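/- **$L$-functions.** Let $d\ge 1$. An $L$-function of degree $d$, $L(f,s)$, consists of coefficients $\lambda_f(n)\in\mathbb C$ ($n\ge1$, $\lambda_f(1)=1$), local roots $\alpha_1(p),\dots,\alpha_d(p)\in\mathbb C$ for each prime $p$, parameters $\kappa_1,\dots,\kappa_d\in\mathbb C$, a conductor $q(f)\in\mathbb Z_{\ge1}$ and a root number $\epsilon(f)\in\mathbb C$ with $|\epsilon(f)|=1$, such that: 1. for $\mathrm{Re}(s)>1$, $$L(f,s)=\sum_{n\ge1}\frac{\lambda_f(n)}{n^{s}}=\prod_p\prod_{i=1}^d\Big(1-\frac{\alpha_i(p)}{p^{s}}\Big)^{-1},$$ where the series, and the product over $p$, converge absolutely; $|\alpha_i(p)|<p$ for all $p$ and $i$, and $\alpha_i(p)\ne0$ if $p\nmid q(f)$; 2. $\mathrm{Re}(\kappa_j)>-1$ for all $j$; put $\gamma(f,s)=\pi^{-ds/2}\prod_{j=1}^d\Gamma\big(\tfrac{s+\kappa_j}{2}\big)$; 3. $\Lambda(f,s)=q(f)^{s/2}\gamma(f,s)L(f,s)$ continues to a meromorphic function on $\mathbb C$ of order at most $1$, with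 poles at most at $s=0$ and $s=1$, and satisfies $\Lambda(f,s)=\epsilon(f)\,\Lambda(\bar f,1-s)$, where $\Lambda(\bar f,s)=\overline{\Lambda(f,\bar s)}$ (this is the completed $L$-function with coefficients $\overline{\lambda_f(n)}$, parameters $\overline{\kappa_j}$ and conductor $q(f)$). For other $s$, $L(f,s)$ denotes the meromorphic continuation. The analytic conductor is $q(f,s)=q(f)\prod_{j=1}^d(|s+\kappa_j|+3)$. **Proposition.** For every integer $d\ge1$ and every $\varepsilon>0$ there is a constant $C=C(d,\varepsilon)>0$ such that the following holds. Let $L(f,s)$ be an $L$-function of degree $d$, let $T_0\in\mathbb R$, $T>0$ and $Q\in\mathbb R$, and suppose that $q(f,\tfrac12+it)\le Q$ for all $t$ with $T_0-T\le t\le T_0+T$. If $T\ge Q^{\varepsilon}$, then $$\int_{T_0-T}^{T_0+T}\big|L(f,\tfrac12+it)\big|^2\,dt\;\ge\;T-C\,Q^{-99}.$$ -/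

import Mathlib

noncomputable section

/-- The gamma factor `γ(s) = π^{-ds/2} ∏_j Γ((s + κ_j)/2)`. -/
def gammaFactor {d : ℕ} (κ : Fin d → ℂ) (s : ℂ) : ℂ :=
  (Real.pi : ℂ) ^ (-((d : ℂ) * s) / 2) * ∏ j, Complex.Gamma ((s + κ j) / 2)

/-- An `L`-function of degree `d`, in the sense of analytic number theory: a Dirichlet series with
an Euler product of degree `d`, whose completion by a gamma factor and a conductor continues
meromorphically to `ℂ` with finite order `1` and poles at most at `0` and `1`, and satisfies a
functional equation relating it to its dual. -/
structure LFunction (d : ℕ) where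
  /-- the Dirichlet coefficients `λ_f(n)`, `n ≥ 1` (the value at `0` plays no role) -/
  coeff : ℕ → ℂ
  /-- the local roots `α_i(p)` (only the values at primes play a role) -/
  localRoot : ℕ → Fin d → ℂ
  /-- the local parameters `κ_j` at infinity -/
  kappa : Fin d → ℂ
  /-- the (arithmetic) conductor `q(f)` -/
  conductor : ℕ
  /-- the root number `ε(f)` -/
  rootNumber : ℂ
  /-- the completed function `Λ(f, s)`; its values at `0` and `1` play no role -/
  completed : ℂ → ℂ
  coeff_one : coeff 1 = 1
  /-- the Dirichlet series converges absolutely for `Re s > 1` -/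
  summable : ∀ s : ℂ, 1 < s.re → LSeriesSummable coeff s
  /-- the Euler product converges absolutely for `Re s > 1` ... -/
  euler_summable : ∀ s : ℂ, 1 < s.re → Summable fun p : Nat.Primes =>
    ‖(∏ i, (1 - localRoot p i * ((p : ℕ) : ℂ) ^ (-s))⁻¹) - 1‖
  /-- ... and is equal to the Dirichlet series there -/
  euler_product : ∀ s : ℂ, 1 < s.re → HasProd (fun p : Nat.Primes =>
    ∏ i, (1 - localRoot p i * ((p : ℕ) : ℂ) ^ (-s))⁻¹) (LSeries coeff s)
  norm_localRoot_lt : ∀ p : ℕ, p.Prime → ∀ i, ‖localRoot p i‖ < p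
  kappa_re : ∀ j, -1 < (kappa j).re
  conductor_pos : 1 ≤ conductor
  localRoot_ne_zero : ∀ p : ℕ, p.Prime → ¬ p ∣ conductor → ∀ i, localRoot p i ≠ 0
  /-- `Λ(f, s) = q(f)^{s/2} γ(f, s) L(f, s)` in the half plane of absolute convergence -/
  completed_eq : ∀ s : ℂ, 1 < s.re →
    completed s = (conductor : ℂ) ^ (s / 2) * gammaFactor kappa s * LSeries coeff s
  /-- `Λ(f, ·)` is meromorphic on `ℂ` ... -/
  meromorphic : MeromorphicOn completed Set.univ
  /-- ... holomorphic away from `0` and `1` ... -/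
  differentiableOn : DifferentiableOn ℂ completed {0, 1}ᶜ
  /-- ... and of order (at most) `1`. -/
  order_one : ∀ η : ℝ, 0 < η → ∃ C : ℝ, ∀ s : ℂ, 2 ≤ ‖s‖ →
    ‖completed s‖ ≤ C * Real.exp (‖s‖ ^ (1 + η))
  norm_rootNumber : ‖rootNumber‖ = 1
  /-- The functional equation `Λ(f, s) = ε(f) Λ(f̄, 1 - s)`. The dual `f̄` has coefficients
  `conj λ_f(n)`, parameters `conj κ_j` and the conductor of `f`, so that `Λ(f̄, s)` is
  `conj Λ(f, conj s)`, see `LFunction.conj_completed_conj`. -/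
  functional_equation : ∀ s : ℂ, s ≠ 0 → s ≠ 1 →
    completed s = rootNumber * (starRingEnd ℂ) (completed (starRingEnd ℂ (1 - s)))

namespace LFunction

variable {d : ℕ}

/-- The continued `L`-function, `L(f, s) = Λ(f, s) / (q(f)^{s/2} γ(f, s))`. The reciprocal of each
gamma function is entire (and `(Complex.Gamma z)⁻¹` has its true value `0` at the poles of `Γ`), so
this is the meromorphic continuation of the Dirichlet series, at every `s ≠ 0, 1`. -/
def L (f : LFunction d) (s : ℂ) : ℂ :=
  f.completed s * ((f.conductor : ℂ) ^ (s / 2) * gammaFactor f.kappa s)⁻¹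

/-- The analytic conductor `q(f, s) = q(f) ∏_j (|s + κ_j| + 3)`. -/
def analyticConductor (f : LFunction d) (s : ℂ) : ℝ :=
  f.conductor * ∏ j, (‖s + f.kappa j‖ + 3)

/-- `L(f, s)` is given by the Dirichlet series for `Re s > 1`. -/
theorem L_eq_LSeries (f : LFunction d) {s : ℂ} (hs : 1 < s.re) :
    f.L s = LSeries f.coeff s := by
  have h1 : (f.conductor : ℂ) ^ (s / 2) ≠ 0 := by
    have := f.conductor_pos
    rw [Ne, Complex.cpow_eq_zero_iff]
    rintro ⟨h, -⟩
    norm_cast at h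
    omega
  have h2 : gammaFactor f.kappa s ≠ 0 := by
    refine mul_ne_zero ?_ (Finset.prod_ne_zero_iff.2 fun j _ => ?_)
    · rw [Ne, Complex.cpow_eq_zero_iff]
      rintro ⟨h, -⟩
      exact Real.pi_ne_zero (by exact_mod_cast h)
    · refine Complex.Gamma_ne_zero_of_re_pos ?_
      have h3 := f.kappa_re j
      have : ((s + f.kappa j) / 2).re = (s.re + (f.kappa j).re) / 2 := by simp
      rw [this]
      linarith
  rw [L, f.completed_eq s hs]
  field_simp

/-- `conj Λ(f, conj s)` is the completed `L`-function of the dual of `f`. -/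
theorem conj_completed_conj (f : LFunction d) {s : ℂ} (hs : 1 < s.re) :
    (starRingEnd ℂ) (f.completed (starRingEnd ℂ s)) =
      (f.conductor : ℂ) ^ (s / 2) * gammaFactor (fun j => starRingEnd ℂ (f.kappa j)) s *
        LSeries (fun n => starRingEnd ℂ (f.coeff n)) s := by
  have hpow : ∀ (x : ℝ) (z : ℂ), 0 ≤ x →
      (starRingEnd ℂ) ((x : ℂ) ^ z) = (x : ℂ) ^ (starRingEnd ℂ z) := by
    intro x z hx
    have harg : (x : ℂ).arg ≠ Real.pi := by
      rw [Complex.arg_ofReal_of_nonneg hx]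
      exact Real.pi_ne_zero.symm
    have h := Complex.cpow_conj (x : ℂ) z harg
    rw [h, Complex.conj_ofReal]
  have hnat : ∀ (n : ℕ) (z : ℂ),
      (starRingEnd ℂ) ((n : ℂ) ^ z) = (n : ℂ) ^ (starRingEnd ℂ z) := by
    intro n z
    have := hpow n z n.cast_nonneg
    push_cast at this
    exact this
  rw [f.completed_eq _ (by simpa using hs), map_mul, map_mul, hnat]
  congr 1
  · congr 1
    · simp [Complex.conj_ofNat]
    · rw [gammaFactor, gammaFactor, map_mul, hpow _ _ Real.pi_pos.le, map_prod]
      congr 1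
      · simp [Complex.conj_ofNat]
      · refine Finset.prod_congr rfl fun j _ => ?_
        rw [← Complex.Gamma_conj]
        simp [Complex.conj_ofNat]
  · rw [LSeries, LSeries, Complex.conj_tsum]
    refine tsum_congr fun n => ?_
    rcases eq_or_ne n 0 with rfl | hn
    · simp
    · rw [LSeries.term_of_ne_zero hn, LSeries.term_of_ne_zero hn, map_div₀, hnat]
      simp

end LFunction

end

/-! Since `x ≥ 1 + log x` at `x = |L|²`, the second moment is bounded below by a logarithmic mean
(`LFunction.le_integral_norm_L_sq`). It suffices to show that `∫ log |L(1/2 + iτ)| dτ ≥ -T/4` over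
the interval shortened by `2√T` at each end, once `T` is large; bounded `T` is absorbed by the
constant.

Write `u A τ = log |Λ(1/2 + A + iτ)|`. The functional equation makes `|Λ|` symmetric about the
critical line, and `Λ` has order at most `1`. So `u A τ - u B τ` is, up to an arbitrarily small
error, a finite sum over zeros in the strip of differences of `kern`, minus a term from the poles
(`LFunction.exists_kern_expansion`). For a single zero, the integral of `kern (2K) - kern 0` over a
long interval is at most about `2πK`, while that of `kern (2K+2) - kern (2K)` is about `2π`; far
from the zero even the integrands compare with factor `K`. Hence `K(1 + O(1/W)) ∫ (u (2K+2) - u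
(2K))` dominates `∫ (u (2K) - u 0)` taken over an interval shorter by `2W` at each end
(`potential_nonneg`).

The pole term has the wrong sign and a multiplicity with no bound uniform in `f`, so the functional
has to vanish exactly at the pole. A small combination of differences of `u` on the lines `A = 4, 6,
8` at heights `0` and `±1` achieves this without destroying positivity on the strip
(`exists_pole_correction`, `exists_lineFunctional_nonneg`).

Evaluate the resulting inequality for `Λ = q^{s/2} γ L`
(`LFunction.exists_integral_logL_lower_bound`). A shift by `2` multiplies `q^{s/2} γ` by `q π^{-d} ∏
(s + κ_j)/2`. The `K` shifts leading from `A = 0` to `A = 2K` agree on average with `K` times the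
shift at `2K`, so the large terms cancel. On the lines `2K` and `2K + 2` the Euler product gives
`log |L| = O(2^{-2K})` uniformly in `f`. What remains is the required bound, with a loss of a small
multiple of `T` plus `O(√T (1 + log Q + log(10 + 2T)))`, which is `o(T)` because `log Q ≤ (log
T)/ε`. -/

section
-- Entire functions of order less than two: second differences of `log ‖F‖` from zeros
open Complex Metric Set Filter Topology

theorem norm_prod_sub_le {S : Multiset ℂ} {R : ℝ} (hS : ∀ ρ ∈ S, ‖ρ‖ ≤ R) :
    ‖(S.map fun ρ => (0 : ℂ) - ρ).prod‖ ≤ R ^ S.card := by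
  induction S using Multiset.induction_on with
  | empty => simp
  | cons a S ih =>
    simp only [Multiset.map_cons, Multiset.prod_cons, norm_mul, Multiset.card_cons, pow_succ']
    gcongr
    · exact (norm_nonneg a).trans (hS a (by simp))
    · simpa using hS a (by simp)
    · exact ih fun ρ hρ => hS ρ (Multiset.mem_cons_of_mem hρ)

theorem le_norm_prod_sub {S : Multiset ℂ} {R : ℝ} (hS : ∀ ρ ∈ S, ‖ρ‖ ≤ R) {z : ℂ}
    {k : ℝ} (hk : 0 ≤ k) (hz : R + k ≤ ‖z‖) :
    k ^ S.card ≤ ‖(S.map fun ρ => z - ρ).prod‖ := by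
  induction S using Multiset.induction_on with
  | empty => simp
  | cons a S ih =>
    simp only [Multiset.map_cons, Multiset.prod_cons, norm_mul, Multiset.card_cons, pow_succ']
    gcongr
    · have h1 := hS a (by simp)
      have h2 := norm_sub_norm_le z a
      linarith
    · exact ih fun ρ hρ => hS ρ (Multiset.mem_cons_of_mem hρ)

/-- The cofactor is bounded in terms of the original function: the maximum principle. -/
theorem norm_cofactor_mul_le {F G : ℂ → ℂ} {S : Multiset ℂ} {R k M : ℝ} (hR : 0 < R) (hk : 0 < k)
    (hG : Differentiable ℂ G) (hS : ∀ ρ ∈ S, ‖ρ‖ ≤ R)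
    (hFG : ∀ z, F z = (S.map fun ρ => z - ρ).prod * G z)
    (hM : ∀ z, ‖z‖ = R + k → ‖F z‖ ≤ M) {z : ℂ} (hz : ‖z‖ ≤ R + k) :
    ‖G z‖ * k ^ S.card ≤ M := by
  have hpos : 0 < k ^ S.card := by positivity
  rw [← le_div_iff₀ hpos]
  have hmem : z ∈ closure (ball (0 : ℂ) (R + k)) := by
    rw [closure_ball _ (by positivity)]; simpa using hz
  refine Complex.norm_le_of_forall_mem_frontier_norm_le (U := ball 0 (R + k)) isBounded_ball
    hG.diffContOnCl ?_ hmem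
  intro w hw
  rw [frontier_ball _ (by positivity)] at hw
  have hw' : ‖w‖ = R + k := by simpa using hw
  rw [le_div_iff₀ hpos]
  have h1 := le_norm_prod_sub hS hk.le hw'.ge
  calc ‖G w‖ * k ^ S.card ≤ ‖G w‖ * ‖(S.map fun ρ => w - ρ).prod‖ := by gcongr
    _ = ‖F w‖ := by rw [hFG w, norm_mul, mul_comm]
    _ ≤ M := hM w hw'

/-- Finite factorization of an entire function over a disc. -/
theorem exists_zero_factorization {F : ℂ → ℂ} (hF : Differentiable ℂ F) (h0 : F 0 ≠ 0)
    {R : ℝ} (hR : 0 < R) :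
    ∃ (S : Multiset ℂ) (G : ℂ → ℂ), Differentiable ℂ G ∧ (∀ ρ ∈ S, ‖ρ‖ ≤ R) ∧
      (∀ z, ‖z‖ ≤ R → G z ≠ 0) ∧ ∀ z, F z = (S.map fun ρ => z - ρ).prod * G z := by
  by_contra hcon
  push Not at hcon
  have key : ∀ n : ℕ, ∃ (S : Multiset ℂ) (G : ℂ → ℂ), S.card = n ∧ Differentiable ℂ G ∧
      (∀ ρ ∈ S, ‖ρ‖ ≤ R) ∧ ∀ z, F z = (S.map fun ρ => z - ρ).prod * G z := by
    intro n
    induction n with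
    | zero => exact ⟨0, F, by simp, hF, by simp, by simp⟩
    | succ n ih =>
      obtain ⟨S, G, hcard, hG, hS, hFG⟩ := ih
      have hzero : ∃ z, ‖z‖ ≤ R ∧ G z = 0 := by
        by_contra hno
        push Not at hno
        obtain ⟨z, hz⟩ := hcon S G hG hS hno
        exact hz (hFG z)
      obtain ⟨a, ha, hGa⟩ := hzero
      refine ⟨a ::ₘ S, dslope G a, by simp [hcard], ?_, ?_, ?_⟩
      · rw [← differentiableOn_univ] at hG ⊢
        exact (differentiableOn_dslope univ_mem).2 hG
      · intro ρ hρ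
        rcases Multiset.mem_cons.1 hρ with rfl | h
        exacts [ha, hS ρ h]
      · intro z
        have h1 := sub_smul_dslope G a z
        rw [hGa, sub_zero, smul_eq_mul] at h1
        rw [hFG z, Multiset.map_cons, Multiset.prod_cons, ← h1]
        ring
  -- The sphere of radius `3R` forces the division to stop: each zero costs a factor at least `2R`
  -- there but at most `R` at the origin, so `n` zeros give `‖F 0‖ 2^n ≤ M`.
  obtain ⟨M, hM⟩ := (isCompact_sphere (0 : ℂ) (R + 2 * R)).exists_bound_of_continuousOn
    hF.continuous.continuousOn
  obtain ⟨n, hn⟩ := exists_nat_gt (M / ‖F 0‖)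
  obtain ⟨S, G, hcard, hG, hS, hFG⟩ := key n
  have h1 := norm_cofactor_mul_le hR (k := 2 * R) (by positivity) hG hS hFG
    (fun z hz => hM z (by simpa using hz)) (z := 0) (by simp; positivity)
  have h2 := norm_prod_sub_le hS
  have h3 : ‖F 0‖ ≤ R ^ n * ‖G 0‖ := by
    rw [hFG 0, norm_mul]
    rw [hcard] at h2
    gcongr
  have h4 : ‖F 0‖ * 2 ^ n ≤ M := by
    calc ‖F 0‖ * 2 ^ n ≤ R ^ n * ‖G 0‖ * 2 ^ n := by gcongr
      _ = ‖G 0‖ * (2 * R) ^ n := by rw [mul_pow]; ring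
      _ ≤ M := by rw [hcard] at h1; exact h1
  have hpos : 0 < ‖F 0‖ := norm_pos_iff.2 h0
  rw [div_lt_iff₀ hpos] at hn
  have h5 : (n : ℝ) ≤ 2 ^ n := by exact_mod_cast (Nat.lt_two_pow_self (n := n)).le
  nlinarith

/-- Second differences of `log ‖G‖` are small inside a large zero-free disc. -/
theorem abs_second_difference_log_norm_le {G : ℂ → ℂ} (hG : Differentiable ℂ G) {R B : ℝ}
    (hR : 0 < R) (hB : 0 < B) (hne : ∀ z, ‖z‖ ≤ R → G z ≠ 0)
    (hb : ∀ z, ‖z‖ ≤ R → Real.log ‖G z‖ - Real.log ‖G 0‖ ≤ B) {w a : ℂ} (hw : ‖w‖ ≤ R / 16)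
    (ha : ‖a‖ ≤ R / 16) :
    |Real.log ‖G (w + a)‖ + Real.log ‖G (w - a)‖ - 2 * Real.log ‖G w‖| ≤
      128 * B / R ^ 2 * ‖a‖ ^ 2 := by
  have hharm : InnerProductSpace.HarmonicOnNhd (fun z => Real.log ‖G z‖) (ball 0 R) := by
    intro z hz
    exact (hG.analyticAt z).harmonicAt_log_norm (hne z (by simpa using (mem_ball_zero_iff.1 hz).le))
  obtain ⟨H, hH, hHre⟩ := hharm.exists_analyticOnNhd_ball_re_eq
  set h : ℂ → ℂ := fun z => H z - H 0 with hdef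
  have hre : ∀ z ∈ ball (0 : ℂ) R, (h z).re = Real.log ‖G z‖ - Real.log ‖G 0‖ := by
    intro z hz
    have h1 := hHre hz
    have h2 := hHre (mem_ball_self hR)
    simp only at h1 h2
    simp [hdef, h1, h2]
  have hd : DifferentiableOn ℂ h (ball 0 R) := hH.differentiableOn.sub_const _
  have hd' : DifferentiableOn ℂ (deriv h) (ball 0 R) := hd.deriv isOpen_ball
  have hbound : ∀ z, ‖z‖ ≤ R / 2 → ‖h z‖ ≤ 2 * B := by
    intro z hz
    have hzR : z ∈ ball (0 : ℂ) R := by rw [mem_ball_zero_iff]; linarith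
    -- The one-sided bound on `Re h = log ‖G‖ - log ‖G 0‖` controls `‖h‖` on half the disc; two
    -- Cauchy estimates then bound `h''`.
    have h1 := borelCaratheodory_zero hB hd (fun x hx => by
      simp only [mem_ofPred_eq]
      rw [hre x hx]
      exact hb x (mem_ball_zero_iff.1 hx).le) hR hzR (by simp [hdef])
    refine h1.trans ?_
    rw [div_le_iff₀ (by linarith)]
    nlinarith
  have hsub : ∀ {z : ℂ} {r₁ r₂ : ℝ}, ‖z‖ ≤ r₁ → r₁ + r₂ < R → closedBall z r₂ ⊆ ball 0 R := by
    intro z r₁ r₂ h1 h2 x hx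
    rw [mem_ball_zero_iff]
    have h3 : ‖x - z‖ ≤ r₂ := by simpa [dist_eq_norm] using hx
    have h4 := norm_le_norm_add_norm_sub' x z
    linarith
  have hcl : ∀ {k : ℂ → ℂ} {z : ℂ} {r₁ r₂ : ℝ}, DifferentiableOn ℂ k (ball 0 R) → 0 < r₂ →
      ‖z‖ ≤ r₁ → r₁ + r₂ < R → DiffContOnCl ℂ k (ball z r₂) := by
    intro k z r₁ r₂ hk h0 h1 h2
    refine DifferentiableOn.diffContOnCl ?_
    rw [closure_ball _ h0.ne']
    exact hk.mono (hsub h1 h2)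
  have hb1 : ∀ z, ‖z‖ ≤ R / 4 → ‖deriv h z‖ ≤ 2 * B / (R / 4) := by
    intro z hz
    refine norm_deriv_le_of_forall_mem_sphere_norm_le (by positivity)
      (hcl hd (by positivity) hz (by linarith)) fun x hx => hbound x ?_
    have h3 : ‖x - z‖ = R / 4 := by simpa [dist_eq_norm] using hx
    have h4 := norm_le_norm_add_norm_sub' x z
    linarith
  have hb2 : ∀ z, ‖z‖ ≤ R / 8 → ‖deriv (deriv h) z‖ ≤ 2 * B / (R / 4) / (R / 8) := by
    intro z hz
    refine norm_deriv_le_of_forall_mem_sphere_norm_le (by positivity)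
      (hcl hd' (by positivity) hz (by linarith)) fun x hx => hb1 x ?_
    have h3 : ‖x - z‖ = R / 8 := by simpa [dist_eq_norm] using hx
    have h4 := norm_le_norm_add_norm_sub' x z
    linarith
  have hin : ∀ {b : ℂ}, ‖b‖ ≤ R / 16 → ‖w + b‖ ≤ R / 8 ∧ ‖w - b‖ ≤ R / 8 := by
    intro b hb
    have h1 := norm_add_le w b
    have h2 := norm_sub_le w b
    constructor <;> linarith
  have hat : ∀ {k : ℂ → ℂ} {z : ℂ}, DifferentiableOn ℂ k (ball 0 R) → ‖z‖ ≤ R / 8 →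
      DifferentiableAt ℂ k z := by
    intro k z hk hz
    exact hk.differentiableAt (isOpen_ball.mem_nhds (by rw [mem_ball_zero_iff]; linarith))
  have hlip : ∀ {x y : ℂ}, ‖x‖ ≤ R / 8 → ‖y‖ ≤ R / 8 →
      ‖deriv h y - deriv h x‖ ≤ 2 * B / (R / 4) / (R / 8) * ‖y - x‖ := by
    intro x y hx hy
    refine Convex.norm_image_sub_le_of_norm_deriv_le (s := closedBall 0 (R / 8))
      (fun z hz => hat hd' (by simpa using hz)) (fun z hz => hb2 z (by simpa using hz))
      (convex_closedBall _ _) (by simpa using hx) (by simpa using hy)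
  -- The derivative `h'(w + b) - h'(w - b)` of `φ` is at most `sup |h''| · 2|b|`, which turns the
  -- bound `64B/R²` for `h''` into the constant `128B/R²`.
  set φ : ℂ → ℂ := fun b => h (w + b) + h (w - b) with hφ
  have hder : ∀ b : ℂ, ‖b‖ ≤ R / 16 → HasDerivAt φ (deriv h (w + b) - deriv h (w - b)) b := by
    intro b hb
    have h1 := (hat hd (hin hb).1).hasDerivAt.comp_const_add w b
    have h2 := (hat hd (hin hb).2).hasDerivAt.comp_const_sub w b
    exact (h1.add h2).congr_deriv (by ring)
  have hmain : ‖φ a - φ 0‖ ≤ 2 * B / (R / 4) / (R / 8) * (2 * ‖a‖) * ‖a - 0‖ := by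
    refine Convex.norm_image_sub_le_of_norm_deriv_le (s := closedBall 0 ‖a‖)
      (fun z hz => ?_) (fun z hz => ?_) (convex_closedBall _ _) (by simp) (by simp)
    · exact (hder z ((by simpa using hz : ‖z‖ ≤ ‖a‖).trans ha)).differentiableAt
    · have hz' : ‖z‖ ≤ ‖a‖ := by simpa using hz
      rw [(hder z (hz'.trans ha)).deriv]
      have hzz := hin (hz'.trans ha)
      refine (hlip hzz.2 hzz.1).trans ?_
      gcongr
      have : w + z - (w - z) = 2 * z := by ring
      rw [this, norm_mul]
      simpa using hz'
  have hval : Real.log ‖G (w + a)‖ + Real.log ‖G (w - a)‖ - 2 * Real.log ‖G w‖ =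
      (φ a - φ 0).re := by
    have hm : ∀ {z : ℂ}, ‖z‖ ≤ R / 8 → z ∈ ball (0 : ℂ) R := by
      intro z hz; rw [mem_ball_zero_iff]; linarith
    simp only [hφ, sub_re, add_re, add_zero, sub_zero]
    rw [hre _ (hm (hin ha).1), hre _ (hm (hin ha).2), hre w (hm (by linarith))]
    ring
  rw [hval]
  refine (abs_re_le_norm _).trans (hmain.trans (le_of_eq ?_))
  rw [sub_zero]
  field_simp
  ring

/-- `log` of the norm of a product of linear factors. -/
theorem log_norm_prod_sub {S : Multiset ℂ} {z : ℂ} (hz : (S.map fun ρ => z - ρ).prod ≠ 0) :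
    Real.log ‖(S.map fun ρ => z - ρ).prod‖ = (S.map fun ρ => Real.log ‖z - ρ‖).sum := by
  induction S using Multiset.induction_on with
  | empty => simp
  | cons a S ih =>
    simp only [Multiset.map_cons, Multiset.prod_cons, Multiset.sum_cons] at hz ⊢
    rw [norm_mul, Real.log_mul (by simpa using left_ne_zero_of_mul hz)
      (by simpa using right_ne_zero_of_mul hz), ih (right_ne_zero_of_mul hz)]

/-- For an entire function of order less than two, second differences of `log ‖F‖` are given, up to
an arbitrarily small error, by those of finitely many of its zeros. -/
theorem exists_multiset_second_difference {F : ℂ → ℂ} (hF : Differentiable ℂ F) (h0 : F 0 ≠ 0)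
    (hgrow : ∀ η : ℝ, 0 < η → ∃ R₀ : ℝ, ∀ R ≥ R₀, ∀ z, ‖z‖ = R → ‖F z‖ ≤ Real.exp (η * R ^ 2))
    {η : ℝ} (hη : 0 < η) (M : ℝ) :
    ∃ S : Multiset ℂ, (∀ ρ ∈ S, F ρ = 0) ∧ ∀ w a b : ℂ, ‖w‖ ≤ M → ‖a‖ ≤ M → ‖b‖ ≤ M →
      F (w + a) ≠ 0 → F (w - a) ≠ 0 → F (w + b) ≠ 0 → F (w - b) ≠ 0 →
      |Real.log ‖F (w + a)‖ + Real.log ‖F (w - a)‖ - Real.log ‖F (w + b)‖ - Real.log ‖F (w - b)‖ -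
        (S.map fun ρ => Real.log ‖w + a - ρ‖ + Real.log ‖w - a - ρ‖ - Real.log ‖w + b - ρ‖ -
          Real.log ‖w - b - ρ‖).sum| ≤ η := by
  set N : ℝ := |M| + 1 with hN
  have hNpos : 0 < N := by positivity
  -- With this growth rate `B` is about `ηR²/(512N²)`, so `128BN²/R²` stays below `η/2` for large
  -- `R`. Each of the two second differences uses half of `η`.
  obtain ⟨R₀, hR₀⟩ := hgrow (η / (2048 * N ^ 2)) (by positivity)
  obtain ⟨R, hRlarge⟩ : ∃ R : ℝ, R₀ ≤ R ∧ 16 * N ≤ R ∧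
      2048 * N ^ 2 * (1 + |Real.log ‖F 0‖|) ≤ η * R ^ 2 := by
    have ht : Tendsto (fun R : ℝ => η * R ^ 2) atTop atTop :=
      (tendsto_pow_atTop two_ne_zero).const_mul_atTop hη
    obtain ⟨R, h1, h2, h3⟩ := ((eventually_ge_atTop R₀).and ((eventually_ge_atTop (16 * N)).and
      (ht.eventually_ge_atTop (2048 * N ^ 2 * (1 + |Real.log ‖F 0‖|))))).exists
    exact ⟨R, h1, h2, h3⟩
  obtain ⟨hR1, hR2, hR3⟩ := hRlarge
  have hR : 0 < R := by nlinarith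
  obtain ⟨S, G, hG, hS, hGne, hFG⟩ := exists_zero_factorization hF h0 hR
  have hprod0 : ∀ z, F z ≠ 0 → (S.map fun ρ => z - ρ).prod ≠ 0 := fun z hz h => hz (by
    rw [hFG z, h, zero_mul])
  set B : ℝ := η / (2048 * N ^ 2) * (R + R) ^ 2 + |Real.log ‖F 0‖| + 1 with hBdef
  have hB : 0 < B := by positivity
  have hbb : ∀ z, ‖z‖ ≤ R → Real.log ‖G z‖ - Real.log ‖G 0‖ ≤ B := by
    intro z hz
    have h1 := norm_cofactor_mul_le hR hR hG hS hFG
      (fun z hz => hR₀ (R + R) (by linarith) z hz) (z := z) (by linarith)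
    have h2 := norm_prod_sub_le hS
    have hG0 : 0 < ‖G 0‖ := norm_pos_iff.2 (hGne 0 (by simpa using hR.le))
    have hGz : 0 < ‖G z‖ := norm_pos_iff.2 (hGne z hz)
    have hRS : 0 < R ^ S.card := by positivity
    have h3 : ‖F 0‖ ≤ R ^ S.card * ‖G 0‖ := by
      rw [hFG 0, norm_mul]; gcongr
    -- The power `R ^ S.card` occurs in the upper bound for `‖G z‖` and in the lower bound for `‖G
    -- 0‖`. It cancels, so the number of zeros does not enter.
    have h4 := Real.log_le_log (mul_pos hGz hRS) h1
    have h5 := Real.log_le_log (norm_pos_iff.2 h0) h3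
    rw [Real.log_mul hGz.ne' hRS.ne', Real.log_exp] at h4
    rw [Real.log_mul hRS.ne' hG0.ne'] at h5
    have h6 := neg_abs_le (Real.log ‖F 0‖)
    simp only [hBdef]
    linarith
  have herr : 128 * B / R ^ 2 * N ^ 2 ≤ η / 2 := by
    rw [div_mul_eq_mul_div, div_le_iff₀ (by positivity)]
    have h1 : 2048 * N ^ 2 * B = 4 * η * R ^ 2 + 2048 * N ^ 2 * (1 + |Real.log ‖F 0‖|) := by
      simp only [hBdef]
      field_simp
      ring
    nlinarith
  refine ⟨S, fun ρ hρ => ?_, ?_⟩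
  · rw [hFG ρ, Multiset.prod_eq_zero (Multiset.mem_map.2 ⟨ρ, hρ, sub_self ρ⟩), zero_mul]
  intro w a b hw ha hb h1 h2 h3 h4
  have hMN : M ≤ N := by have := le_abs_self M; linarith
  have hw' : ‖w‖ ≤ R / 16 := by linarith
  have e1 := abs_second_difference_log_norm_le hG hR hB hGne hbb hw' (a := a) (by linarith)
  have e2 := abs_second_difference_log_norm_le hG hR hB hGne hbb hw' (a := b) (by linarith)
  have hcoef : ∀ {x : ℂ}, ‖x‖ ≤ M → 128 * B / R ^ 2 * ‖x‖ ^ 2 ≤ η / 2 := by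
    intro x hx
    refine le_trans ?_ herr
    gcongr
    exact hx.trans hMN
  have e1' := e1.trans (hcoef ha)
  have e2' := e2.trans (hcoef hb)
  have hlog : ∀ {z : ℂ}, F z ≠ 0 →
      Real.log ‖F z‖ = (S.map fun ρ => Real.log ‖z - ρ‖).sum + Real.log ‖G z‖ := by
    intro z hz
    have hp := hprod0 z hz
    have hGz : G z ≠ 0 := fun h => hz (by rw [hFG z, h, mul_zero])
    rw [hFG z, norm_mul, Real.log_mul (by simpa using hp) (by simpa using hGz),
      log_norm_prod_sub hp]
  rw [Multiset.sum_map_sub, Multiset.sum_map_sub, Multiset.sum_map_add, hlog h1, hlog h2, hlog h3,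
    hlog h4]
  rw [abs_le] at e1' e2' ⊢
  constructor <;> linarith [e1'.1, e1'.2, e2'.1, e2'.2]

end

/-! ### The half plane of absolute convergence; the entire completion and its growth -/

noncomputable section
open Complex Metric Set Filter Topology

namespace LFunction

variable {d : ℕ}

theorem norm_localRoot_mul_le (f : LFunction d) {p : ℕ} (hp : p.Prime) (i : Fin d) (s : ℂ) :
    ‖f.localRoot p i * (p : ℂ) ^ (-s)‖ ≤ (p : ℝ) ^ (1 - s.re) := by
  have hp0 : (0 : ℝ) < p := by exact_mod_cast hp.pos
  rw [norm_mul, norm_natCast_cpow_of_pos hp.pos, neg_re, sub_eq_add_neg, Real.rpow_add hp0,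
    Real.rpow_one]
  gcongr
  exact (f.norm_localRoot_lt p hp i).le

theorem one_sub_localRoot_ne_zero (f : LFunction d) {p : ℕ} (hp : p.Prime) (i : Fin d) {s : ℂ}
    (hs : 1 < s.re) : 1 - f.localRoot p i * (p : ℂ) ^ (-s) ≠ 0 := by
  intro h
  have h1 := f.norm_localRoot_mul_le hp i s
  rw [← sub_eq_zero.1 h, norm_one] at h1
  have h2 : (p : ℝ) ^ (1 - s.re) < 1 :=
    Real.rpow_lt_one_of_one_lt_of_neg (by exact_mod_cast hp.one_lt) (by linarith)
  linarith

/-- An `L`-function does not vanish in the half plane of absolute convergence. -/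
theorem LSeries_ne_zero (f : LFunction d) {s : ℂ} (hs : 1 < s.re) : LSeries f.coeff s ≠ 0 := by
  have h1 := f.euler_product s hs
  have h2 := tprod_one_add_ne_zero_of_summable (R := ℂ) (f := fun p : Nat.Primes =>
    (∏ i, (1 - f.localRoot p i * ((p : ℕ) : ℂ) ^ (-s))⁻¹) - 1) (fun p => by
      rw [add_sub_cancel]
      exact Finset.prod_ne_zero_iff.2 fun i _ =>
        inv_ne_zero (f.one_sub_localRoot_ne_zero p.2 i hs)) (f.euler_summable s hs)
  simp only [add_sub_cancel] at h2
  rwa [h1.tprod_eq] at h2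

theorem abs_log_norm_one_sub_le {z : ℂ} (hz : ‖z‖ ≤ 1 / 2) : |Real.log ‖1 - z‖| ≤ 2 * ‖z‖ := by
  have h1 : 1 - ‖z‖ ≤ ‖1 - z‖ := by simpa using norm_sub_norm_le (1 : ℂ) z
  have h2 : ‖1 - z‖ ≤ 1 + ‖z‖ := by simpa using norm_sub_le (1 : ℂ) z
  have h0 := norm_nonneg z
  have hpos : 0 < ‖1 - z‖ := by linarith
  rw [abs_le]
  constructor
  · have h3 := Real.one_sub_inv_le_log_of_pos hpos
    have h4 : ‖1 - z‖⁻¹ ≤ 1 + 2 * ‖z‖ := by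
      rw [inv_le_comm₀ hpos (by positivity), inv_le_iff_one_le_mul₀ (by positivity)]
      nlinarith
    linarith
  · have h3 := Real.log_le_sub_one_of_pos hpos
    linarith

/-- The logarithm of an `L`-function decays exponentially, uniformly in the `L`-function. -/
theorem exists_abs_log_norm_LSeries_le (d : ℕ) : ∃ C : ℝ, 0 ≤ C ∧ ∀ (f : LFunction d) (s : ℂ),
    4 ≤ s.re → |Real.log ‖LSeries f.coeff s‖| ≤ C * 2 ^ (-s.re) := by
  have hsum : Summable fun p : Nat.Primes => ((p : ℕ) : ℝ) ^ (-2 : ℝ) :=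
    Nat.Primes.summable_rpow.2 (by norm_num)
  set Z : ℝ := ∑' p : Nat.Primes, ((p : ℕ) : ℝ) ^ (-2 : ℝ) with hZ
  have hZ0 : 0 ≤ Z := tsum_nonneg fun p => by positivity
  refine ⟨16 * d * Z, by positivity, fun f s hs => ?_⟩
  have hs1 : 1 < s.re := by linarith
  set B : ℝ := 16 * d * Z * 2 ^ (-s.re) with hB
  have hprod := (f.euler_product s hs1).norm
  have hfactor : ∀ p : Nat.Primes, |Real.log ‖∏ i, (1 - f.localRoot p i * ((p : ℕ) : ℂ) ^ (-s))⁻¹‖|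
      ≤ 16 * d * 2 ^ (-s.re) * ((p : ℕ) : ℝ) ^ (-2 : ℝ) := by
    intro p
    have hp2 : (2 : ℝ) ≤ (p : ℕ) := by exact_mod_cast p.2.two_le
    have hp0 : (0 : ℝ) < (p : ℕ) := by linarith
    -- Splitting off `p^{-2}` keeps the sum over primes convergent; the remaining `p^{3-σ}` is
    -- largest at `p = 2`, which produces the decay `2^{-σ}`.
    have hpow : ((p : ℕ) : ℝ) ^ (1 - s.re) ≤ 8 * 2 ^ (-s.re) * ((p : ℕ) : ℝ) ^ (-2 : ℝ) := by
      have e1 : ((p : ℕ) : ℝ) ^ (1 - s.re) =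
          ((p : ℕ) : ℝ) ^ (3 - s.re) * ((p : ℕ) : ℝ) ^ (-2 : ℝ) := by
        rw [← Real.rpow_add hp0]; congr 1; ring
      have e2 : (8 : ℝ) * 2 ^ (-s.re) = 2 ^ (3 - s.re) := by
        rw [sub_eq_add_neg, Real.rpow_add two_pos]; norm_num
      rw [e1, e2]
      exact mul_le_mul_of_nonneg_right (Real.rpow_le_rpow_of_nonpos two_pos hp2 (by linarith))
        (by positivity)
    have hhalf : ((p : ℕ) : ℝ) ^ (1 - s.re) ≤ 1 / 2 := by
      calc ((p : ℕ) : ℝ) ^ (1 - s.re) ≤ ((p : ℕ) : ℝ) ^ (-1 : ℝ) :=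
            Real.rpow_le_rpow_of_exponent_le (by linarith) (by linarith)
        _ ≤ 1 / 2 := by
            rw [Real.rpow_neg_one, one_div]
            exact inv_anti₀ two_pos hp2
    rw [norm_prod, Real.log_prod (fun i _ => by
      simpa using f.one_sub_localRoot_ne_zero p.2 i hs1)]
    calc |∑ i, Real.log ‖(1 - f.localRoot p i * ((p : ℕ) : ℂ) ^ (-s))⁻¹‖|
        ≤ ∑ i, |Real.log ‖(1 - f.localRoot p i * ((p : ℕ) : ℂ) ^ (-s))⁻¹‖| :=
          Finset.abs_sum_le_sum_abs _ _
      _ ≤ ∑ _i : Fin d, 2 * (8 * 2 ^ (-s.re) * ((p : ℕ) : ℝ) ^ (-2 : ℝ)) := by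
          refine Finset.sum_le_sum fun i _ => ?_
          have h1 := f.norm_localRoot_mul_le p.2 i s
          rw [norm_inv, Real.log_inv, abs_neg]
          refine (abs_log_norm_one_sub_le (h1.trans hhalf)).trans ?_
          gcongr
          exact h1.trans hpow
      _ = 16 * d * 2 ^ (-s.re) * ((p : ℕ) : ℝ) ^ (-2 : ℝ) := by simp; ring
  have hpos : ∀ p : Nat.Primes, 0 < ‖∏ i, (1 - f.localRoot p i * ((p : ℕ) : ℂ) ^ (-s))⁻¹‖ := by
    intro p
    exact norm_pos_iff.2 (Finset.prod_ne_zero_iff.2 fun i _ =>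
      inv_ne_zero (f.one_sub_localRoot_ne_zero p.2 i hs1))
  have hfin : ∀ t : Finset Nat.Primes,
      |Real.log (∏ p ∈ t, ‖∏ i, (1 - f.localRoot p i * ((p : ℕ) : ℂ) ^ (-s))⁻¹‖)| ≤ B := by
    intro t
    rw [Real.log_prod (fun p _ => (hpos p).ne')]
    calc _ ≤ ∑ p ∈ t, |Real.log ‖∏ i, (1 - f.localRoot p i * ((p : ℕ) : ℂ) ^ (-s))⁻¹‖| :=
          Finset.abs_sum_le_sum_abs _ _
      _ ≤ ∑ p ∈ t, 16 * d * 2 ^ (-s.re) * ((p : ℕ) : ℝ) ^ (-2 : ℝ) :=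
          Finset.sum_le_sum fun p _ => hfactor p
      _ = 16 * d * 2 ^ (-s.re) * ∑ p ∈ t, ((p : ℕ) : ℝ) ^ (-2 : ℝ) := by rw [Finset.mul_sum]
      _ ≤ 16 * d * 2 ^ (-s.re) * Z := by
          gcongr
          exact hsum.sum_le_tsum t fun p _ => by positivity
      _ = B := by rw [hB]; ring
  have hL : ‖LSeries f.coeff s‖ ≠ 0 := norm_ne_zero_iff.2 (f.LSeries_ne_zero hs1)
  have htend := ((Real.continuousAt_log hL).tendsto.comp hprod).abs
  exact le_of_tendsto htend (Eventually.of_forall hfin)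

theorem gammaFactor_ne_zero (f : LFunction d) {s : ℂ} (hs : 1 < s.re) :
    gammaFactor f.kappa s ≠ 0 := by
  refine mul_ne_zero ?_ (Finset.prod_ne_zero_iff.2 fun j _ => ?_)
  · rw [Ne, cpow_eq_zero_iff]
    rintro ⟨h, -⟩
    exact Real.pi_ne_zero (by exact_mod_cast h)
  · refine Gamma_ne_zero_of_re_pos ?_
    have h3 := f.kappa_re j
    have : ((s + f.kappa j) / 2).re = (s.re + (f.kappa j).re) / 2 := by simp
    rw [this]
    linarith

theorem conductor_cpow_ne_zero (f : LFunction d) (s : ℂ) : (f.conductor : ℂ) ^ s ≠ 0 := by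
  have := f.conductor_pos
  rw [Ne, cpow_eq_zero_iff]
  rintro ⟨h, -⟩
  norm_cast at h
  omega

theorem completed_ne_zero (f : LFunction d) {s : ℂ} (hs : 1 < s.re) : f.completed s ≠ 0 := by
  rw [f.completed_eq s hs]
  exact mul_ne_zero (mul_ne_zero (f.conductor_cpow_ne_zero _) (f.gammaFactor_ne_zero hs))
    (f.LSeries_ne_zero hs)

/-- The map `s ↦ 1 - conj s` reflects in the critical line and preserves the height, so only
horizontal symmetry of `‖Λ‖` is used later. -/
theorem norm_completed_reflect (f : LFunction d) {s : ℂ} (h0 : s ≠ 0) (h1 : s ≠ 1) :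
    ‖f.completed (1 - starRingEnd ℂ s)‖ = ‖f.completed s‖ := by
  rw [f.functional_equation s h0 h1, norm_mul, f.norm_rootNumber, one_mul, RCLike.norm_conj]
  simp

theorem completed_ne_zero_of_re_neg (f : LFunction d) {s : ℂ} (hs : s.re < 0) :
    f.completed s ≠ 0 := by
  have h0 : s ≠ 0 := by rintro rfl; simp at hs
  have h1 : s ≠ 1 := by rintro rfl; simp at hs; linarith
  rw [← norm_ne_zero_iff, ← f.norm_completed_reflect h0 h1, norm_ne_zero_iff]
  exact f.completed_ne_zero (by simp; linarith)

/-- Clearing the poles at `0` and `1` gives an entire function. -/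
theorem exists_entire (f : LFunction d) :
    ∃ m : ℕ, Differentiable ℂ fun s => (s * (s - 1)) ^ m * f.completed s := by
  obtain ⟨n₀, h0⟩ := f.meromorphic 0 (mem_univ _)
  obtain ⟨n₁, h1⟩ := f.meromorphic 1 (mem_univ _)
  refine ⟨max n₀ n₁, fun s => ?_⟩
  by_cases hs0 : s = 0
  · subst hs0
    have h2 : (fun s => (s * (s - 1)) ^ (max n₀ n₁) * f.completed s) =
        fun s => s ^ (max n₀ n₁ - n₀) * (s - 1) ^ (max n₀ n₁) * ((s - 0) ^ n₀ • f.completed s) := by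
      ext s
      rw [sub_zero, smul_eq_mul, mul_pow]
      nth_rewrite 1 [← Nat.sub_add_cancel (le_max_left n₀ n₁)]
      rw [pow_add]
      ring
    rw [h2]
    exact DifferentiableAt.mul (by fun_prop) h0.differentiableAt
  by_cases hs1 : s = 1
  · subst hs1
    have h2 : (fun s => (s * (s - 1)) ^ (max n₀ n₁) * f.completed s) =
        fun s => (s - 1) ^ (max n₀ n₁ - n₁) * s ^ (max n₀ n₁) * ((s - 1) ^ n₁ • f.completed s) := by
      ext s
      rw [smul_eq_mul, mul_pow]
      nth_rewrite 2 [← Nat.sub_add_cancel (le_max_right n₀ n₁)]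
      rw [pow_add]
      ring
    rw [h2]
    exact DifferentiableAt.mul (by fun_prop) h1.differentiableAt
  · refine DifferentiableAt.mul (by fun_prop) (f.differentiableOn.differentiableAt ?_)
    exact (Set.toFinite {0, 1}).isClosed.isOpen_compl.mem_nhds (by simp [hs0, hs1])

/-- Order one gives growth `exp(|z|^{3/2})`, and the polynomial factor is harmless, so any
`exp(ηR²)` wins. The shift by `3` moves the origin to a point where the function is nonzero. -/
theorem growth_entire (f : LFunction d) (m : ℕ) {η : ℝ} (hη : 0 < η) : ∃ R₀ : ℝ, ∀ R ≥ R₀, ∀ z : ℂ,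
    ‖z‖ = R → ‖((z + 3) * (z + 3 - 1)) ^ m * f.completed (z + 3)‖ ≤ Real.exp (η * R ^ 2) := by
  obtain ⟨C, hC⟩ := f.order_one (1 / 2) (by norm_num)
  have hlo : ∀ᶠ x : ℝ in atTop, |C| + 2 * m * Real.log x + x ^ (3 / 2 : ℝ) ≤ η / 4 * x ^ (2 : ℝ) := by
    have e1 : (fun _ : ℝ => |C|) =o[atTop] fun x : ℝ => x ^ (2 : ℝ) :=
      Asymptotics.isLittleO_const_left.2 (Or.inr
        (tendsto_norm_atTop_atTop.comp (tendsto_rpow_atTop (by norm_num))))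
    have e2 : (fun x : ℝ => 2 * m * Real.log x) =o[atTop] fun x : ℝ => x ^ (2 : ℝ) :=
      (isLittleO_log_rpow_atTop (by norm_num)).const_mul_left _
    have e3 : (fun x : ℝ => x ^ (3 / 2 : ℝ)) =o[atTop] fun x : ℝ => x ^ (2 : ℝ) :=
      Asymptotics.isLittleO_of_tendsto' (by
        filter_upwards [eventually_gt_atTop 0] with x hx h
        exact absurd h (by positivity))
        ((tendsto_rpow_neg_atTop (show (0 : ℝ) < 1 / 2 by norm_num)).congr' (by
          filter_upwards [eventually_gt_atTop 0] with x hx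
          rw [← Real.rpow_sub hx]
          norm_num))
    have := ((e1.add e2).add e3).bound (show 0 < η / 4 by positivity)
    filter_upwards [this, eventually_ge_atTop 0] with x hx hx0
    rw [Real.norm_of_nonneg (by positivity : (0:ℝ) ≤ x ^ (2:ℝ))] at hx
    exact (le_abs_self _).trans hx
  obtain ⟨x₀, hx₀⟩ := eventually_atTop.1 hlo
  refine ⟨max x₀ 8, fun R hR z hz => ?_⟩
  have hR8 : 8 ≤ R := (le_max_right _ _).trans hR
  have hx := hx₀ (R + 4) (by have := (le_max_left x₀ 8).trans hR; linarith)
  have hz3 : ‖z + 3‖ ≤ R + 3 := by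
    refine (norm_add_le _ _).trans ?_
    simp [hz]
  have hz2 : ‖z + 3 - 1‖ ≤ R + 4 := by
    refine (norm_sub_le _ _).trans ?_
    rw [norm_one]; linarith
  have hz4 : 2 ≤ ‖z + 3‖ := by
    have := norm_sub_le (z + 3) 3
    simp [hz] at this
    linarith
  have h1 := hC (z + 3) hz4
  have hxpos : 0 < R + 4 := by linarith
  rw [norm_mul, norm_pow, norm_mul]
  have h3 : C ≤ Real.exp |C| := (le_abs_self C).trans ((by linarith : |C| ≤ |C| + 1).trans
    (Real.add_one_le_exp _))
  have h4 : Real.exp (‖z + 3‖ ^ (1 + 1 / 2 : ℝ)) ≤ Real.exp ((R + 4) ^ (3 / 2 : ℝ)) := by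
    norm_num
    gcongr
    linarith
  calc (‖z + 3‖ * ‖z + 3 - 1‖) ^ m * ‖f.completed (z + 3)‖
      ≤ ((R + 4) * (R + 4)) ^ m * (Real.exp |C| * Real.exp ((R + 4) ^ (3 / 2 : ℝ))) := by
        gcongr
        · linarith
        · refine h1.trans ?_
          gcongr
    _ = Real.exp (|C| + 2 * m * Real.log (R + 4) + (R + 4) ^ (3 / 2 : ℝ)) := by
        rw [Real.exp_add, Real.exp_add]
        have : Real.exp (2 * m * Real.log (R + 4)) = ((R + 4) * (R + 4)) ^ m := by
          rw [← sq, ← pow_mul, ← Real.rpow_natCast, Real.rpow_def_of_pos hxpos]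
          push_cast
          ring_nf
        rw [this]
        ring
    _ ≤ Real.exp (η * R ^ 2) := by
        refine Real.exp_le_exp.2 (hx.trans ?_)
        rw [Real.rpow_two]
        have : (R + 4) ^ 2 ≤ 4 * R ^ 2 := by nlinarith
        nlinarith

end LFunction

end

/-! ### The kernel of a zero and the expansion of `log ‖Λ‖` -/

noncomputable section
open Complex Metric Set Filter Topology

/-- The mean of `log ‖1/2 ± A + iτ - ρ‖` over the two signs, for `ρ = 1/2 + x + it` and
`y = τ - t`. -/
def kern (A x y : ℝ) : ℝ := (Real.log ((A - x) ^ 2 + y ^ 2) + Real.log ((A + x) ^ 2 + y ^ 2)) / 4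

theorem log_norm_eq_half_log (z : ℂ) : Real.log ‖z‖ = Real.log (z.re ^ 2 + z.im ^ 2) / 2 := by
  have h : z.re ^ 2 + z.im ^ 2 = ‖z‖ ^ 2 := by
    rw [Complex.sq_norm, normSq_apply]; ring
  rw [h, Real.log_pow]; push_cast; ring

theorem log_norm_add_log_norm_eq_kern (A x τ t : ℝ) {u v : ℂ} (hu : u.re = A - x)
    (hu' : u.im = τ - t) (hv : v.re = -A - x) (hv' : v.im = τ - t) :
    Real.log ‖u‖ + Real.log ‖v‖ = 2 * kern A x (τ - t) := by
  rw [log_norm_eq_half_log, log_norm_eq_half_log, hu, hu', hv, hv', kern]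
  have : (-A - x) ^ 2 = (A + x) ^ 2 := by ring
  rw [this]; ring

namespace LFunction

variable {d : ℕ}

/-- Horizontal differences of `log ‖Λ‖` are given, up to a small error, by finitely many zeros in the
critical strip and by the poles. -/
theorem exists_kern_expansion (f : LFunction d) {η : ℝ} (hη : 0 < η) (M : ℝ) :
    ∃ (m : ℕ) (S : Multiset (ℝ × ℝ)), (∀ p ∈ S, |p.1| ≤ 1 / 2) ∧
      ∀ τ A B : ℝ, |τ| ≤ M → 0 ≤ A → A ≤ M → 0 ≤ B → B ≤ M → A ≠ 1 / 2 → B ≠ 1 / 2 →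
        f.completed (1 / 2 + A + τ * I) ≠ 0 → f.completed (1 / 2 + B + τ * I) ≠ 0 →
        |Real.log ‖f.completed (1 / 2 + A + τ * I)‖ - Real.log ‖f.completed (1 / 2 + B + τ * I)‖ -
          ((S.map fun p => kern A p.1 (τ - p.2) - kern B p.1 (τ - p.2)).sum -
            2 * m * (kern A (1 / 2) τ - kern B (1 / 2) τ))| ≤ η := by
  obtain ⟨m, hm⟩ := f.exists_entire
  set F : ℂ → ℂ := fun z => ((z + 3) * (z + 3 - 1)) ^ m * f.completed (z + 3) with hFdef
  have hF : Differentiable ℂ F := hm.comp (differentiable_id.add_const 3)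
  have hFne : ∀ {z : ℂ}, z + 3 ≠ 0 → z + 3 ≠ 1 → f.completed (z + 3) ≠ 0 → F z ≠ 0 := by
    intro z h1 h2 h3
    exact mul_ne_zero (pow_ne_zero _ (mul_ne_zero h1 (sub_ne_zero.2 h2))) h3
  have h0 : F 0 ≠ 0 := hFne (by norm_num) (by norm_num) (f.completed_ne_zero (by norm_num))
  obtain ⟨S, hSzero, hS⟩ := exists_multiset_second_difference hF h0
    (fun η hη => f.growth_entire m hη) (show 0 < 2 * η by positivity) (|M| + 3)
  -- Undoing the shift by `3` and measuring from the critical line: `ρ.re + 3 - 1/2`.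
  refine ⟨m, S.map fun ρ => (ρ.re + 5 / 2, ρ.im), ?_, ?_⟩
  · intro p hp
    obtain ⟨ρ, hρ, rfl⟩ := Multiset.mem_map.1 hp
    have hz := hSzero ρ hρ
    by_contra hcon
    rw [abs_le, not_and_or, not_le, not_le] at hcon
    have hre : (ρ + 3).re = ρ.re + 3 := by simp
    refine hFne ?_ ?_ ?_ hz
    · intro h; rw [h] at hre; simp at hre; rcases hcon with h | h <;> linarith
    · intro h; rw [h] at hre; simp at hre; rcases hcon with h | h <;> linarith
    · rcases hcon with h | h
      · exact f.completed_ne_zero_of_re_neg (by rw [hre]; linarith)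
      · exact f.completed_ne_zero (by rw [hre]; linarith)
  intro τ A B hτ hA0 hA hB0 hB hA' hB' hfA hfB
  set w : ℂ := 1 / 2 + τ * I - 3 with hw
  have hM : |M| = M := abs_of_nonneg ((abs_nonneg τ).trans hτ)
  have hwn : ‖w‖ ≤ |M| + 3 := by
    have e : w = (-(5 / 2 : ℝ) : ℂ) + τ * I := by rw [hw]; push_cast; ring
    rw [e]
    refine (norm_add_le _ _).trans ?_
    rw [norm_mul, norm_I, mul_one, norm_neg, norm_real, norm_real, Real.norm_eq_abs,
      Real.norm_eq_abs, hM]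
    norm_num
    linarith
  have hreal : ∀ {X : ℝ}, 0 ≤ X → X ≤ M → ‖(X : ℂ)‖ ≤ |M| + 3 := by
    intro X h1 h2
    rw [norm_real, Real.norm_eq_abs, abs_of_nonneg h1, hM]; linarith
  have hpt : ∀ X : ℝ, w + X + 3 = 1 / 2 + X + τ * I := fun X => by rw [hw]; ring
  have hpt' : ∀ X : ℝ, w - X + 3 = 1 / 2 - X + τ * I := fun X => by rw [hw]; ring
  have hne : ∀ {X : ℝ}, 0 ≤ X → X ≠ 1 / 2 → (1 / 2 + X + τ * I : ℂ) ≠ 0 ∧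
      (1 / 2 + X + τ * I : ℂ) ≠ 1 ∧ (1 / 2 - X + τ * I : ℂ) ≠ 0 ∧ (1 / 2 - X + τ * I : ℂ) ≠ 1 := by
    intro X h1 h2
    refine ⟨?_, ?_, ?_, ?_⟩ <;> intro h <;> have h3 := congrArg Complex.re h <;> simp at h3
    · linarith
    · exact h2 (by linarith)
    · exact h2 (by linarith)
    · exact h2 (by linarith)
  have hsymm : ∀ {X : ℝ}, 0 ≤ X → X ≠ 1 / 2 →
      ‖f.completed (1 / 2 - X + τ * I)‖ = ‖f.completed (1 / 2 + X + τ * I)‖ := by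
    intro X h1 h2
    rw [← f.norm_completed_reflect (hne h1 h2).1 (hne h1 h2).2.1]
    congr 2
    apply Complex.ext <;> simp; ring
  have hlogF : ∀ {X : ℝ}, 0 ≤ X → X ≠ 1 / 2 → f.completed (1 / 2 + X + τ * I) ≠ 0 →
      F (w + X) ≠ 0 ∧ F (w - X) ≠ 0 ∧ Real.log ‖F (w + X)‖ + Real.log ‖F (w - X)‖ =
        2 * (2 * m * kern X (1 / 2) τ + Real.log ‖f.completed (1 / 2 + X + τ * I)‖) := by
    intro X h1 h2 h3
    obtain ⟨n1, n2, n3, n4⟩ := hne h1 h2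
    have h3' : f.completed (1 / 2 - X + τ * I) ≠ 0 := by
      rw [← norm_ne_zero_iff, hsymm h1 h2, norm_ne_zero_iff]; exact h3
    refine ⟨hFne (by rwa [hpt]) (by rwa [hpt]) (by rwa [hpt]),
      hFne (by rwa [hpt']) (by rwa [hpt']) (by rwa [hpt']), ?_⟩
    simp only [hFdef, hpt, hpt']
    have k1 : Real.log ‖(1 / 2 + X + τ * I - 1 : ℂ)‖ + Real.log ‖(1 / 2 - X + τ * I - 1 : ℂ)‖ =
        2 * kern X (1 / 2) (τ - 0) :=
      log_norm_add_log_norm_eq_kern _ _ _ _ (by simp; ring) (by simp) (by simp; ring) (by simp)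
    have k2 : Real.log ‖(1 / 2 + X + τ * I : ℂ)‖ + Real.log ‖(1 / 2 - X + τ * I : ℂ)‖ =
        2 * kern X (-(1 / 2)) (τ - 0) :=
      log_norm_add_log_norm_eq_kern _ _ _ _ (by simp; ring) (by simp) (by simp; ring) (by simp)
    -- The poles `0` and `1` are mirror images, so they contribute the same kernel. This is the
    -- source of the factor `2 * m`.
    have k3 : kern X (-(1 / 2)) (τ - 0) = kern X (1 / 2) (τ - 0) := by
      rw [kern, kern, sub_neg_eq_add, ← sub_eq_add_neg, add_comm (Real.log _)]
    rw [sub_zero] at k1 k2 k3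
    rw [norm_mul, norm_mul, norm_pow, norm_pow, norm_mul, norm_mul, hsymm h1 h2]
    have p1 := norm_ne_zero_iff.2 n1
    have p2 := norm_ne_zero_iff.2 (sub_ne_zero.2 n2)
    have p3 := norm_ne_zero_iff.2 n3
    have p4 := norm_ne_zero_iff.2 (sub_ne_zero.2 n4)
    have p5 := norm_ne_zero_iff.2 h3
    rw [Real.log_mul (pow_ne_zero _ (mul_ne_zero p1 p2)) p5,
      Real.log_mul (pow_ne_zero _ (mul_ne_zero p3 p4)) p5, Real.log_pow, Real.log_pow,
      Real.log_mul p1 p2, Real.log_mul p3 p4]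
    linear_combination (m : ℝ) * (k1 + k2 + 2 * k3)
  obtain ⟨a1, a2, a3⟩ := hlogF hA0 hA' hfA
  obtain ⟨b1, b2, b3⟩ := hlogF hB0 hB' hfB
  have hmain := hS w A B hwn (hreal hA0 hA) (hreal hB0 hB) a1 a2 b1 b2
  have hsum : (S.map fun ρ => Real.log ‖w + A - ρ‖ + Real.log ‖w - A - ρ‖ - Real.log ‖w + B - ρ‖ -
      Real.log ‖w - B - ρ‖).sum =
      2 * ((S.map fun ρ => ((ρ.re + 5 / 2, ρ.im) : ℝ × ℝ)).map fun p =>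
        kern A p.1 (τ - p.2) - kern B p.1 (τ - p.2)).sum := by
    rw [Multiset.map_map, ← Multiset.sum_map_mul_left]
    congr 1
    refine Multiset.map_congr rfl fun ρ _ => ?_
    simp only [Function.comp]
    have k : ∀ X : ℝ, Real.log ‖w + X - ρ‖ + Real.log ‖w - X - ρ‖ =
        2 * kern X (ρ.re + 5 / 2) (τ - ρ.im) := fun X =>
      log_norm_add_log_norm_eq_kern _ _ _ _ (by simp [hw]; ring) (by simp [hw])
        (by simp [hw]; ring) (by simp [hw])
    linear_combination k A - k B
  rw [hsum] at hmain
  rw [abs_le] at hmain ⊢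
  constructor <;> linarith [hmain.1, hmain.2]

end LFunction

end

/-! ### Integrals and pointwise comparison of the kernel -/

noncomputable section
open Set Filter Topology MeasureTheory intervalIntegral

/-- Logarithm of the product of the two squared distances entering `kern`. -/
theorem kern_eq_log_mul {A x y : ℝ} (h : |x| < A) : kern A x y =
    Real.log (((A - x) ^ 2 + y ^ 2) * ((A + x) ^ 2 + y ^ 2)) / 4 := by
  rw [abs_lt] at h
  have h1 : 0 < A - x := by linarith [h.2]
  have h2 : 0 < A + x := by linarith [h.1]
  rw [kern, Real.log_mul (by positivity) (by positivity)]

theorem kern_zero_eq (x y : ℝ) : kern 0 x y = Real.log (x ^ 2 + y ^ 2) / 2 := by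
  rw [kern]; simp only [zero_sub, zero_add, neg_sq]; ring

theorem kern_mono {A B x y : ℝ} (h : |x| < A) (hAB : A ≤ B) : kern A x y ≤ kern B x y := by
  rw [abs_lt] at h
  have h1 : 0 < A - x := by linarith [h.2]
  have h2 : 0 < A + x := by linarith [h.1]
  rw [kern, kern]
  gcongr

theorem continuous_kern {A x : ℝ} (h : |x| < A) : Continuous fun y => kern A x y := by
  rw [abs_lt] at h
  have h1 : 0 < A - x := by linarith [h.2]
  have h2 : 0 < A + x := by linarith [h.1]
  unfold kern
  refine Continuous.div_const (Continuous.add ?_ ?_) _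
  · exact Continuous.log (by fun_prop) fun y => by positivity
  · exact Continuous.log (by fun_prop) fun y => by positivity

theorem intervalIntegrable_kern_zero (x t a b : ℝ) :
    IntervalIntegrable (fun τ => kern 0 x (τ - t)) volume a b := by
  have h : MeromorphicOn (fun τ : ℝ => x ^ 2 + (τ - t) ^ 2) (uIcc a b) :=
    AnalyticOnNhd.meromorphicOn (fun y _ => by fun_prop)
  have h1 := h.intervalIntegrable_log.div_const 2
  refine h1.congr_ae (Filter.Eventually.of_forall fun τ => ?_)
  simp [kern_zero_eq]

theorem kern_zero_le {A x y : ℝ} (hA : 1 ≤ A) (hx : |x| ≤ 1 / 2) : kern 0 x y ≤ kern A x y := by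
  rw [kern_zero_eq, kern_eq_log_mul (by linarith)]
  have hx2 : x ^ 2 ≤ 1 / 4 := by rw [← sq_abs]; nlinarith [abs_nonneg x]
  have hA2 : 1 ≤ A ^ 2 := by nlinarith
  have hid : ((A - x) ^ 2 + y ^ 2) * ((A + x) ^ 2 + y ^ 2) =
    (x ^ 2 + y ^ 2) ^ 2 + A ^ 2 * (A ^ 2 - 2 * x ^ 2 + 2 * y ^ 2) := by ring
  -- At the source itself `Real.log 0 = 0`, so this case needs the right-hand side to be
  -- nonnegative.
  rcases (by positivity : 0 ≤ x ^ 2 + y ^ 2).eq_or_lt with h | h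
  · rw [← h, Real.log_zero, zero_div]
    refine div_nonneg (Real.log_nonneg ?_) (by norm_num)
    rw [hid]
    nlinarith [sq_nonneg y]
  · have : Real.log ((x ^ 2 + y ^ 2) ^ 2) ≤
        Real.log (((A - x) ^ 2 + y ^ 2) * ((A + x) ^ 2 + y ^ 2)) := by
      refine Real.log_le_log (by positivity) ?_
      rw [hid]
      nlinarith [sq_nonneg y]
    rw [Real.log_pow] at this
    push_cast at this
    linarith

/-- Away from the source, the kernel of the critical line is dominated. -/
theorem kern_sub_kern_zero_le {K x y : ℝ} (hK : 1 ≤ K) (hx : |x| ≤ 1 / 2)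
    (hy : 10 * (K + 1) ≤ |y|) : kern (2 * K) x y - kern 0 x y ≤
      K * (kern (2 * K + 2) x y - kern (2 * K) x y) := by
  have hx2 : x ^ 2 ≤ 1 / 4 := by rw [← sq_abs]; nlinarith [abs_nonneg x]
  have hy2 : 100 * (K + 1) ^ 2 ≤ y ^ 2 := by rw [← sq_abs y]; nlinarith
  have hypos : 0 < y ^ 2 := by nlinarith
  rw [kern_zero_eq, kern_eq_log_mul (A := 2 * K) (by linarith),
    kern_eq_log_mul (A := 2 * K + 2) (by linarith)]
  set Y := y ^ 2 with hY
  set X := x ^ 2 with hX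
  have hX0 : 0 ≤ X := sq_nonneg x
  have id1 : ((2 * K - x) ^ 2 + Y) * ((2 * K + x) ^ 2 + Y) =
    (X + Y) ^ 2 + 4 * K ^ 2 * (4 * K ^ 2 - 2 * X + 2 * Y) := by rw [hX]; ring
  have id2 : ((2 * K + 2 - x) ^ 2 + Y) * ((2 * K + 2 + x) ^ 2 + Y) =
    (X + Y) ^ 2 + (2 * K + 2) ^ 2 * ((2 * K + 2) ^ 2 - 2 * X + 2 * Y) := by rw [hX]; ring
  rw [id1, id2]
  set P0 := (X + Y) ^ 2 with hP0
  set P1 := P0 + 4 * K ^ 2 * (4 * K ^ 2 - 2 * X + 2 * Y) with hP1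
  set P2 := P0 + (2 * K + 2) ^ 2 * ((2 * K + 2) ^ 2 - 2 * X + 2 * Y) with hP2
  have p0 : 0 < P0 := by positivity
  have p1 : 0 < P1 := by
    have : 0 < 4 * K ^ 2 - 2 * X + 2 * Y := by nlinarith
    positivity
  have p2 : 0 < P2 := by
    have : 0 < (2 * K + 2) ^ 2 - 2 * X + 2 * Y := by nlinarith
    positivity
  have l1 : Real.log P1 - Real.log P0 ≤ P1 / P0 - 1 := by
    rw [← Real.log_div p1.ne' p0.ne']; exact Real.log_le_sub_one_of_pos (by positivity)
  have l2 : 1 - P1 / P2 ≤ Real.log P2 - Real.log P1 := by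
    rw [← Real.log_div p2.ne' p1.ne']
    have := Real.one_sub_inv_le_log_of_pos (show 0 < P2 / P1 by positivity)
    rwa [inv_div] at this
  have l0 : Real.log P0 = 2 * Real.log (X + Y) := by rw [hP0, Real.log_pow]; push_cast; ring
  -- To leading order, `P1/P0 - 1` is `8K²/Y` and `1 - P1/P2` is `(16K + 8)/Y`. After multiplying
  -- the latter by `K` there is a spare factor of two, so the threshold `10K²/Y` separates them
  -- despite the lower-order terms.
  have u1 : P1 / P0 - 1 ≤ 10 * K ^ 2 / Y := by
    rw [div_sub_one p0.ne', div_le_div_iff₀ p0 hypos]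
    have h1 : P1 - P0 ≤ 10 * K ^ 2 * Y := by
      have e : P1 - P0 = 4 * K ^ 2 * (4 * K ^ 2 - 2 * X + 2 * Y) := by rw [hP1]; ring
      rw [e]
      have e2 : 4 * K ^ 2 - 2 * X + 2 * Y ≤ 5 / 2 * Y := by nlinarith
      calc 4 * K ^ 2 * (4 * K ^ 2 - 2 * X + 2 * Y) ≤ 4 * K ^ 2 * (5 / 2 * Y) := by gcongr
        _ = 10 * K ^ 2 * Y := by ring
    have h2 : Y * Y ≤ P0 := by rw [hP0]; nlinarith
    calc (P1 - P0) * Y ≤ 10 * K ^ 2 * Y * Y := by gcongr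
      _ = 10 * K ^ 2 * (Y * Y) := by ring
      _ ≤ 10 * K ^ 2 * P0 := by gcongr
  have u2 : 10 * K / Y ≤ 1 - P1 / P2 := by
    rw [one_sub_div p2.ne', div_le_div_iff₀ hypos p2]
    have h1 : (16 * K + 8) * Y ≤ P2 - P1 := by
      have e : P2 - P1 = (8 * K + 4) * (8 * K ^ 2 + 8 * K + 4 - 2 * X + 2 * Y) := by
        rw [hP1, hP2]; ring
      rw [e]
      have e2 : 2 * Y ≤ 8 * K ^ 2 + 8 * K + 4 - 2 * X + 2 * Y := by nlinarith
      calc (16 * K + 8) * Y = (8 * K + 4) * (2 * Y) := by ring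
        _ ≤ _ := by gcongr
    have h2 : P2 ≤ 3 / 2 * (Y * Y) := by
      have e2 : (2 * K + 2) ^ 2 ≤ Y / 25 := by linarith only [hy2, sq_nonneg (K + 1)]
      have e3 : 1 ≤ Y / 400 := by
        have : (2 : ℝ) ^ 2 ≤ (K + 1) ^ 2 := by gcongr; linarith
        linarith
      have e1 : P0 ≤ (Y / 400 + Y) ^ 2 := by rw [hP0]; gcongr; linarith
      have e4 : (2 * K + 2) ^ 2 * ((2 * K + 2) ^ 2 - 2 * X + 2 * Y) ≤ Y / 25 * (Y / 25 + 2 * Y) := by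
        refine mul_le_mul e2 (by linarith) ?_ (by positivity)
        linarith [sq_nonneg (2 * K + 2)]
      have e5 : 0 < Y * Y := mul_pos hypos hypos
      calc P2 ≤ (Y / 400 + Y) ^ 2 + Y / 25 * (Y / 25 + 2 * Y) := by rw [hP2]; linarith
        _ = (401 ^ 2 / 400 ^ 2 + 51 / 625) * (Y * Y) := by ring
        _ ≤ 3 / 2 * (Y * Y) := by gcongr; norm_num
    calc 10 * K * P2 ≤ 10 * K * (3 / 2 * (Y * Y)) := by gcongr
      _ = 15 * K * (Y * Y) := by ring
      _ ≤ (16 * K + 8) * (Y * Y) := by gcongr; linarith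
      _ = (16 * K + 8) * Y * Y := by ring
      _ ≤ (P2 - P1) * Y := by gcongr
  have u3 : 10 * K ^ 2 / Y = K * (10 * K / Y) := by ring
  have u4 : K * (10 * K / Y) ≤ K * (Real.log P2 - Real.log P1) := by gcongr; linarith
  linarith

theorem integral_log_sq_add_sq {u : ℝ} (hu : 0 < u) (W : ℝ) :
    ∫ y in (-W)..W, Real.log (u ^ 2 + y ^ 2) =
      2 * W * Real.log (u ^ 2 + W ^ 2) - 4 * W + 4 * (u * Real.arctan (W / u)) := by
  have hpos : ∀ y : ℝ, 0 < u ^ 2 + y ^ 2 := fun y => by positivity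
  have hder : ∀ y ∈ uIcc (-W) W, HasDerivAt
      (fun y => y * Real.log (u ^ 2 + y ^ 2) - 2 * y + 2 * u * Real.arctan (y / u))
      (Real.log (u ^ 2 + y ^ 2)) y := by
    intro y _
    have h1 : HasDerivAt (fun y : ℝ => u ^ 2 + y ^ 2) (2 * y) y := by
      simpa using (hasDerivAt_pow 2 y).const_add (u ^ 2)
    have h2 := (hasDerivAt_id' y).mul (h1.log (hpos y).ne')
    have h3 := (hasDerivAt_id' y).const_mul 2
    have h4 := (((hasDerivAt_id' y).div_const u).arctan).const_mul (2 * u)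
    refine ((h2.sub h3).add h4).congr_deriv ?_
    have := (hpos y).ne'
    have h5 : 1 + (y / u) ^ 2 = (u ^ 2 + y ^ 2) / u ^ 2 := by field_simp
    rw [h5]
    field_simp
    ring
  rw [integral_eq_sub_of_hasDerivAt hder
    (Continuous.intervalIntegrable (Continuous.log (by fun_prop) fun y => (hpos y).ne') _ _)]
  rw [neg_div, Real.arctan_neg, neg_sq]
  ring

theorem mul_arctan_div_le {u W : ℝ} (hu : 0 < u) :
    u * Real.arctan (W / u) ≤ u * (Real.pi / 2) := by
  gcongr
  exact (Real.arctan_lt_pi_div_two _).le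

theorem arctan_le_self {x : ℝ} (hx : 0 ≤ x) : Real.arctan x ≤ x := by
  have h0 : 0 ≤ Real.arctan x := Real.arctan_nonneg.2 hx
  have h := Real.le_tan h0 (Real.arctan_lt_pi_div_two x)
  rwa [Real.tan_arctan] at h

theorem le_mul_arctan_div {u W : ℝ} (hu : 0 < u) (hW : 0 < W) :
    u * (Real.pi / 2) - u ^ 2 / W ≤ u * Real.arctan (W / u) := by
  have h1 := Real.arctan_inv_of_pos (show 0 < u / W by positivity)
  rw [inv_div] at h1
  have h2 : Real.arctan (u / W) ≤ u / W := arctan_le_self (by positivity)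
  rw [h1, mul_sub]
  have : u * Real.arctan (u / W) ≤ u * (u / W) := by gcongr
  have e : u * (u / W) = u ^ 2 / W := by ring
  linarith

theorem integral_kern {A x : ℝ} (h : |x| < A) (W : ℝ) : ∫ y in (-W)..W, kern A x y =
    (W * Real.log ((A - x) ^ 2 + W ^ 2) + W * Real.log ((A + x) ^ 2 + W ^ 2)) / 2 - 2 * W +
      ((A - x) * Real.arctan (W / (A - x)) + (A + x) * Real.arctan (W / (A + x))) := by
  rw [abs_lt] at h
  have h1 : 0 < A - x := by linarith [h.2]
  have h2 : 0 < A + x := by linarith [h.1]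
  unfold kern
  rw [intervalIntegral.integral_div, intervalIntegral.integral_add, integral_log_sq_add_sq h1, integral_log_sq_add_sq h2]
  · ring
  all_goals
    exact (Continuous.log (by fun_prop) fun y => by positivity).intervalIntegrable _ _

/-- Moving a line lying to the right of the source by one unit changes the integral of the kernel
over the whole line by `π`; the term in `1/W` pays for truncation. The logarithmic boundary terms
have a favourable sign and are dropped. -/
theorem le_integral_kern_sub {A B x W : ℝ} (h : |x| < A) (hAB : A ≤ B) (hW : 0 < W) :
    Real.pi * (B - A) - 2 * (B ^ 2 + x ^ 2) / W ≤
      ∫ y in (-W)..W, (kern B x y - kern A x y) := by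
  have h' := abs_lt.1 h
  have h1 : 0 < A - x := by linarith [h'.2]
  have h2 : 0 < A + x := by linarith [h'.1]
  rw [intervalIntegral.integral_sub ((continuous_kern (h.trans_le hAB)).intervalIntegrable _ _)
    ((continuous_kern h).intervalIntegrable _ _), integral_kern h, integral_kern (h.trans_le hAB)]
  have a1 := mul_arctan_div_le (W := W) h1
  have a2 := mul_arctan_div_le (W := W) h2
  have b1 := le_mul_arctan_div (show 0 < B - x by linarith) hW
  have b2 := le_mul_arctan_div (show 0 < B + x by linarith) hW
  have c1 : W * Real.log ((A - x) ^ 2 + W ^ 2) ≤ W * Real.log ((B - x) ^ 2 + W ^ 2) := by gcongr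
  have c2 : W * Real.log ((A + x) ^ 2 + W ^ 2) ≤ W * Real.log ((B + x) ^ 2 + W ^ 2) := by gcongr
  have e : 2 * (B ^ 2 + x ^ 2) / W = (B - x) ^ 2 / W + (B + x) ^ 2 / W := by ring
  rw [e]
  linarith

/-- On the whole line the integral would be `π(A - |x|)`. Bounding `x² + y²` below by `y²` forfeits
`π|x|` and makes the estimate uniform in `x`. -/
theorem integral_kern_sub_zero_le {A x W : ℝ} (h : |x| < A) (hW : 0 < W) :
    ∫ y in (-W)..W, (kern A x y - kern 0 x y) ≤ Real.pi * A + (A ^ 2 + x ^ 2) / W := by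
  have h' := abs_lt.1 h
  have h1 : 0 < A - x := by linarith [h'.2]
  have h2 : 0 < A + x := by linarith [h'.1]
  have hint : IntervalIntegrable (fun y => kern 0 x y) volume (-W) W := by
    simpa using intervalIntegrable_kern_zero x 0 (-W) W
  rw [intervalIntegral.integral_sub ((continuous_kern h).intervalIntegrable _ _) hint,
    integral_kern h]
  have a1 := mul_arctan_div_le (W := W) h1
  have a2 := mul_arctan_div_le (W := W) h2
  have hlow : 2 * (W * Real.log W - W) ≤ ∫ y in (-W)..W, kern 0 x y := by
    have e : ∫ y in (-W)..W, Real.log y = 2 * (W * Real.log W - W) := by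
      rw [integral_log, Real.log_neg_eq_log]; ring
    rw [← e]
    refine integral_mono_ae (by linarith) intervalIntegral.intervalIntegrable_log' hint ?_
    have hne : ∀ᵐ y : ℝ, y ≠ 0 := by
      have : volume ({0} : Set ℝ) = 0 := by simp
      exact measure_eq_zero_iff_ae_notMem.1 this
    filter_upwards [hne] with y hy
    rw [kern_zero_eq]
    have hl : 2 * Real.log y = Real.log (y ^ 2) := by rw [Real.log_pow]; push_cast; ring
    have : Real.log (y ^ 2) ≤ Real.log (x ^ 2 + y ^ 2) :=
      Real.log_le_log (by positivity) (by nlinarith [sq_nonneg x])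
    linarith
  have c : ∀ u : ℝ, 0 < u → W * Real.log (u ^ 2 + W ^ 2) ≤ 2 * (W * Real.log W) + u ^ 2 / W := by
    intro u hu
    have k1 : u ^ 2 + W ^ 2 = W ^ 2 * (1 + u ^ 2 / W ^ 2) := by field_simp; ring
    rw [k1, Real.log_mul (by positivity) (by positivity), Real.log_pow]
    have k2 := Real.log_le_sub_one_of_pos (show 0 < 1 + u ^ 2 / W ^ 2 by positivity)
    have k3 : W * Real.log (1 + u ^ 2 / W ^ 2) ≤ W * (u ^ 2 / W ^ 2) := by gcongr; linarith
    have k4 : W * (u ^ 2 / W ^ 2) = u ^ 2 / W := by field_simp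
    push_cast
    linarith
  have c1 := c _ h1
  have c2 := c _ h2
  have e : (A ^ 2 + x ^ 2) / W = ((A - x) ^ 2 / W + (A + x) ^ 2 / W) / 2 := by ring
  rw [e]
  linarith

end

/-! ### Domination of the critical line for one zero, over general intervals -/

noncomputable section
open Set Filter Topology MeasureTheory intervalIntegral

theorem continuous_kern_sub {A x : ℝ} (h : |x| < A) (t : ℝ) :
    Continuous fun τ => kern A x (τ - t) :=
  (continuous_kern h).comp (continuous_sub_right t)

/-- The potential of the critical line is dominated by that of the lines to the right: centered
interval. -/
theorem integral_kern_sub_zero_le_mul {K x W : ℝ} (hK : 1 ≤ K) (hx : |x| ≤ 1 / 2)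
    (hW : 0 < W) (hWD : (2 * K + 2) ^ 2 + 1 ≤ W) :
    ∫ y in (-W)..W, (kern (2 * K) x y - kern 0 x y) ≤
      K * (1 + ((2 * K + 2) ^ 2 + 1) / W) *
        ∫ y in (-W)..W, (kern (2 * K + 2) x y - kern (2 * K) x y) := by
  have hx2 : x ^ 2 ≤ 1 / 4 := by rw [← sq_abs]; nlinarith [abs_nonneg x]
  have h1 := integral_kern_sub_zero_le (A := 2 * K) (x := x) (by linarith) hW
  have h2 := le_integral_kern_sub (A := 2 * K) (B := 2 * K + 2) (x := x) (by linarith)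
    (by linarith) hW
  set J := ∫ y in (-W)..W, (kern (2 * K + 2) x y - kern (2 * K) x y) with hJ
  have hJ0 : 0 ≤ J := intervalIntegral.integral_nonneg (by linarith) fun y _ =>
    sub_nonneg.2 (kern_mono (by linarith) (by linarith))
  set D := ((2 * K + 2) ^ 2 + 1) with hD
  have hD0 : 0 < D := by positivity
  have hpi := Real.pi_gt_three
  have h3 : 2 * ((2 * K + 2) ^ 2 + x ^ 2) / W ≤ 2 * D / W := by gcongr; linarith
  have h4 : ((2 * K) ^ 2 + x ^ 2) / W ≤ D / W := by
    rw [hD]; gcongr <;> linarith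
  set q := D / W with hq
  have hq0 : 0 < q := by positivity
  have h5 : 2 * D / W = 2 * q := by rw [hq]; ring
  have h6 : 2 * Real.pi - 2 * q ≤ J := by linarith
  refine h1.trans ?_
  have hq1 : q ≤ 1 := (div_le_one hW).2 hWD
  have h7 : K * (1 + q) * (2 * Real.pi - 2 * q) ≤ K * (1 + q) * J := by gcongr
  -- The truncation errors are of order `q = D/W`, and the extra factor `1 + q` absorbs them because
  -- `q ≤ 1` and `π > 3`.
  have h8 : 0 ≤ K * q * (2 * Real.pi - 2 * q - 4) + 2 * K * q - q := by
    have : 0 ≤ K * q * (2 * Real.pi - 2 * q - 4) := by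
      apply mul_nonneg (by positivity); linarith
    nlinarith
  nlinarith

/-- Same, for arbitrary position relative to the intervals. -/
theorem potential_nonneg {K a b W x : ℝ} (t : ℝ) (hK : 1 ≤ K) (hW : 10 * (K + 1) ≤ W)
    (hWD : (2 * K + 2) ^ 2 + 1 ≤ W)
    (hab : a + 4 * W ≤ b) (hx : |x| ≤ 1 / 2) :
    ∫ τ in (a + 2 * W)..(b - 2 * W), (kern (2 * K) x (τ - t) - kern 0 x (τ - t)) ≤
      K * (1 + ((2 * K + 2) ^ 2 + 1) / W) *
        ∫ τ in a..b, (kern (2 * K + 2) x (τ - t) - kern (2 * K) x (τ - t)) := by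
  have hW0 : 0 < W := by linarith
  have hxA : |x| < 2 * K := by linarith
  have hxB : |x| < 2 * K + 2 := by linarith
  set δ := ((2 * K + 2) ^ 2 + 1) / W with hδ
  have hδ0 : 0 ≤ δ := by positivity
  set g : ℝ → ℝ := fun τ => kern (2 * K) x (τ - t) - kern 0 x (τ - t) with hg
  set e : ℝ → ℝ := fun τ => kern (2 * K + 2) x (τ - t) - kern (2 * K) x (τ - t) with he
  have hgi : ∀ u v, IntervalIntegrable g volume u v := fun u v =>
    ((continuous_kern_sub hxA t).intervalIntegrable _ _).sub (intervalIntegrable_kern_zero _ _ _ _)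
  have hei : ∀ u v, IntervalIntegrable e volume u v := fun u v =>
    ((continuous_kern_sub hxB t).sub (continuous_kern_sub hxA t)).intervalIntegrable _ _
  have hg0 : ∀ τ, 0 ≤ g τ := fun τ => sub_nonneg.2 (kern_zero_le (by linarith) hx)
  have he0 : ∀ τ, 0 ≤ e τ := fun τ => sub_nonneg.2 (kern_mono hxA (by linarith))
  have hfar : ∀ τ, W ≤ |τ - t| → g τ ≤ K * (1 + δ) * e τ := by
    intro τ hτ
    have h1 := kern_sub_kern_zero_le hK hx (hW.trans hτ)
    have h2 : K * e τ ≤ K * (1 + δ) * e τ := by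
      gcongr
      · exact he0 τ
      · nlinarith
    exact h1.trans h2
  rw [← intervalIntegral.integral_const_mul]
  have hce0 : ∀ τ, 0 ≤ K * (1 + δ) * e τ := fun τ => mul_nonneg (by positivity) (he0 τ)
  have hcei : ∀ u v, IntervalIntegrable (fun τ => K * (1 + δ) * e τ) volume u v := fun u v =>
    (hei u v).const_mul _
  -- If the window of radius `W` about `t` fits into `[a, b]`, the centred inequality serves inside
  -- it and the pointwise one outside. Otherwise `t` is left of `a + W` or right of `b - W`, and
  -- shortening by `2W` keeps the whole inner interval at distance `W` from `t`.
  by_cases hcase : a ≤ t - W ∧ t + W ≤ b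
  · obtain ⟨h1, h2⟩ := hcase
    calc ∫ τ in (a + 2 * W)..(b - 2 * W), g τ ≤ ∫ τ in a..b, g τ :=
          integral_mono_interval (by linarith) (by linarith) (by linarith)
            (Filter.Eventually.of_forall hg0) (hgi _ _)
      _ = (∫ τ in a..(t - W), g τ) + (∫ τ in (t - W)..(t + W), g τ) + ∫ τ in (t + W)..b, g τ := by
          rw [integral_add_adjacent_intervals (hgi _ _) (hgi _ _),
            integral_add_adjacent_intervals (hgi _ _) (hgi _ _)]
      _ ≤ (∫ τ in a..(t - W), K * (1 + δ) * e τ) + (∫ τ in (t - W)..(t + W), K * (1 + δ) * e τ) +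
          ∫ τ in (t + W)..b, K * (1 + δ) * e τ := by
          gcongr ?_ + ?_ + ?_
          · refine integral_mono_on h1 (hgi _ _) (hcei _ _) fun τ hτ => hfar τ ?_
            rw [abs_of_nonpos (by linarith [hτ.2])]; linarith [hτ.2]
          · rw [intervalIntegral.integral_const_mul]
            have := integral_kern_sub_zero_le_mul hK hx hW0 hWD
            have e1 := intervalIntegral.integral_comp_sub_right (a := t - W) (b := t + W)
              (fun y => kern (2 * K) x y - kern 0 x y) t
            have e2 := intervalIntegral.integral_comp_sub_right (a := t - W) (b := t + W)
              (fun y => kern (2 * K + 2) x y - kern (2 * K) x y) t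
            rw [show t - W - t = -W by ring, show t + W - t = W by ring] at e1 e2
            rw [hg, he, e1, e2]
            exact this
          · refine integral_mono_on h2 (hgi _ _) (hcei _ _) fun τ hτ => hfar τ ?_
            rw [abs_of_nonneg (by linarith [hτ.1])]; linarith [hτ.1]
      _ = ∫ τ in a..b, K * (1 + δ) * e τ := by
          rw [integral_add_adjacent_intervals (hcei _ _) (hcei _ _),
            integral_add_adjacent_intervals (hcei _ _) (hcei _ _)]
  · have hout : ∀ τ ∈ Icc (a + 2 * W) (b - 2 * W), W ≤ |τ - t| := by
      intro τ hτ
      rw [not_and_or, not_le, not_le] at hcase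
      rcases hcase with h | h
      · rw [abs_of_nonneg (by linarith [hτ.1])]; linarith [hτ.1]
      · rw [abs_of_nonpos (by linarith [hτ.2])]; linarith [hτ.2]
    calc ∫ τ in (a + 2 * W)..(b - 2 * W), g τ
        ≤ ∫ τ in (a + 2 * W)..(b - 2 * W), K * (1 + δ) * e τ :=
          integral_mono_on (by linarith) (hgi _ _) (hcei _ _) fun τ hτ => hfar τ (hout τ hτ)
      _ ≤ ∫ τ in a..b, K * (1 + δ) * e τ :=
          integral_mono_interval (by linarith) (by linarith) (by linarith)
            (Filter.Eventually.of_forall hce0) (hcei _ _)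

end

/-! ### Expansions of the kernel near the pole and decay of its differences -/

noncomputable section
open Set Filter Topology MeasureTheory intervalIntegral

theorem abs_log_sq_add_sq_sub_le {u v : ℝ} (y : ℝ) (hu : 1 / 4 ≤ u) (hv : 1 / 4 ≤ v) :
    |Real.log (u ^ 2 + y ^ 2) - Real.log (v ^ 2 + y ^ 2)| ≤
      16 * (u + v) * |u - v| / (1 + y ^ 2) := by
  have key : ∀ {p q : ℝ}, 1 / 4 ≤ p → 1 / 4 ≤ q →
      Real.log (p ^ 2 + y ^ 2) - Real.log (q ^ 2 + y ^ 2) ≤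
        16 * (p + q) * |p - q| / (1 + y ^ 2) := by
    intro p q hp hq
    have hP : 0 < p ^ 2 + y ^ 2 := by positivity
    have hQ : 0 < q ^ 2 + y ^ 2 := by positivity
    rw [← Real.log_div hP.ne' hQ.ne']
    refine (Real.log_le_sub_one_of_pos (by positivity)).trans ?_
    rw [div_sub_one hQ.ne', div_le_div_iff₀ hQ (by positivity)]
    have h1 : p ^ 2 + y ^ 2 - (q ^ 2 + y ^ 2) ≤ (p + q) * |p - q| := by
      have : p ^ 2 + y ^ 2 - (q ^ 2 + y ^ 2) = (p + q) * (p - q) := by ring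
      rw [this]
      gcongr
      exact le_abs_self _
    have h2 : 1 + y ^ 2 ≤ 16 * (q ^ 2 + y ^ 2) := by nlinarith [sq_nonneg y]
    calc _ ≤ (p + q) * |p - q| * (1 + y ^ 2) := by gcongr
      _ ≤ (p + q) * |p - q| * (16 * (q ^ 2 + y ^ 2)) := by gcongr
      _ = _ := by ring
  rw [abs_le]
  have h1 := key hu hv
  have h2 := key hv hu
  rw [abs_sub_comm, add_comm v u] at h2
  constructor <;> linarith

/-- The quotient of the two arguments is `1 + s` with `s = (t² - 2tτ)/Q`. Here `s² ≤ 9t²/Q`, so the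
second-order error of `log (1 + s)` already has the required size, and `|t| ≤ 1/16` ensures `|s| ≤
1/2`. -/
theorem abs_log_taylor_le {v τ t : ℝ} (hv : 1 / 2 ≤ v) (ht : |t| ≤ 1 / 16) :
    |Real.log (v ^ 2 + (τ - t) ^ 2) - Real.log (v ^ 2 + τ ^ 2) - t * (-(2 * τ) / (v ^ 2 + τ ^ 2))| ≤
      76 * t ^ 2 / (1 + τ ^ 2) := by
  set Q := v ^ 2 + τ ^ 2 with hQ
  have hQpos : 0 < Q := by positivity
  have hQ1 : 1 + τ ^ 2 ≤ 4 * Q := by nlinarith [sq_nonneg τ]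
  have ht2 : t ^ 2 ≤ 1 / 256 := by rw [← sq_abs]; nlinarith [abs_nonneg t]
  set s := (t ^ 2 - 2 * t * τ) / Q with hs
  have hs2 : s ^ 2 ≤ 9 * t ^ 2 / Q := by
    rw [hs, div_pow, div_le_div_iff₀ (by positivity) hQpos]
    have h1 : (t - 2 * τ) ^ 2 ≤ 9 * Q := by nlinarith [sq_nonneg (t + 2 * τ)]
    calc (t ^ 2 - 2 * t * τ) ^ 2 * Q = t ^ 2 * (t - 2 * τ) ^ 2 * Q := by ring
      _ ≤ t ^ 2 * (9 * Q) * Q := by gcongr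
      _ = 9 * t ^ 2 * Q ^ 2 := by ring
  have hQ4 : 1 / 4 ≤ Q := by nlinarith [sq_nonneg τ]
  have hs4 : s ^ 2 ≤ 1 / 4 := by
    refine hs2.trans ?_
    rw [div_le_iff₀ hQpos]
    linarith
  have habs : |s| ≤ 1 / 2 := abs_le_of_sq_le_sq (by linarith) (by norm_num)
  have hs' := abs_le.1 habs
  have hpos : 0 < 1 + s := by linarith [hs'.1]
  have e1 : v ^ 2 + (τ - t) ^ 2 = Q * (1 + s) := by rw [hs]; field_simp; rw [hQ]; ring
  rw [e1, Real.log_mul hQpos.ne' hpos.ne']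
  have e2 : t * (-(2 * τ) / Q) = s - t ^ 2 / Q := by rw [hs]; ring
  rw [e2]
  have l1 := Real.log_le_sub_one_of_pos hpos
  have l2 := Real.one_sub_inv_le_log_of_pos hpos
  have l3 : s - 2 * s ^ 2 ≤ 1 - (1 + s)⁻¹ := by
    have : 1 - (1 + s)⁻¹ = s / (1 + s) := by field_simp; ring
    rw [this, le_div_iff₀ hpos]
    nlinarith [sq_nonneg s]
  have l4 : 19 * t ^ 2 / Q ≤ 76 * t ^ 2 / (1 + τ ^ 2) := by
    rw [div_le_div_iff₀ hQpos (by positivity)]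
    nlinarith [sq_nonneg t]
  have l5 : 19 * t ^ 2 / Q = 2 * (9 * t ^ 2 / Q) + t ^ 2 / Q := by ring
  have l6 : 0 ≤ t ^ 2 / Q := by positivity
  rw [abs_le]
  constructor <;> linarith

/-- The vertical slope of `kern` at `x = 1/2`. -/
def kernSlope (A τ : ℝ) : ℝ :=
  (-(2 * τ) / ((A - 1 / 2) ^ 2 + τ ^ 2) + -(2 * τ) / ((A + 1 / 2) ^ 2 + τ ^ 2)) / 4

theorem one_add_sq_le_of_abs_le {τ t : ℝ} (ht : |t| ≤ 1) : 1 + τ ^ 2 ≤ 3 * (1 + (τ - t) ^ 2) := by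
  have : t ^ 2 ≤ 1 := by rw [← sq_abs]; nlinarith [abs_nonneg t]
  nlinarith [sq_nonneg (2 * τ - 3 * t)]

/-- First `x` is moved to `1/2`, then `t` to `0`. The condition on `A` keeps `|A - 1/2| ≥ 1/2`, away
from the singularity of the logarithm. An error linear in `1/2 - x` but quadratic in `t` is what the
pole correction can absorb. -/
theorem abs_kern_taylor_le {A : ℝ} (hA : A = 0 ∨ 1 ≤ A) {x t : ℝ} (τ : ℝ) (hx : 1 / 4 ≤ x)
    (hx' : x ≤ 1 / 2) (ht : |t| ≤ 1 / 16) :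
    |kern A x (τ - t) - kern A (1 / 2) τ - t * kernSlope A τ| ≤
      (48 * (A + 1) + 38) * ((1 / 2 - x) + t ^ 2) / (1 + τ ^ 2) := by
  have hA0 : 0 ≤ A := by rcases hA with h | h <;> linarith
  have hu : 1 / 4 ≤ |A - x| ∧ 1 / 2 ≤ |A - 1 / 2| ∧ |A - x| + |A - 1 / 2| ≤ 2 * A + 1 ∧
      |(|A - x| - |A - 1 / 2|)| ≤ 1 / 2 - x := by
    rcases hA with rfl | h
    · rw [zero_sub, zero_sub, abs_neg, abs_neg, abs_of_nonneg (by linarith : (0 : ℝ) ≤ x),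
        abs_of_nonneg (by norm_num : (0 : ℝ) ≤ 1 / 2), abs_of_nonpos (by linarith)]
      refine ⟨hx, le_rfl, by linarith, by linarith⟩
    · rw [abs_of_nonneg (by linarith : 0 ≤ A - x), abs_of_nonneg (by linarith : 0 ≤ A - 1 / 2),
        abs_of_nonneg (by linarith)]
      refine ⟨by linarith, by linarith, by linarith, by linarith⟩
  obtain ⟨hu1, hu2, hu3, hu4⟩ := hu
  have hden : 1 + τ ^ 2 ≤ 3 * (1 + (τ - t) ^ 2) := one_add_sq_le_of_abs_le (by linarith)
  have hstep : ∀ {N : ℝ}, 0 ≤ N → N / (1 + (τ - t) ^ 2) ≤ 3 * N / (1 + τ ^ 2) := by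
    intro N hN
    rw [div_le_div_iff₀ (by positivity) (by positivity)]
    nlinarith
  have a1 := abs_log_sq_add_sq_sub_le (τ - t) hu1 (by linarith : 1 / 4 ≤ |A - 1 / 2|)
  have a2 := abs_log_sq_add_sq_sub_le (τ - t) (by linarith : 1 / 4 ≤ A + x)
    (by linarith : 1 / 4 ≤ A + 1 / 2)
  have b1 := abs_log_taylor_le (τ := τ) hu2 ht
  have b2 := abs_log_taylor_le (τ := τ) (by linarith : 1 / 2 ≤ A + 1 / 2) ht
  rw [sq_abs, sq_abs] at a1
  rw [sq_abs] at b1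
  have a1' := a1.trans (hstep (by positivity))
  have a2' := a2.trans (hstep (by positivity))
  have c1 : 3 * (16 * (|A - x| + |A - 1 / 2|) * |(|A - x| - |A - 1 / 2|)|) / (1 + τ ^ 2) ≤
      96 * (A + 1) * (1 / 2 - x) / (1 + τ ^ 2) := by
    rw [show 96 * (A + 1) * (1 / 2 - x) = 3 * (16 * (2 * A + 2) * (1 / 2 - x)) by ring]
    gcongr 3 * (16 * ?_ * ?_) / _
    linarith
  have c2 : 3 * (16 * (A + x + (A + 1 / 2)) * |A + x - (A + 1 / 2)|) / (1 + τ ^ 2) ≤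
      96 * (A + 1) * (1 / 2 - x) / (1 + τ ^ 2) := by
    rw [show 96 * (A + 1) * (1 / 2 - x) = 3 * (16 * (2 * A + 2) * (1 / 2 - x)) by ring]
    have : |A + x - (A + 1 / 2)| = 1 / 2 - x := by rw [abs_of_nonpos (by linarith)]; ring
    rw [this]
    have : 0 ≤ 1 / 2 - x := by linarith
    gcongr 3 * (16 * ?_ * _) / _
    linarith
  have e : (48 * (A + 1) + 38) * ((1 / 2 - x) + t ^ 2) / (1 + τ ^ 2) =
      48 * (A + 1) * (1 / 2 - x) / (1 + τ ^ 2) + 38 * t ^ 2 / (1 + τ ^ 2) +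
      (38 * (1 / 2 - x) + 48 * (A + 1) * t ^ 2) / (1 + τ ^ 2) := by ring
  have e' : 0 ≤ (38 * (1 / 2 - x) + 48 * (A + 1) * t ^ 2) / (1 + τ ^ 2) := by
    have : 0 ≤ 1 / 2 - x := by linarith
    positivity
  have f1 := a1'.trans c1
  have f2 := a2'.trans c2
  have g1 : 96 * (A + 1) * (1 / 2 - x) / (1 + τ ^ 2) =
      2 * (48 * (A + 1) * (1 / 2 - x) / (1 + τ ^ 2)) := by ring
  have g2 : 76 * t ^ 2 / (1 + τ ^ 2) = 2 * (38 * t ^ 2 / (1 + τ ^ 2)) := by ring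
  rw [g1] at f1 f2
  rw [g2] at b1 b2
  rw [e, kern, kern, kernSlope]
  rw [abs_le] at f1 f2 b1 b2 ⊢
  constructor <;> linarith [f1.1, f1.2, f2.1, f2.2, b1.1, b1.2, b2.1, b2.2]

theorem abs_kern_sub_half_le {A B : ℝ} (hA : A = 0 ∨ 1 ≤ A) (hB : 1 ≤ B) (hAB : A ≤ B) (τ : ℝ) :
    |kern B (1 / 2) τ - kern A (1 / 2) τ| ≤ 16 * (B + 1) ^ 2 / (1 + τ ^ 2) := by
  have hA0 : 0 ≤ A := by rcases hA with h | h <;> linarith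
  have hu : 1 / 2 ≤ |A - 1 / 2| ∧ |A - 1 / 2| ≤ B + 1 := by
    rcases hA with rfl | h
    · norm_num; linarith
    · rw [abs_of_nonneg (by linarith : 0 ≤ A - 1 / 2)]; constructor <;> linarith
  have a1 := abs_log_sq_add_sq_sub_le τ (by linarith : 1 / 4 ≤ B - 1 / 2)
    (by linarith [hu.1] : 1 / 4 ≤ |A - 1 / 2|)
  have a2 := abs_log_sq_add_sq_sub_le τ (by linarith : 1 / 4 ≤ B + 1 / 2)
    (by linarith : 1 / 4 ≤ A + 1 / 2)
  rw [sq_abs] at a1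
  have c1 : 16 * (B - 1 / 2 + |A - 1 / 2|) * |B - 1 / 2 - (|A - 1 / 2|)| / (1 + τ ^ 2) ≤
      16 * (2 * (B + 1)) * (B + 1) / (1 + τ ^ 2) := by
    have : |B - 1 / 2 - (|A - 1 / 2|)| ≤ B + 1 := by
      rw [abs_le]; constructor <;> linarith [hu.1, hu.2]
    gcongr
    linarith [hu.2]
  have c2 : 16 * (B + 1 / 2 + (A + 1 / 2)) * |B + 1 / 2 - (A + 1 / 2)| / (1 + τ ^ 2) ≤
      16 * (2 * (B + 1)) * (B + 1) / (1 + τ ^ 2) := by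
    have : |B + 1 / 2 - (A + 1 / 2)| ≤ B + 1 := by
      rw [abs_le]; constructor <;> linarith
    gcongr
    linarith
  have f1 := a1.trans c1
  have f2 := a2.trans c2
  have e : 16 * (2 * (B + 1)) * (B + 1) / (1 + τ ^ 2) = 2 * (16 * (B + 1) ^ 2 / (1 + τ ^ 2)) := by ring
  rw [e] at f1 f2
  rw [kern, kern]
  rw [abs_le] at f1 f2 ⊢
  constructor <;> linarith [f1.1, f1.2, f2.1, f2.2]

theorem abs_kern_sub_le {A B x : ℝ} (hA : 1 ≤ A) (hAB : A ≤ B) (hx : |x| ≤ 1 / 2) (y : ℝ) :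
    |kern B x y - kern A x y| ≤ 16 * (B + 1) ^ 2 / (1 + y ^ 2) := by
  rw [abs_le] at hx
  have a1 := abs_log_sq_add_sq_sub_le y (by linarith [hx.2] : 1 / 4 ≤ B - x)
    (by linarith [hx.2] : 1 / 4 ≤ A - x)
  have a2 := abs_log_sq_add_sq_sub_le y (by linarith [hx.1] : 1 / 4 ≤ B + x)
    (by linarith [hx.1] : 1 / 4 ≤ A + x)
  have c1 : 16 * (B - x + (A - x)) * |B - x - (A - x)| / (1 + y ^ 2) ≤
      16 * (2 * (B + 1)) * (B + 1) / (1 + y ^ 2) := by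
    have : |B - x - (A - x)| ≤ B + 1 := by rw [abs_le]; constructor <;> linarith
    gcongr <;> linarith [hx.1, hx.2]
  have c2 : 16 * (B + x + (A + x)) * |B + x - (A + x)| / (1 + y ^ 2) ≤
      16 * (2 * (B + 1)) * (B + 1) / (1 + y ^ 2) := by
    have : |B + x - (A + x)| ≤ B + 1 := by rw [abs_le]; constructor <;> linarith
    gcongr <;> linarith [hx.1, hx.2]
  have f1 := a1.trans c1
  have f2 := a2.trans c2
  have e : 16 * (2 * (B + 1)) * (B + 1) / (1 + y ^ 2) = 2 * (16 * (B + 1) ^ 2 / (1 + y ^ 2)) := by ring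
  rw [e] at f1 f2
  rw [kern, kern]
  rw [abs_le] at f1 f2 ⊢
  constructor <;> linarith [f1.1, f1.2, f2.1, f2.2]

/-- A single slope decays only like `1/τ`; the difference gains another power and is therefore
controlled by `poleMass` after integration. -/
theorem abs_kernSlope_sub_le {A B : ℝ} (hA : A = 0 ∨ 1 ≤ A) (hB : 1 ≤ B) (hAB : A ≤ B) (τ : ℝ) :
    |kernSlope B τ - kernSlope A τ| ≤ 4 * (B + 1) ^ 2 / (1 + τ ^ 2) := by
  have hA0 : 0 ≤ A := by rcases hA with h | h <;> linarith
  have key : ∀ {u v : ℝ}, 1 / 2 ≤ u → u ≤ B + 1 → 1 / 2 ≤ v → v ≤ B + 1 →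
      |-(2 * τ) / (u ^ 2 + τ ^ 2) - -(2 * τ) / (v ^ 2 + τ ^ 2)| ≤
        8 * (B + 1) ^ 2 / (1 + τ ^ 2) := by
    intro u v hu hu' hv hv'
    have hU : 0 < u ^ 2 + τ ^ 2 := by positivity
    have hV : 0 < v ^ 2 + τ ^ 2 := by positivity
    have e : -(2 * τ) / (u ^ 2 + τ ^ 2) - -(2 * τ) / (v ^ 2 + τ ^ 2) =
        2 * τ / (u ^ 2 + τ ^ 2) * ((u ^ 2 - v ^ 2) / (v ^ 2 + τ ^ 2)) := by field_simp; ring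
    rw [e, abs_mul, abs_div, abs_div, abs_of_pos hU, abs_of_pos hV]
    have h1 : |2 * τ| / (u ^ 2 + τ ^ 2) ≤ 2 := by
      rw [div_le_iff₀ hU, abs_mul, abs_two, ← sq_abs τ]
      nlinarith [sq_nonneg (|τ| - 1 / 2)]
    have h2 : |u ^ 2 - v ^ 2| / (v ^ 2 + τ ^ 2) ≤ 4 * (B + 1) ^ 2 / (1 + τ ^ 2) := by
      have h3 : |u ^ 2 - v ^ 2| ≤ (B + 1) ^ 2 := by
        have : u ^ 2 ≤ (B + 1) ^ 2 := by gcongr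
        have : v ^ 2 ≤ (B + 1) ^ 2 := by gcongr
        rw [abs_le]; constructor <;> nlinarith
      rw [div_le_div_iff₀ hV (by positivity)]
      have h4 : 1 + τ ^ 2 ≤ 4 * (v ^ 2 + τ ^ 2) := by nlinarith [sq_nonneg τ]
      calc |u ^ 2 - v ^ 2| * (1 + τ ^ 2) ≤ (B + 1) ^ 2 * (4 * (v ^ 2 + τ ^ 2)) := by gcongr
        _ = _ := by ring
    calc _ ≤ 2 * (4 * (B + 1) ^ 2 / (1 + τ ^ 2)) := by gcongr
      _ = _ := by ring
  have hu : 1 / 2 ≤ |A - 1 / 2| ∧ |A - 1 / 2| ≤ B + 1 := by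
    rcases hA with rfl | h
    · norm_num; linarith
    · rw [abs_of_nonneg (by linarith : 0 ≤ A - 1 / 2)]; constructor <;> linarith
  have k1 := key (by linarith : 1 / 2 ≤ B - 1 / 2) (by linarith) hu.1 hu.2
  have k2 := key (by linarith : 1 / 2 ≤ B + 1 / 2) (by linarith)
    (by linarith : 1 / 2 ≤ A + 1 / 2) (by linarith)
  rw [sq_abs] at k1
  have e : 8 * (B + 1) ^ 2 / (1 + τ ^ 2) = 2 * (4 * (B + 1) ^ 2 / (1 + τ ^ 2)) := by ring
  rw [e] at k1 k2
  rw [kernSlope, kernSlope]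
  rw [abs_le] at k1 k2 ⊢
  constructor <;> linarith [k1.1, k1.2, k2.1, k2.2]

end

/-! ### Convexity in `log (A² - 1/4)` and the test kernel -/

noncomputable section
open Set Filter Topology MeasureTheory intervalIntegral

/-- The product of the two distances is `|A² - (x + iy)²| = |α + r|` with `α = A² - 1/4` and `Re r =
1/4 - x² + y²`. The pole corresponds to `r = 0`, where `kern` is linear in `log α`; elsewhere in the
strip it is strictly convex in `log α`. -/
theorem kern_eq_log_quadratic {A x y : ℝ} (h : |x| < A) : kern A x y =
    Real.log ((A ^ 2 - 1 / 4) ^ 2 + 2 * (A ^ 2 - 1 / 4) * (1 / 4 - x ^ 2 + y ^ 2) +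
      ((1 / 4 - x ^ 2 + y ^ 2) ^ 2 + 4 * x ^ 2 * y ^ 2)) / 4 := by
  rw [kern_eq_log_mul h]
  congr 2
  ring

/-- First derivative of `s ↦ log (1 + 2ρ e^{-s} + σ e^{-2s})`. -/
theorem hasDerivAt_log_quadratic {ρ σ : ℝ} (hρ : 0 ≤ ρ) (hσ : 0 ≤ σ) (s : ℝ) :
    HasDerivAt (fun s => Real.log (1 + 2 * ρ * Real.exp (-s) + σ * Real.exp (-s) ^ 2))
      (-(2 * ρ * Real.exp (-s) + 2 * σ * Real.exp (-s) ^ 2) /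
        (1 + 2 * ρ * Real.exp (-s) + σ * Real.exp (-s) ^ 2)) s := by
  have hv : HasDerivAt (fun s => Real.exp (-s)) (-Real.exp (-s)) s := by
    simpa using (hasDerivAt_neg s).exp
  have h := ((hv.const_mul (2 * ρ)).const_add 1).add ((hv.pow 2).const_mul σ)
  have hne : 1 + 2 * ρ * Real.exp (-s) + σ * Real.exp (-s) ^ 2 ≠ 0 := by positivity
  refine (h.log hne).congr_deriv ?_
  simp only [Pi.add_apply, Pi.pow_apply]
  congr 1
  push_cast
  ring

/-- Second derivative of `s ↦ log (1 + 2ρ e^{-s} + σ e^{-2s})`. -/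
theorem hasDerivAt_deriv_log_quadratic {ρ σ : ℝ} (hρ : 0 ≤ ρ) (hσ : 0 ≤ σ) (s : ℝ) :
    HasDerivAt (fun s => -(2 * ρ * Real.exp (-s) + 2 * σ * Real.exp (-s) ^ 2) /
        (1 + 2 * ρ * Real.exp (-s) + σ * Real.exp (-s) ^ 2))
      ((2 * ρ * Real.exp (-s) + 4 * σ * Real.exp (-s) ^ 2 + 2 * ρ * σ * Real.exp (-s) ^ 3) /
        (1 + 2 * ρ * Real.exp (-s) + σ * Real.exp (-s) ^ 2) ^ 2) s := by
  have hv : HasDerivAt (fun s => Real.exp (-s)) (-Real.exp (-s)) s := by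
    simpa using (hasDerivAt_neg s).exp
  have h1 := ((hv.const_mul (2 * ρ)).const_add 1).add ((hv.pow 2).const_mul σ)
  have h2 := ((hv.const_mul (2 * ρ)).add ((hv.pow 2).const_mul (2 * σ))).neg
  have hne : 1 + 2 * ρ * Real.exp (-s) + σ * Real.exp (-s) ^ 2 ≠ 0 := by positivity
  refine (h2.div h1 hne).congr_deriv ?_
  simp only [Pi.add_apply, Pi.pow_apply, Pi.neg_apply]
  congr 1
  push_cast
  ring

/-- Quantitative convexity of `log ‖α + r‖` as a function of `log α`. -/
theorem slope_log_quadratic {ρ σ α β γ : ℝ} (hρ : 0 ≤ ρ) (hσ : ρ ^ 2 ≤ σ) (hα : 2 ≤ α)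
    (hαβ : α < β) (hβγ : β < γ) (hγ : γ ≤ 64) :
    (1 / 64) ^ 3 * (ρ / (1 + ρ + σ)) * (Real.log γ - Real.log α) / 2 ≤
      (Real.log (γ ^ 2 + 2 * γ * ρ + σ) - Real.log (β ^ 2 + 2 * β * ρ + σ)) /
        (Real.log γ - Real.log β) -
      (Real.log (β ^ 2 + 2 * β * ρ + σ) - Real.log (α ^ 2 + 2 * α * ρ + σ)) /
        (Real.log β - Real.log α) := by
  have hσ0 : 0 ≤ σ := (sq_nonneg ρ).trans hσ
  set m := (1 / 64) ^ 3 * (ρ / (1 + ρ + σ)) with hm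
  set u : ℝ → ℝ := fun s => Real.log (1 + 2 * ρ * Real.exp (-s) + σ * Real.exp (-s) ^ 2) with hu
  -- Since `m` bounds `u''` from below on the range, `φ` is convex. The slopes of the subtracted
  -- quadratic differ by `m (lc - la) / 2`, which is the claimed surplus.
  set φ : ℝ → ℝ := fun s => u s - m / 2 * s ^ 2 with hφ
  set la := Real.log α
  set lb := Real.log β
  set lc := Real.log γ
  have hab : la < lb := Real.log_lt_log (by linarith) hαβ
  have hbc : lb < lc := Real.log_lt_log (by linarith) hβγ
  have hconv : ConvexOn ℝ (Icc la lc) φ := by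
    refine convexOn_of_hasDerivWithinAt2_nonneg (convex_Icc _ _)
      (f' := fun s => -(2 * ρ * Real.exp (-s) + 2 * σ * Real.exp (-s) ^ 2) /
        (1 + 2 * ρ * Real.exp (-s) + σ * Real.exp (-s) ^ 2) - m * s)
      (f'' := fun s => (2 * ρ * Real.exp (-s) + 4 * σ * Real.exp (-s) ^ 2 +
        2 * ρ * σ * Real.exp (-s) ^ 3) /
        (1 + 2 * ρ * Real.exp (-s) + σ * Real.exp (-s) ^ 2) ^ 2 - m) ?_ ?_ ?_ ?_
    · intro s _
      exact ((hasDerivAt_log_quadratic hρ hσ0 s).continuousAt.sub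
        (by fun_prop)).continuousWithinAt
    · intro s _
      have h2 : HasDerivAt (fun s : ℝ => m / 2 * s ^ 2) (m * s) s := by
        refine ((hasDerivAt_pow 2 s).const_mul (m / 2)).congr_deriv ?_
        push_cast; ring
      exact ((hasDerivAt_log_quadratic hρ hσ0 s).sub h2).hasDerivWithinAt
    · intro s _
      have h2 : HasDerivAt (fun s : ℝ => m * s) m s := by
        simpa using (hasDerivAt_id' s).const_mul m
      exact ((hasDerivAt_deriv_log_quadratic hρ hσ0 s).sub h2).hasDerivWithinAt
    · intro s hs
      have hs' := interior_subset hs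
      have hv1 : Real.exp (-s) ≤ 1 / 2 := by
        rw [Real.exp_neg, one_div]
        refine inv_anti₀ two_pos ?_
        calc (2 : ℝ) ≤ α := hα
          _ = Real.exp la := (Real.exp_log (by linarith)).symm
          _ ≤ Real.exp s := Real.exp_le_exp.2 hs'.1
      have hv2 : 1 / 64 ≤ Real.exp (-s) := by
        rw [Real.exp_neg, one_div]
        refine inv_anti₀ (Real.exp_pos _) ?_
        calc Real.exp s ≤ Real.exp lc := Real.exp_le_exp.2 hs'.2
          _ = γ := Real.exp_log (by linarith)
          _ ≤ 64 := hγ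
      set v := Real.exp (-s)
      have hv0 : 0 < v := Real.exp_pos _
      have hP : 0 < 1 + 2 * ρ * v + σ * v ^ 2 := by positivity
      have hP0 : 1 + 2 * ρ * v + σ * v ^ 2 ≤ 1 + ρ + σ / 4 := by
        have h1 : σ * v ^ 2 ≤ σ * (1 / 2) ^ 2 := by gcongr
        have h2 : 2 * ρ * v ≤ 2 * ρ * (1 / 2) := by gcongr
        linarith
      have hP1 : 1 + 2 * ρ * v + σ * v ^ 2 ≤ 2 * (1 + σ) := by
        nlinarith [sq_nonneg (ρ - 1)]
      have hP2 : 1 + 2 * ρ * v + σ * v ^ 2 ≤ 1 + ρ + σ := by linarith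
      -- The two copies of the denominator are bounded differently: the factor `1 + σ` cancels the
      -- one in the numerator, and `1 + ρ + σ` remains.
      have hP3 : (1 + 2 * ρ * v + σ * v ^ 2) ^ 2 ≤ 2 * (1 + σ) * (1 + ρ + σ) := by
        rw [sq]
        exact mul_le_mul hP1 hP2 hP.le (by positivity)
      rw [sub_nonneg, hm, le_div_iff₀ (by positivity)]
      have hnum : 2 * (1 / 64) ^ 3 * ρ * (1 + σ) ≤
          2 * ρ * v + 4 * σ * v ^ 2 + 2 * ρ * σ * v ^ 3 := by
        have h3 : (1 / 64) ^ 3 ≤ v ^ 3 := by gcongr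
        have h4 : (1 / 64 : ℝ) ^ 3 ≤ v := by norm_num at hv2 ⊢; linarith
        have e1 : 2 * ρ * (1 / 64) ^ 3 ≤ 2 * ρ * v := by gcongr
        have e2 : 2 * ρ * σ * (1 / 64) ^ 3 ≤ 2 * ρ * σ * v ^ 3 := by gcongr
        have e3 : 0 ≤ 4 * σ * v ^ 2 := by positivity
        linarith
      calc (1 / 64) ^ 3 * (ρ / (1 + ρ + σ)) * (1 + 2 * ρ * v + σ * v ^ 2) ^ 2
          ≤ (1 / 64) ^ 3 * (ρ / (1 + ρ + σ)) * (2 * (1 + σ) * (1 + ρ + σ)) := by gcongr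
        _ = 2 * (1 / 64) ^ 3 * ρ * (1 + σ) := by field_simp
        _ ≤ _ := hnum
  have hslope := hconv.slope_mono_adjacent (x := la) (y := lb) (z := lc)
    ⟨le_rfl, by linarith⟩ ⟨by linarith, le_rfl⟩ hab hbc
  have hval : ∀ {a : ℝ}, 0 < a →
      Real.log (a ^ 2 + 2 * a * ρ + σ) = 2 * Real.log a + u (Real.log a) := by
    intro a ha
    have : a ^ 2 + 2 * a * ρ + σ =
        a ^ 2 * (1 + 2 * ρ * Real.exp (-Real.log a) + σ * Real.exp (-Real.log a) ^ 2) := by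
      rw [Real.exp_neg, Real.exp_log ha]; field_simp
    rw [this, Real.log_mul (by positivity) (by positivity), Real.log_pow]
    push_cast; rfl
  rw [hval (by linarith), hval (by linarith), hval (by linarith)]
  have e1 : (φ lb - φ la) / (lb - la) = (u lb - u la) / (lb - la) - m / 2 * (lb + la) := by
    rw [hφ]; have : lb - la ≠ 0 := by linarith
    field_simp; ring
  have e2 : (φ lc - φ lb) / (lc - lb) = (u lc - u lb) / (lc - lb) - m / 2 * (lc + lb) := by
    rw [hφ]; have : lc - lb ≠ 0 := by linarith
    field_simp; ring
  rw [e1, e2] at hslope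
  have e3 : (2 * lb + u lb - (2 * la + u la)) / (lb - la) = 2 + (u lb - u la) / (lb - la) := by
    have : lb - la ≠ 0 := by linarith
    field_simp; ring
  have e4 : (2 * lc + u lc - (2 * lb + u lb)) / (lc - lb) = 2 + (u lc - u lb) / (lc - lb) := by
    have : lc - lb ≠ 0 := by linarith
    field_simp; ring
  change m * (lc - la) / 2 ≤ (2 * lc + u lc - (2 * lb + u lb)) / (lc - lb) -
    (2 * lb + u lb - (2 * la + u la)) / (lb - la)
  rw [e3, e4]
  linarith


theorem kern_half_zero {A : ℝ} (hA : 1 ≤ A) :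
    kern A (1 / 2) 0 = Real.log (A ^ 2 - 1 / 4) / 2 := by
  rw [kern_eq_log_quadratic (by rw [abs_of_nonneg] <;> linarith)]
  have : (A ^ 2 - 1 / 4) ^ 2 + 2 * (A ^ 2 - 1 / 4) * (1 / 4 - (1 / 2) ^ 2 + 0 ^ 2) +
      ((1 / 4 - (1 / 2) ^ 2 + 0 ^ 2) ^ 2 + 4 * (1 / 2) ^ 2 * 0 ^ 2) = (A ^ 2 - 1 / 4) ^ 2 := by
    ring
  rw [this, Real.log_pow]
  push_cast
  ring

theorem kern_sub_half_zero_pos {A B : ℝ} (hA : 1 ≤ A) (hAB : A < B) :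
    0 < kern B (1 / 2) 0 - kern A (1 / 2) 0 := by
  rw [kern_half_zero hA, kern_half_zero (hA.trans hAB.le)]
  have := Real.log_lt_log (x := A ^ 2 - 1 / 4) (y := B ^ 2 - 1 / 4) (by nlinarith) (by nlinarith)
  linarith

/-- The normalised difference of two test kernels vanishes at the pole and is positive elsewhere. -/
theorem exists_test_kernel_lower_bound : ∃ c : ℝ, 0 < c ∧ ∀ x y : ℝ, |x| ≤ 1 / 2 →
    c * ((1 / 4 - x ^ 2 + y ^ 2) / (1 + (1 / 4 - x ^ 2 + y ^ 2)) ^ 2) ≤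
      (kern 8 x y - kern 6 x y) / (kern 8 (1 / 2) 0 - kern 6 (1 / 2) 0) -
      (kern 6 x y - kern 4 x y) / (kern 6 (1 / 2) 0 - kern 4 (1 / 2) 0) := by
  have hα := Real.log_lt_log (x := 4 ^ 2 - 1 / 4) (y := 6 ^ 2 - 1 / 4) (by norm_num) (by norm_num)
  have hβ := Real.log_lt_log (x := 6 ^ 2 - 1 / 4) (y := 8 ^ 2 - 1 / 4) (by norm_num) (by norm_num)
  refine ⟨(1 / 64) ^ 3 * (Real.log (8 ^ 2 - 1 / 4) - Real.log (4 ^ 2 - 1 / 4)) / 4,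
    by have := hα.trans hβ; have h := sub_pos.2 this; positivity, fun x y hx => ?_⟩
  have hx2 : x ^ 2 ≤ 1 / 4 := by
    have := sq_le_sq' (neg_le_of_abs_le hx) (le_of_abs_le hx)
    norm_num at this ⊢
    linarith
  rw [kern_half_zero (by norm_num), kern_half_zero (by norm_num), kern_half_zero (by norm_num),
    kern_eq_log_quadratic (A := 8) (by linarith), kern_eq_log_quadratic (A := 6) (by linarith),
    kern_eq_log_quadratic (A := 4) (by linarith)]
  set ρ := 1 / 4 - x ^ 2 + y ^ 2 with hρ
  have hρy : y ^ 2 ≤ ρ := by linarith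
  have hρ0 : 0 ≤ ρ := (sq_nonneg y).trans hρy
  set σ := ρ ^ 2 + 4 * x ^ 2 * y ^ 2 with hσ
  have hσ1 : ρ ^ 2 ≤ σ := by have : 0 ≤ 4 * x ^ 2 * y ^ 2 := by positivity
                             linarith
  -- Here `|x| ≤ 1/2` gives `4x²y² ≤ y² ≤ ρ`, so `σ` can be eliminated in favour of `ρ`.
  have hσ2 : 1 + ρ + σ ≤ (1 + ρ) ^ 2 := by
    have : 4 * x ^ 2 * y ^ 2 ≤ 4 * (1 / 4) * y ^ 2 := by gcongr
    nlinarith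
  have h := slope_log_quadratic (α := 4 ^ 2 - 1 / 4) (β := 6 ^ 2 - 1 / 4) (γ := 8 ^ 2 - 1 / 4)
    hρ0 hσ1 (by norm_num) (by norm_num) (by norm_num) (by norm_num)
  have hm : ρ / (1 + ρ) ^ 2 ≤ ρ / (1 + ρ + σ) := by
    have : 0 ≤ σ := (sq_nonneg ρ).trans hσ1
    gcongr
  set la := Real.log (4 ^ 2 - 1 / 4)
  set lb := Real.log (6 ^ 2 - 1 / 4)
  set lc := Real.log (8 ^ 2 - 1 / 4)
  have hd : 0 ≤ lc - la := by linarith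
  have h1 : (1 / 64) ^ 3 * (lc - la) / 4 * (ρ / (1 + ρ) ^ 2) ≤
      ((1 / 64) ^ 3 * (ρ / (1 + ρ + σ)) * (lc - la) / 2) / 2 := by
    calc _ ≤ (1 / 64) ^ 3 * (lc - la) / 4 * (ρ / (1 + ρ + σ)) := by gcongr
      _ = _ := by ring
  refine h1.trans ((div_le_div_of_nonneg_right h zero_le_two).trans (le_of_eq ?_))
  have e1 : lc - lb ≠ 0 := by linarith
  have e2 : lb - la ≠ 0 := by linarith
  have e3 : lc / 2 - lb / 2 ≠ 0 := by intro h; apply e1; linarith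
  have e4 : lb / 2 - la / 2 ≠ 0 := by intro h; apply e2; linarith
  rw [← sub_div, ← sub_div, ← sub_div, ← sub_div, div_div_eq_mul_div, div_div_eq_mul_div]
  ring

end

/-! ### Forcing a potential to vanish at the pole -/

noncomputable section
open Set Filter Topology MeasureTheory intervalIntegral

theorem kern_neg_left (A x y : ℝ) : kern A (-x) y = kern A x y := by
  rw [kern, kern, sub_neg_eq_add, ← sub_eq_add_neg, add_comm]

theorem kern_neg_right (A x y : ℝ) : kern A x (-y) = kern A x y := by
  rw [kern, kern, neg_sq]

theorem kern_abs_left (A x y : ℝ) : kern A |x| y = kern A x y := by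
  rcases abs_choice x with h | h <;> rw [h]
  exact kern_neg_left A x y

theorem kernSlope_neg (A τ : ℝ) : kernSlope A (-τ) = -kernSlope A τ := by
  rw [kernSlope, kernSlope, neg_sq]; ring

theorem kernSlope_zero (A : ℝ) : kernSlope A 0 = 0 := by simp [kernSlope]

theorem kernSlope_sub_pos : 0 < kernSlope 6 1 - kernSlope 4 1 := by
  rw [kernSlope, kernSlope]; norm_num

/-- Test kernel used to modify the values at the poles. -/
def testKern (τ x t : ℝ) : ℝ := kern 6 x (τ - t) - kern 4 x (τ - t)

theorem abs_testKern_taylor_le {x t : ℝ} (τ : ℝ) (hx : 1 / 4 ≤ x)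
    (hx' : x ≤ 1 / 2) (ht : |t| ≤ 1 / 16) :
    |testKern τ x t - testKern τ (1 / 2) 0 - t * (kernSlope 6 τ - kernSlope 4 τ)| ≤
      700 * ((1 / 2 - x) + t ^ 2) / (1 + τ ^ 2) := by
  have h1 := abs_kern_taylor_le (A := 6) (Or.inr (by norm_num)) τ hx hx' ht
  have h2 := abs_kern_taylor_le (A := 4) (Or.inr (by norm_num)) τ hx hx' ht
  have e : 700 * ((1 / 2 - x) + t ^ 2) / (1 + τ ^ 2) =
      (48 * (6 + 1) + 38) * ((1 / 2 - x) + t ^ 2) / (1 + τ ^ 2) +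
      (48 * (4 + 1) + 38) * ((1 / 2 - x) + t ^ 2) / (1 + τ ^ 2) +
      48 * ((1 / 2 - x) + t ^ 2) / (1 + τ ^ 2) := by ring
  have h3 : 0 ≤ 48 * ((1 / 2 - x) + t ^ 2) / (1 + τ ^ 2) :=
    div_nonneg (mul_nonneg (by norm_num) (add_nonneg (by linarith) (sq_nonneg t))) (by positivity)
  rw [e, testKern, testKern, sub_zero]
  rw [abs_le] at h1 h2 ⊢
  constructor <;> linarith [h1.1, h1.2, h2.1, h2.2]

theorem abs_testKern_le {x : ℝ} (τ t : ℝ) (hx : |x| ≤ 1 / 2) (hτ : |τ| ≤ 1) :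
    |testKern τ x t| ≤ 2352 * (1 / (1 + t ^ 2)) := by
  refine (abs_kern_sub_le (A := 4) (B := 6) (by norm_num) (by norm_num) hx (τ - t)).trans ?_
  have := one_add_sq_le_of_abs_le (τ := t) hτ
  rw [mul_one_div, div_le_div_iff₀ (by positivity) (by positivity)]
  nlinarith

theorem sq_le_sq_of_abs_le {x r : ℝ} (h : |x| ≤ r) : x ^ 2 ≤ r ^ 2 := by
  rw [← sq_abs x]
  exact pow_le_pow_left₀ (abs_nonneg x) h 2

theorem one_div_div_le_div_sq {ρ y : ℝ} (hρ : 1 / 256 ≤ ρ) (hρy : ρ ≤ y) (hy : 1 ≤ y) :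
    1 / y / 1024 ≤ ρ / (1 + ρ) ^ 2 := by
  rw [div_div, div_le_div_iff₀ (by positivity) (by positivity), one_mul]
  have h1 : 1 / 256 ≤ ρ * y := by nlinarith
  have h2 : ρ ^ 2 ≤ ρ * y := by nlinarith
  nlinarith [sq_nonneg (ρ - 1)]

set_option maxHeartbeats 400000 in
/-- A nonnegative potential can be modified by a small combination of test kernels so that it
vanishes at the pole `1` and remains nonnegative on the critical strip. -/
theorem exists_pole_correction {N₀ : ℝ} (hN₀ : 0 ≤ N₀) : ∃ C : ℝ, 0 ≤ C ∧
    ∀ (Ψ : ℝ → ℝ → ℝ) (μ ω : ℝ), 0 ≤ ω → (∀ x t, |x| ≤ 1 / 2 → 0 ≤ Ψ x t) →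
      (∀ x t, Ψ |x| t = Ψ x t) →
      (∀ x t, 1 / 4 ≤ x → x ≤ 1 / 2 → |t| ≤ 1 / 16 →
        |Ψ x t - Ψ (1 / 2) 0 - t * μ| ≤ N₀ * ω * ((1 / 2 - x) + t ^ 2)) →
      |Ψ (1 / 2) 0| ≤ N₀ * ω → |μ| ≤ N₀ * ω →
      ∃ a₀ a₁ a₂ : ℝ, |a₀| ≤ C * ω ∧ |a₁| ≤ C * ω ∧ |a₂| ≤ C * ω ∧
        Ψ (1 / 2) 0 + a₀ * testKern 0 (1 / 2) 0 +
          a₁ * (testKern 1 (1 / 2) 0 - testKern (-1) (1 / 2) 0) +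
          a₂ * (kern 8 (1 / 2) 0 - kern 6 (1 / 2) 0) = 0 ∧
        ∀ x t, |x| ≤ 1 / 2 → 0 ≤ Ψ x t + a₀ * testKern 0 x t +
          a₁ * (testKern 1 x t - testKern (-1) x t) +
          a₂ * (kern 8 x (0 - t) - kern 6 x (0 - t)) := by
  obtain ⟨c, hc, hZ⟩ := exists_test_kernel_lower_bound
  have hP := kern_sub_half_zero_pos (A := 4) (B := 6) (by norm_num) (by norm_num)
  have hR := kern_sub_half_zero_pos (A := 6) (B := 8) (by norm_num) (by norm_num)
  set P := kern 6 (1 / 2) 0 - kern 4 (1 / 2) 0 with hPdef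
  set R := kern 8 (1 / 2) 0 - kern 6 (1 / 2) 0 with hRdef
  set s := 2 * (kernSlope 6 1 - kernSlope 4 1) with hs
  have hs0 : 0 < s := by have := kernSlope_sub_pos; positivity
  -- Any `M` that beats the Taylor errors `700 E` after the loss of `8` near the pole, and the
  -- kernel bounds up to `4704 h` after the loss of `1024` away from it, would do.
  set M : ℝ := 10000000 * (1 + 1 / P + 1 / s) with hM
  have hM0 : 0 ≤ M := by positivity
  refine ⟨N₀ * (1 / P + M / c / P + 1 / s + M / c / R), by positivity,
    fun Ψ μ ω hω h0 heven htaylor hα hμ => ?_⟩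
  set α := Ψ (1 / 2) 0 with hαdef
  set N := N₀ * ω with hN
  have hN0 : 0 ≤ N := by positivity
  have htk0 : testKern 0 (1 / 2) 0 = P := by rw [testKern, sub_zero]
  have htk1 : testKern 1 (1 / 2) 0 - testKern (-1) (1 / 2) 0 = 0 := by
    rw [testKern, testKern, sub_zero, sub_zero, kern_neg_right, kern_neg_right, sub_self]
  have hC : N₀ * (1 / P + M / c / P + 1 / s + M / c / R) * ω =
      N / P + N * (M / c) / P + N / s + N * (M / c) / R := by rw [hN]; ring
  have n1 : 0 ≤ N / P := by positivity
  have n2 : 0 ≤ N * (M / c) / P := by positivity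
  have n3 : 0 ≤ N / s := by positivity
  have n4 : 0 ≤ N * (M / c) / R := by positivity
  have b1 : |α / P| ≤ N / P := by rw [abs_div, abs_of_pos hP]; gcongr
  have b2 : |μ / s| ≤ N / s := by rw [abs_div, abs_of_pos hs0]; gcongr
  -- The part `-α/P` cancels the value at the pole and `-μ/s` the slope in `t`. The two terms with
  -- `M/c` form the test kernel, which vanishes at the pole and dominates what is left.
  refine ⟨-(α / P) - N * (M / c) / P, -(μ / s), N * (M / c) / R, ?_, ?_, ?_, ?_, ?_⟩
  · rw [hC]
    rw [abs_le] at b1 ⊢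
    constructor <;> linarith [b1.1, b1.2]
  · rw [hC, abs_neg]; linarith
  · rw [hC, abs_of_nonneg n4]; linarith
  · rw [htk0, htk1]; field_simp; ring
  · intro x t hx
    set ρ := 1 / 4 - x ^ 2 + t ^ 2 with hρ
    have hform : Ψ x t + (-(α / P) - N * (M / c) / P) * testKern 0 x t +
          -(μ / s) * (testKern 1 x t - testKern (-1) x t) +
          N * (M / c) / R * (kern 8 x (0 - t) - kern 6 x (0 - t)) =
        Ψ x t - α / P * testKern 0 x t - μ / s * (testKern 1 x t - testKern (-1) x t) +
        N * (M / c) * ((kern 8 x (0 - t) - kern 6 x (0 - t)) / R -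
          (kern 6 x (0 - t) - kern 4 x (0 - t)) / P) := by
      rw [testKern, testKern, testKern]; ring
    have hZ' := hZ x (0 - t) hx
    rw [show (0 - t) ^ 2 = t ^ 2 by ring] at hZ'
    have hZM : N * M * (ρ / (1 + ρ) ^ 2) ≤ N * (M / c) *
        ((kern 8 x (0 - t) - kern 6 x (0 - t)) / R -
          (kern 6 x (0 - t) - kern 4 x (0 - t)) / P) := by
      have hMc : M / c * c = M := div_mul_cancel₀ _ hc.ne'
      have := mul_le_mul_of_nonneg_left hZ' (show 0 ≤ N * (M / c) by positivity)
      rwa [← mul_assoc, mul_assoc N (M / c) c, hMc] at this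
    rw [hform]
    have hx2 : x ^ 2 ≤ 1 / 4 := (sq_le_sq_of_abs_le hx).trans_eq (by norm_num)
    have hρ0 : 0 ≤ ρ := by rw [hρ]; linarith [sq_nonneg t]
    have hM' : N * M = 10000000 * (N + N / P + N / s) := by rw [hM]; ring
    -- Near the pole the value and slope cancel and only an error of size `E` remains. Elsewhere `Ψ
    -- ≥ 0` is used, and the added kernels decay like `1/(1 + t²)`, no slower than the test kernel's
    -- lower bound.
    by_cases hnear : 1 / 4 ≤ |x| ∧ |t| ≤ 1 / 16
    · obtain ⟨hx4, ht⟩ := hnear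
      have ev : ∀ τ, testKern τ x t = testKern τ |x| t := fun τ => by
        simp only [testKern, kern_abs_left]
      have t2 : t ^ 2 ≤ 1 / 256 := (sq_le_sq_of_abs_le ht).trans_eq (by norm_num)
      set E := (1 / 2 - |x|) + t ^ 2 with hE
      have hE0 : 0 ≤ E := by have := sq_nonneg t; linarith
      -- Because `1/4 - x² = (1/2 - |x|)(1/2 + |x|)`, the quantity `ρ` sees `1/2 - |x|` to first
      -- order.
      have hρE : E / 2 ≤ ρ := by
        have := mul_nonneg (sub_nonneg.2 hx) (abs_nonneg x)
        rw [hρ, hE, ← sq_abs x]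
        linarith only [this, sq_nonneg t]
      have hρ1 : ρ ≤ 1 := by rw [hρ]; linarith [sq_nonneg x]
      have hlow : E / 8 ≤ ρ / (1 + ρ) ^ 2 := by
        calc E / 8 ≤ ρ / (1 + 1) ^ 2 := by linarith
          _ ≤ _ := by gcongr
      have h1 := htaylor |x| t hx4 hx ht
      rw [heven, ← hE] at h1
      have h1' := (abs_le.1 h1).1
      have h2 := abs_testKern_taylor_le 0 hx4 hx ht
      rw [kernSlope_zero, kernSlope_zero, htk0, ← ev] at h2
      have h3 := abs_testKern_taylor_le 1 hx4 hx ht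
      have h4 := abs_testKern_taylor_le (-1) hx4 hx ht
      rw [← ev] at h3 h4
      rw [kernSlope_neg, kernSlope_neg] at h4
      have h5 : |testKern 1 x t - testKern (-1) x t - t * s| ≤ 700 * E := by
        rw [abs_le] at h3 h4 ⊢
        have : t * s = t * (kernSlope 6 1 - kernSlope 4 1) -
          t * (-kernSlope 6 1 - -kernSlope 4 1) := by rw [hs]; ring
        norm_num at h3 h4
        constructor <;> linarith [h3.1, h3.2, h4.1, h4.2]
      have h6 : |testKern 0 x t - P| ≤ 700 * E := by
        norm_num at h2; exact h2
      have h7 : |α / P * (testKern 0 x t - P)| ≤ N / P * (700 * E) := by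
        rw [abs_mul]; gcongr
      have h8 : |μ / s * (testKern 1 x t - testKern (-1) x t - t * s)| ≤ N / s * (700 * E) := by
        rw [abs_mul]; gcongr
      have e1 : α / P * (testKern 0 x t - P) = α / P * testKern 0 x t - α := by
        field_simp
      have e2 : μ / s * (testKern 1 x t - testKern (-1) x t - t * s) =
          μ / s * (testKern 1 x t - testKern (-1) x t) - t * μ := by field_simp
      rw [e1] at h7
      rw [e2] at h8
      have h9 : N * M * (E / 8) ≤ N * M * (ρ / (1 + ρ) ^ 2) := by gcongr
      rw [hM'] at h9
      have q0 : 0 ≤ N * E := by positivity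
      have q1 : 0 ≤ N / P * E := by positivity
      have q2 : 0 ≤ N / s * E := by positivity
      rw [hM'] at hZM
      have h7' := (abs_le.1 h7).2
      have h8' := (abs_le.1 h8).2
      linarith only [h1', h7', h8', h9, hZM, q0, q1, q2]
    · have hρl : 1 / 256 ≤ ρ := by
        rw [not_and_or, not_le, not_le] at hnear
        rcases hnear with h | h
        · have : x ^ 2 ≤ 1 / 16 := (sq_le_sq_of_abs_le h.le).trans_eq (by norm_num)
          rw [hρ]; linarith [sq_nonneg t]
        · have : (1 / 16) ^ 2 ≤ |t| ^ 2 := pow_le_pow_left₀ (by norm_num) h.le 2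
          rw [sq_abs] at this
          norm_num at this
          rw [hρ]; linarith
      have hρu : ρ ≤ 1 + t ^ 2 := by rw [hρ]; linarith [sq_nonneg x]
      set h := 1 / (1 + t ^ 2) with hh
      have hh0 : 0 ≤ h := by positivity
      have hlow : h / 1024 ≤ ρ / (1 + ρ) ^ 2 := by
        exact one_div_div_le_div_sq hρl hρu (by linarith [sq_nonneg t])
      have h1 := h0 x t hx
      have h2 := abs_testKern_le 0 t hx (by norm_num)
      have h3 := abs_testKern_le 1 t hx (by norm_num)
      have h4 := abs_testKern_le (-1) t hx (by norm_num)
      have h5 : |testKern 1 x t - testKern (-1) x t| ≤ 4704 * h := by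
        rw [abs_le] at h3 h4 ⊢
        constructor <;> linarith [h3.1, h3.2, h4.1, h4.2]
      have h7 : |α / P * testKern 0 x t| ≤ N / P * (2352 * h) := by
        rw [abs_mul]; gcongr
      have h8 : |μ / s * (testKern 1 x t - testKern (-1) x t)| ≤ N / s * (4704 * h) := by
        rw [abs_mul]; gcongr
      have h9 : N * M * (h / 1024) ≤ N * M * (ρ / (1 + ρ) ^ 2) := by gcongr
      rw [hM'] at h9
      have q0 : 0 ≤ N * h := by positivity
      have q1 : 0 ≤ N / P * h := by positivity
      have q2 : 0 ≤ N / s * h := by positivity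
      rw [hM'] at hZM
      have h7' := (abs_le.1 h7).2
      have h8' := (abs_le.1 h8).2
      linarith only [h1, h7', h8', h9, hZM, q0, q1, q2]

end

/-! ### The corrected functional on single kernels -/

noncomputable section
open Set Filter Topology MeasureTheory intervalIntegral

theorem intervalIntegrable_kern {A : ℝ} (hA : A = 0 ∨ 1 ≤ A) {x : ℝ} (hx : |x| ≤ 1 / 2)
    (t p q : ℝ) : IntervalIntegrable (fun τ => kern A x (τ - t)) volume p q := by
  rcases hA with rfl | h
  · exact intervalIntegrable_kern_zero x t p q
  · exact (continuous_kern_sub (by linarith) t).intervalIntegrable p q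

theorem continuous_kernSlope {A : ℝ} (hA : A = 0 ∨ 1 ≤ A) : Continuous (kernSlope A) := by
  have h1 : A - 1 / 2 ≠ 0 := by rcases hA with rfl | h <;> intro h' <;> linarith
  have h2 : A + 1 / 2 ≠ 0 := by rcases hA with rfl | h <;> intro h' <;> linarith
  unfold kernSlope
  have e1 : ∀ τ : ℝ, (A - 1 / 2) ^ 2 + τ ^ 2 ≠ 0 := fun τ => by positivity
  have e2 : ∀ τ : ℝ, (A + 1 / 2) ^ 2 + τ ^ 2 ≠ 0 := fun τ => by positivity
  fun_prop (disch := assumption)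

theorem continuous_one_div_one_add_sq : Continuous fun τ : ℝ => 1 / (1 + τ ^ 2) := by
  have e1 : ∀ τ : ℝ, 1 + τ ^ 2 ≠ 0 := fun τ => by positivity
  fun_prop (disch := assumption)

/-- The mass of an interval as seen from the poles. -/
def poleMass (a b : ℝ) : ℝ := ∫ τ in a..b, 1 / (1 + τ ^ 2)

theorem poleMass_nonneg {a b : ℝ} (h : a ≤ b) : 0 ≤ poleMass a b :=
  integral_nonneg h fun τ _ => by positivity

theorem poleMass_mono {a b p q : ℝ} (h1 : a ≤ p) (h2 : p ≤ q) (h3 : q ≤ b) :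
    poleMass p q ≤ poleMass a b :=
  integral_mono_interval h1 h2 h3 (Filter.Eventually.of_forall fun τ => by positivity)
    (continuous_one_div_one_add_sq.intervalIntegrable _ _)

theorem abs_integral_le_poleMass {g : ℝ → ℝ} {M p q : ℝ} (hpq : p ≤ q)
    (hg : ∀ τ, |g τ| ≤ M / (1 + τ ^ 2)) : |∫ τ in p..q, g τ| ≤ M * poleMass p q := by
  have h := intervalIntegral.norm_integral_le_of_norm_le (μ := volume) (f := g)
    (g := fun τ => M * (1 / (1 + τ ^ 2))) hpq
    (Filter.Eventually.of_forall fun τ _ => by rw [mul_one_div]; exact hg τ)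
    ((continuous_one_div_one_add_sq.const_mul M).intervalIntegrable _ _)
  rw [intervalIntegral.integral_const_mul] at h
  exact h

theorem abs_integral_kern_taylor_le {A B : ℝ} (hA : A = 0 ∨ 1 ≤ A) (hB : 1 ≤ B) (hAB : A ≤ B)
    {p q x t : ℝ} (hpq : p ≤ q) (hx : 1 / 4 ≤ x) (hx' : x ≤ 1 / 2) (ht : |t| ≤ 1 / 16) :
    |(∫ τ in p..q, (kern B x (τ - t) - kern A x (τ - t))) -
      (∫ τ in p..q, (kern B (1 / 2) (τ - 0) - kern A (1 / 2) (τ - 0))) -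
      t * ∫ τ in p..q, (kernSlope B τ - kernSlope A τ)| ≤
      (96 * (B + 1) + 76) * ((1 / 2 - x) + t ^ 2) * poleMass p q := by
  have hxa : |x| ≤ 1 / 2 := by rw [abs_of_nonneg] <;> linarith
  have hha : |(1 / 2 : ℝ)| ≤ 1 / 2 := by norm_num
  have i1 := (intervalIntegrable_kern (Or.inr hB) hxa t p q).sub
    (intervalIntegrable_kern hA hxa t p q)
  have i2 := (intervalIntegrable_kern (Or.inr hB) hha 0 p q).sub
    (intervalIntegrable_kern hA hha 0 p q)
  have i3 : IntervalIntegrable (fun τ => t * (kernSlope B τ - kernSlope A τ)) volume p q :=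
    (((continuous_kernSlope (Or.inr hB)).sub (continuous_kernSlope hA)).const_mul
      t).intervalIntegrable p q
  rw [← intervalIntegral.integral_const_mul, ← intervalIntegral.integral_sub i1 i2,
    ← intervalIntegral.integral_sub (i1.sub i2) i3]
  refine abs_integral_le_poleMass hpq fun τ => ?_
  have h1 := abs_kern_taylor_le hA τ hx hx' ht
  have h2 := abs_kern_taylor_le (Or.inr hB) τ hx hx' ht
  set E := (1 / 2 - x) + t ^ 2 with hE
  have hE0 : 0 ≤ E := by have := sq_nonneg t; linarith
  have h3 : (48 * (A + 1) + 38) * E / (1 + τ ^ 2) ≤ (48 * (B + 1) + 38) * E / (1 + τ ^ 2) := by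
    gcongr
  have h4 : (96 * (B + 1) + 76) * E / (1 + τ ^ 2) =
      2 * ((48 * (B + 1) + 38) * E / (1 + τ ^ 2)) := by ring
  rw [h4, sub_zero]
  rw [abs_le] at h1 h2 ⊢
  constructor <;> linarith [h1.1, h1.2, h2.1, h2.2]

/-- The potential of the functional that compares the critical line with lines to the right. -/
def basePotential (K W a b x t : ℝ) : ℝ :=
  K * (1 + ((2 * K + 2) ^ 2 + 1) / W) *
      (∫ τ in a..b, (kern (2 * K + 2) x (τ - t) - kern (2 * K) x (τ - t))) -
    ∫ τ in (a + 2 * W)..(b - 2 * W), (kern (2 * K) x (τ - t) - kern 0 x (τ - t))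

/-- The functional of `u`, where `u A τ` stands for `log ‖Λ(1/2 + A + iτ)‖`. -/
def lineFunctional (K W a b a₀ a₁ a₂ : ℝ) (u : ℝ → ℝ → ℝ) : ℝ :=
  K * (1 + ((2 * K + 2) ^ 2 + 1) / W) * (∫ τ in a..b, (u (2 * K + 2) τ - u (2 * K) τ)) -
    (∫ τ in (a + 2 * W)..(b - 2 * W), (u (2 * K) τ - u 0 τ)) + a₀ * (u 6 0 - u 4 0) +
    a₁ * ((u 6 1 - u 4 1) - (u 6 (-1) - u 4 (-1))) + a₂ * (u 8 0 - u 6 0)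

/-- The pole correction is applied to `basePotential`. Its value, slope and Taylor error at the pole
are integrals of functions that are `O(1/(1 + τ²))`, hence `O(poleMass a b)`, and the correction
coefficients inherit this bound with a constant depending only on `K`. -/
theorem exists_lineFunctional_nonneg {K : ℝ} (hK : 1 ≤ K) : ∃ C : ℝ, 0 ≤ C ∧
    ∀ a b W : ℝ, 10 * (K + 1) ≤ W → (2 * K + 2) ^ 2 + 1 ≤ W → a + 4 * W ≤ b →
      ∃ a₀ a₁ a₂ : ℝ, |a₀| ≤ C * poleMass a b ∧ |a₁| ≤ C * poleMass a b ∧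
        |a₂| ≤ C * poleMass a b ∧
        lineFunctional K W a b a₀ a₁ a₂ (fun A τ => kern A (1 / 2) (τ - 0)) = 0 ∧
        ∀ x t, |x| ≤ 1 / 2 →
          0 ≤ lineFunctional K W a b a₀ a₁ a₂ (fun A τ => kern A x (τ - t)) := by
  set N₁ : ℝ := 96 * (2 * K + 3) + 76 + 16 * (2 * K + 3) ^ 2 with hN₁
  have hN₁0 : 0 ≤ N₁ := by positivity
  obtain ⟨C, hC, h⟩ := exists_pole_correction (N₀ := (2 * K + 1) * N₁) (by positivity)
  refine ⟨C, hC, fun a b W hW hWD hab => ?_⟩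
  have hW0 : 0 < W := by linarith
  set c := K * (1 + ((2 * K + 2) ^ 2 + 1) / W) with hc
  have hc0 : 0 ≤ c := by positivity
  have hc2 : c ≤ 2 * K := by
    have : ((2 * K + 2) ^ 2 + 1) / W ≤ 1 := by rwa [div_le_one hW0]
    rw [hc]; nlinarith
  have hω := poleMass_nonneg (show a ≤ b by linarith)
  have hω' := poleMass_nonneg (show a + 2 * W ≤ b - 2 * W by linarith)
  have hωm : poleMass (a + 2 * W) (b - 2 * W) ≤ poleMass a b :=
    poleMass_mono (by linarith) (by linarith) (by linarith)
  set ω := poleMass a b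
  set ω' := poleMass (a + 2 * W) (b - 2 * W)
  have comb : ∀ {X Y M E : ℝ}, 0 ≤ E → 0 ≤ M → M ≤ N₁ → |X| ≤ M * E * ω → |Y| ≤ M * E * ω' →
      |c * X - Y| ≤ (2 * K + 1) * N₁ * ω * E := by
    intro X Y M E hE hM hMN hX hY
    have h1 : |c * X| ≤ 2 * K * (M * E * ω) := by
      rw [abs_mul, abs_of_nonneg hc0]; gcongr
    have h2 : M * E * ω' ≤ M * E * ω := by gcongr
    have h3 : M * E * ω ≤ N₁ * E * ω := by gcongr
    have h4 : 2 * K * (M * E * ω) ≤ 2 * K * (N₁ * E * ω) := by gcongr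
    calc |c * X - Y| ≤ |c * X| + |Y| := abs_sub _ _
      _ ≤ 2 * K * (N₁ * E * ω) + N₁ * E * ω := by linarith
      _ = _ := by ring
  have hab1 : a ≤ b := by linarith
  have hab2 : a + 2 * W ≤ b - 2 * W := by linarith
  have key := h (basePotential K W a b)
    (c * (∫ τ in a..b, (kernSlope (2 * K + 2) τ - kernSlope (2 * K) τ)) -
      ∫ τ in (a + 2 * W)..(b - 2 * W), (kernSlope (2 * K) τ - kernSlope 0 τ)) ω hω
    (fun x t hx => sub_nonneg.2 (potential_nonneg t hK hW hWD hab hx))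
    (fun x t => by simp only [basePotential, kern_abs_left])
    ?_ ?_ ?_
  · obtain ⟨a₀, a₁, a₂, h1, h2, h3, h4, h5⟩ := key
    refine ⟨a₀, a₁, a₂, h1, h2, h3, ?_, fun x t hx => ?_⟩
    · simp only [testKern, sub_zero] at h4
      simpa only [lineFunctional, basePotential, sub_zero] using h4
    · exact h5 x t hx
  · intro x t hx hx' ht
    have t1 := abs_integral_kern_taylor_le (A := 2 * K) (B := 2 * K + 2) (Or.inr (by linarith))
      (by linarith) (by linarith) hab1 hx hx' ht
    have t2 := abs_integral_kern_taylor_le (A := 0) (B := 2 * K) (Or.inl rfl)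
      (by linarith) (by linarith) hab2 hx hx' ht
    have hE0 : 0 ≤ (1 / 2 - x) + t ^ 2 := by have := sq_nonneg t; linarith
    refine le_of_eq_of_le ?_ (comb hE0 (M := 96 * (2 * K + 3) + 76) (by positivity)
      (by rw [hN₁]; have : 0 ≤ 16 * (2 * K + 3) ^ 2 := by positivity
          linarith) (t1.trans_eq (by ring)) (t2.trans ?_))
    · rw [basePotential, basePotential]; congr 1; ring
    · gcongr; linarith
  · have t1 : |∫ τ in a..b, (kern (2 * K + 2) (1 / 2) (τ - 0) - kern (2 * K) (1 / 2) (τ - 0))| ≤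
        16 * (2 * K + 3) ^ 2 * ω := abs_integral_le_poleMass hab1 fun τ => by
      rw [sub_zero, show 2 * K + 3 = 2 * K + 2 + 1 by ring]
      exact abs_kern_sub_half_le (Or.inr (by linarith)) (by linarith) (by linarith) τ
    have t2 : |∫ τ in (a + 2 * W)..(b - 2 * W),
        (kern (2 * K) (1 / 2) (τ - 0) - kern 0 (1 / 2) (τ - 0))| ≤
        16 * (2 * K + 1) ^ 2 * ω' := abs_integral_le_poleMass hab2 fun τ => by
      rw [sub_zero]
      exact abs_kern_sub_half_le (Or.inl rfl) (by linarith) (by linarith) τ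
    refine (comb (E := 1) zero_le_one (M := 16 * (2 * K + 3) ^ 2) (by positivity)
      (by rw [hN₁]; linarith) (t1.trans_eq (by ring)) (t2.trans ?_)).trans_eq (by ring)
    rw [mul_one]; gcongr; linarith
  · have t1 : |∫ τ in a..b, (kernSlope (2 * K + 2) τ - kernSlope (2 * K) τ)| ≤
        4 * (2 * K + 3) ^ 2 * ω := abs_integral_le_poleMass hab1 fun τ => by
      rw [show 2 * K + 3 = 2 * K + 2 + 1 by ring]
      exact abs_kernSlope_sub_le (Or.inr (by linarith)) (by linarith) (by linarith) τ
    have t2 : |∫ τ in (a + 2 * W)..(b - 2 * W), (kernSlope (2 * K) τ - kernSlope 0 τ)| ≤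
        4 * (2 * K + 1) ^ 2 * ω' := abs_integral_le_poleMass hab2 fun τ =>
      abs_kernSlope_sub_le (Or.inl rfl) (by linarith) (by linarith) τ
    refine (comb (E := 1) zero_le_one (M := 4 * (2 * K + 3) ^ 2) (by positivity)
      (by rw [hN₁]; have : 0 ≤ 12 * (2 * K + 3) ^ 2 := by positivity
          linarith) (t1.trans_eq (by ring)) (t2.trans ?_)).trans_eq (by ring)
    rw [mul_one]; gcongr; linarith

end

/-! ### From kernels to `log ‖Λ‖` -/

noncomputable section
open Set Filter Topology MeasureTheory intervalIntegral

/-- The zeros on a line of an entire function that is not identically zero are discrete, hence null.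
This allows pointwise identities on the critical line to ignore zeros. -/
theorem ae_ne_zero_on_vertical_line {F : ℂ → ℂ} (hF : Differentiable ℂ F) {z₀ : ℂ}
    (hz₀ : F z₀ ≠ 0) (s : ℂ) : ∀ᵐ τ : ℝ, F (s + τ * Complex.I) ≠ 0 := by
  set H : ℂ → ℂ := fun z => F (s + z * Complex.I) with hH
  have hHd : Differentiable ℂ H := hF.comp (by fun_prop)
  have hHan : AnalyticOnNhd ℂ H univ := fun z _ => hHd.analyticAt z
  have hgan : AnalyticOnNhd ℝ (fun τ : ℝ => H τ) univ := fun τ _ =>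
    ((hHan τ (mem_univ _)).restrictScalars (𝕜 := ℝ)).comp (Complex.ofRealCLM.analyticAt τ)
  have hex : ∃ τ : ℝ, H τ ≠ 0 := by
    by_contra! hall
    have hfreq : ∃ᶠ z in 𝓝[≠] (0 : ℂ), H z = (fun _ => 0) z := by
      have ht : Tendsto (fun τ : ℝ => (τ : ℂ)) (𝓝[≠] 0) (𝓝[≠] 0) := by
        refine tendsto_nhdsWithin_iff.2 ⟨?_, ?_⟩
        · exact (Complex.continuous_ofReal.tendsto' 0 0 (by simp)).mono_left nhdsWithin_le_nhds
        · filter_upwards [self_mem_nhdsWithin] with τ hτ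
          simpa using hτ
      exact ht.frequently (Eventually.frequently (Eventually.of_forall hall))
    have h0 := hHan.eq_of_frequently_eq analyticOnNhd_const hfreq
    have := congrFun h0 ((z₀ - s) / Complex.I)
    simp only [hH, div_mul_cancel₀ _ Complex.I_ne_zero, add_sub_cancel] at this
    exact hz₀ this
  obtain ⟨τ₀, hτ₀⟩ := hex
  have hcod := hgan.preimage_zero_mem_codiscreteWithin hτ₀ (mem_univ _) isConnected_univ
  have := ae_restrict_le_codiscreteWithin (μ := volume) MeasurableSet.univ hcod
  rwa [Measure.restrict_univ] at this

namespace LFunction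

variable {d : ℕ}

/-- `log ‖Λ(1/2 + A + iτ)‖`. -/
def logCompleted (f : LFunction d) (A τ : ℝ) : ℝ :=
  Real.log ‖f.completed (1 / 2 + A + τ * Complex.I)‖

theorem ae_completed_ne_zero (f : LFunction d) (A : ℝ) :
    ∀ᵐ τ : ℝ, f.completed (1 / 2 + A + τ * Complex.I) ≠ 0 := by
  obtain ⟨m, hm⟩ := f.exists_entire
  have h2 : ((2 : ℂ) * (2 - 1)) ^ m * f.completed 2 ≠ 0 :=
    mul_ne_zero (pow_ne_zero _ (by norm_num)) (f.completed_ne_zero (by norm_num))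
  filter_upwards [ae_ne_zero_on_vertical_line hm (z₀ := 2) h2 (1 / 2 + A)] with τ hτ
  exact right_ne_zero_of_mul hτ

theorem analyticAt_completed_line (f : LFunction d) {A : ℝ} (hA : A = 0 ∨ 1 ≤ A) (τ : ℝ) :
    AnalyticAt ℝ (fun τ : ℝ => f.completed (1 / 2 + A + τ * Complex.I)) τ := by
  have hre : (1 / 2 + A + τ * Complex.I : ℂ).re = 1 / 2 + A := by simp
  have h0 : (1 / 2 + A + τ * Complex.I : ℂ) ≠ 0 := by
    intro h; rw [h] at hre; rcases hA with rfl | h <;> norm_num at hre; linarith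
  have h1 : (1 / 2 + A + τ * Complex.I : ℂ) ≠ 1 := by
    intro h; rw [h] at hre; rcases hA with rfl | h <;> norm_num at hre; linarith
  have han : AnalyticAt ℂ f.completed (1 / 2 + A + τ * Complex.I) :=
    f.differentiableOn.analyticAt
      ((Set.toFinite _).isClosed.isOpen_compl.mem_nhds (by
        rw [mem_compl_iff, mem_insert_iff, mem_singleton_iff, not_or]; exact ⟨h0, h1⟩))
  refine (han.restrictScalars (𝕜 := ℝ)).comp (f := fun τ : ℝ => (1 / 2 + A + τ * Complex.I : ℂ)) ?_
  exact analyticAt_const.add ((Complex.ofRealCLM.analyticAt τ).mul analyticAt_const)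

theorem intervalIntegrable_logCompleted (f : LFunction d) {A : ℝ} (hA : A = 0 ∨ 1 ≤ A)
    (p q : ℝ) : IntervalIntegrable (f.logCompleted A) volume p q :=
  MeromorphicOn.intervalIntegrable_log_norm fun τ _ =>
    (f.analyticAt_completed_line hA τ).meromorphicAt

end LFunction

/-- Integrability of the integrands of `lineFunctional`. -/
def LineIntegrable (K W a b : ℝ) (u : ℝ → ℝ → ℝ) : Prop :=
  IntervalIntegrable (fun τ => u (2 * K + 2) τ - u (2 * K) τ) volume a b ∧
    IntervalIntegrable (fun τ => u (2 * K) τ - u 0 τ) volume (a + 2 * W) (b - 2 * W)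

section

variable {K W a b a₀ a₁ a₂ : ℝ} {u v : ℝ → ℝ → ℝ}

theorem LineIntegrable.add (hu : LineIntegrable K W a b u) (hv : LineIntegrable K W a b v) :
    LineIntegrable K W a b (fun A τ => u A τ + v A τ) := by
  refine ⟨(hu.1.add hv.1).congr fun τ _ => ?_, (hu.2.add hv.2).congr fun τ _ => ?_⟩ <;>
  ring

theorem lineFunctional_add (hu : LineIntegrable K W a b u) (hv : LineIntegrable K W a b v) :
    lineFunctional K W a b a₀ a₁ a₂ (fun A τ => u A τ + v A τ) =
      lineFunctional K W a b a₀ a₁ a₂ u + lineFunctional K W a b a₀ a₁ a₂ v := by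
  have h1 := intervalIntegral.integral_add hu.1 hv.1
  have h2 := intervalIntegral.integral_add hu.2 hv.2
  have e1 : ∀ A B τ : ℝ, u B τ + v B τ - (u A τ + v A τ) = u B τ - u A τ + (v B τ - v A τ) :=
    fun A B τ => by ring
  simp only [lineFunctional, e1]
  rw [h1, h2]
  ring

theorem LineIntegrable.const_mul (r : ℝ) (hu : LineIntegrable K W a b u) :
    LineIntegrable K W a b (fun A τ => r * u A τ) := by
  refine ⟨(hu.1.const_mul r).congr fun τ _ => ?_, (hu.2.const_mul r).congr fun τ _ => ?_⟩ <;>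
  simp only [] <;> ring

theorem lineFunctional_const_mul (r : ℝ) :
    lineFunctional K W a b a₀ a₁ a₂ (fun A τ => r * u A τ) =
      r * lineFunctional K W a b a₀ a₁ a₂ u := by
  simp only [lineFunctional, ← mul_sub, intervalIntegral.integral_const_mul]
  ring

theorem lineIntegrable_kern (hK : 1 ≤ K) {x : ℝ} (t : ℝ) (hx : |x| ≤ 1 / 2) :
    LineIntegrable K W a b (fun A τ => kern A x (τ - t)) :=
  ⟨(intervalIntegrable_kern (Or.inr (by linarith)) hx t _ _).sub
    (intervalIntegrable_kern (Or.inr (by linarith)) hx t _ _),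
   (intervalIntegrable_kern (Or.inr (by linarith)) hx t _ _).sub
    (intervalIntegrable_kern (Or.inl rfl) hx t _ _)⟩

theorem lineFunctional_multiset_sum (hK : 1 ≤ K)
    (h : ∀ x t, |x| ≤ 1 / 2 →
      0 ≤ lineFunctional K W a b a₀ a₁ a₂ (fun A τ => kern A x (τ - t)))
    (S : Multiset (ℝ × ℝ)) (hS : ∀ p ∈ S, |p.1| ≤ 1 / 2) :
    LineIntegrable K W a b (fun A τ => (S.map fun p => kern A p.1 (τ - p.2)).sum) ∧
      0 ≤ lineFunctional K W a b a₀ a₁ a₂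
        (fun A τ => (S.map fun p => kern A p.1 (τ - p.2)).sum) := by
  induction S using Multiset.induction_on with
  | empty => simp [LineIntegrable, lineFunctional]
  | cons p S ih =>
    obtain ⟨h1, h2⟩ := ih fun q hq => hS q (Multiset.mem_cons_of_mem hq)
    have hp := hS p (Multiset.mem_cons_self p S)
    have h3 := lineIntegrable_kern (W := W) (a := a) (b := b) hK p.2 hp
    simp only [Multiset.map_cons, Multiset.sum_cons]
    refine ⟨h3.add h1, ?_⟩
    rw [lineFunctional_add h3 h1]
    exact add_nonneg (h _ _ hp) h2

/-- `lineFunctional` only sees differences, so it is continuous for their uniform norm. -/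
theorem abs_lineFunctional_le {η : ℝ} (hK : 1 ≤ K) (hW : 0 < W) (hab : a + 4 * W ≤ b)
    (h1 : ∀ τ ∈ Icc a b, |u (2 * K + 2) τ - u (2 * K) τ| ≤ η)
    (h2 : ∀ᵐ τ : ℝ, τ ∈ Icc a b → |u (2 * K) τ - u 0 τ| ≤ η)
    (h3 : ∀ τ, |τ| ≤ 1 → |u 6 τ - u 4 τ| ≤ η) (h4 : |u 8 0 - u 6 0| ≤ η) :
    |lineFunctional K W a b a₀ a₁ a₂ u| ≤
      η * ((K * (1 + ((2 * K + 2) ^ 2 + 1) / W) + 1) * (b - a) + |a₀| + 2 * |a₁| + |a₂|) := by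
  have hη : 0 ≤ η := (abs_nonneg _).trans h4
  set c := K * (1 + ((2 * K + 2) ^ 2 + 1) / W) with hc
  have hc0 : 0 ≤ c := by positivity
  have i1 : |∫ τ in a..b, (u (2 * K + 2) τ - u (2 * K) τ)| ≤ η * (b - a) := by
    have := intervalIntegral.norm_integral_le_of_norm_le_const (a := a) (b := b) (C := η)
      (f := fun τ => u (2 * K + 2) τ - u (2 * K) τ) fun τ hτ => by
        rw [uIoc_of_le (by linarith)] at hτ
        exact h1 τ (Ioc_subset_Icc_self hτ)
    rwa [abs_of_nonneg (by linarith : 0 ≤ b - a)] at this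
  have i2 : |∫ τ in (a + 2 * W)..(b - 2 * W), (u (2 * K) τ - u 0 τ)| ≤ η * (b - a) := by
    have := intervalIntegral.norm_integral_le_of_norm_le_const_ae (a := a + 2 * W)
      (b := b - 2 * W) (C := η) (f := fun τ => u (2 * K) τ - u 0 τ) (by
        filter_upwards [h2] with τ hτ hm
        rw [uIoc_of_le (by linarith)] at hm
        exact hτ ⟨by linarith [hm.1], by linarith [hm.2]⟩)
    refine this.trans ?_
    rw [abs_of_nonneg (by linarith)]
    gcongr <;> linarith
  have j1 : |c * ∫ τ in a..b, (u (2 * K + 2) τ - u (2 * K) τ)| ≤ c * (η * (b - a)) := by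
    rw [abs_mul, abs_of_nonneg hc0]; gcongr
  have j2 : |a₀ * (u 6 0 - u 4 0)| ≤ |a₀| * η := by
    rw [abs_mul]; gcongr; exact h3 0 (by norm_num)
  have j3 : |a₁ * ((u 6 1 - u 4 1) - (u 6 (-1) - u 4 (-1)))| ≤ |a₁| * (η + η) := by
    rw [abs_mul]
    gcongr
    exact (abs_sub _ _).trans (add_le_add (h3 1 (by norm_num)) (h3 (-1) (by norm_num)))
  have j4 : |a₂ * (u 8 0 - u 6 0)| ≤ |a₂| * η := by
    rw [abs_mul]; gcongr
  rw [lineFunctional, ← hc]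
  rw [abs_le] at i2 j1 j2 j3 j4 ⊢
  constructor <;> linarith [i2.1, i2.2, j1.1, j1.2, j2.1, j2.2, j3.1, j3.2, j4.1, j4.2]

end

namespace LFunction

variable {d : ℕ}

/-- Up to `η`, differences of `log ‖Λ‖` are those of a sum of zero kernels minus a multiple of the
pole kernel. The functional is nonnegative on the former and zero on the latter whatever the
multiplicity, and it depends only on differences, so the error is `ηD` with `D` independent of `η`.
-/
theorem lineFunctional_logCompleted_nonneg (f : LFunction d) {K W a b a₀ a₁ a₂ : ℝ} (hK : 1 ≤ K)
    (hW : 0 < W) (hab : a + 4 * W ≤ b)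
    (h0 : lineFunctional K W a b a₀ a₁ a₂ (fun A τ => kern A (1 / 2) (τ - 0)) = 0)
    (h : ∀ x t, |x| ≤ 1 / 2 →
      0 ≤ lineFunctional K W a b a₀ a₁ a₂ (fun A τ => kern A x (τ - t))) :
    0 ≤ lineFunctional K W a b a₀ a₁ a₂ f.logCompleted := by
  set D := (K * (1 + ((2 * K + 2) ^ 2 + 1) / W) + 1) * (b - a) + |a₀| + 2 * |a₁| + |a₂| with hD
  have hD0 : 0 ≤ D := by
    have : 0 ≤ b - a := by linarith
    positivity
  have hu : LineIntegrable K W a b f.logCompleted :=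
    ⟨(f.intervalIntegrable_logCompleted (Or.inr (by linarith)) _ _).sub
      (f.intervalIntegrable_logCompleted (Or.inr (by linarith)) _ _),
     (f.intervalIntegrable_logCompleted (Or.inr (by linarith)) _ _).sub
      (f.intervalIntegrable_logCompleted (Or.inl rfl) _ _)⟩
  have key : ∀ η : ℝ, 0 < η →
      -(η * D) ≤ lineFunctional K W a b a₀ a₁ a₂ f.logCompleted := by
    intro η hη
    set M := |a| + |b| + 2 * K + 10 with hM
    have hM0 : 10 ≤ M := by rw [hM]; linarith [abs_nonneg a, abs_nonneg b]
    obtain ⟨m, S, hS, hexp⟩ := f.exists_kern_expansion hη M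
    set v : ℝ → ℝ → ℝ := fun A τ => (S.map fun p => kern A p.1 (τ - p.2)).sum +
      -(2 * m) * kern A (1 / 2) (τ - 0) with hv
    obtain ⟨g1, g2⟩ := lineFunctional_multiset_sum (W := W) hK h S hS
    have g3 := (lineIntegrable_kern (K := K) (W := W) (a := a) (b := b) hK 0
      (x := 1 / 2) (by norm_num)).const_mul (-(2 * m))
    have hvi : LineIntegrable K W a b v := g1.add g3
    have hv0 : 0 ≤ lineFunctional K W a b a₀ a₁ a₂ v := by
      rw [hv, lineFunctional_add g1 g3, lineFunctional_const_mul, h0, mul_zero, add_zero]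
      exact g2
    have hdiff : ∀ {A B τ : ℝ}, (A = 0 ∨ 1 ≤ A) → A ≤ M → 1 ≤ B → B ≤ M → |τ| ≤ M →
        f.completed (1 / 2 + A + τ * Complex.I) ≠ 0 →
        |(f.logCompleted B τ + -1 * v B τ) - (f.logCompleted A τ + -1 * v A τ)| ≤ η := by
      intro A B τ hA hAM hB hBM hτ hne
      have hne' : f.completed (1 / 2 + B + τ * Complex.I) ≠ 0 := by
        refine f.completed_ne_zero ?_
        have : (1 / 2 + B + τ * Complex.I : ℂ).re = 1 / 2 + B := by simp
        rw [this]; linarith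
      have := hexp τ B A hτ (by linarith) hBM (by rcases hA with rfl | h <;> linarith) hAM
        (by linarith) (by rcases hA with rfl | h <;> [norm_num; linarith]) hne' hne
      refine le_of_eq_of_le ?_ this
      rw [Multiset.sum_map_sub]
      simp only [hv, logCompleted, sub_zero]
      congr 1
      ring
    have hne : ∀ {A : ℝ} (τ : ℝ), 1 ≤ A → f.completed (1 / 2 + A + τ * Complex.I) ≠ 0 := by
      intro A τ hA
      refine f.completed_ne_zero ?_
      have : (1 / 2 + A + τ * Complex.I : ℂ).re = 1 / 2 + A := by simp
      rw [this]; linarith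
    have hτM : ∀ τ ∈ Icc a b, |τ| ≤ M := fun τ hτ => by
      rw [abs_le, hM]
      constructor
      · linarith [hτ.1, neg_abs_le a, abs_nonneg b]
      · linarith [hτ.2, le_abs_self b, abs_nonneg a]
    have hle := abs_lineFunctional_le (a₀ := a₀) (a₁ := a₁) (a₂ := a₂) (K := K) (W := W) (a := a)
      (b := b) (u := fun A τ => f.logCompleted A τ + -1 * v A τ) (η := η) hK hW hab
      (fun τ hτ => hdiff (Or.inr (by linarith)) (by rw [hM]; linarith [abs_nonneg a, abs_nonneg b])
        (by linarith) (by rw [hM]; linarith [abs_nonneg a, abs_nonneg b]) (hτM τ hτ)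
        (by
          have := hne (A := 2 * K) τ (by linarith)
          exact this))
      -- The expansion fails at zeros of `Λ` on the critical line, so this bound is available only
      -- almost everywhere.
      (by
        filter_upwards [f.ae_completed_ne_zero 0] with τ h0 hτ
        exact hdiff (Or.inl rfl) (by linarith) (by linarith)
          (by rw [hM]; linarith [abs_nonneg a, abs_nonneg b]) (hτM τ hτ) h0)
      (fun τ hτ => hdiff (Or.inr (by norm_num)) (by linarith) (by norm_num) (by linarith)
        (by linarith) (hne τ (by norm_num)))
      (hdiff (Or.inr (by norm_num)) (by linarith) (by norm_num) (by linarith)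
        (by rw [abs_zero]; linarith) (hne 0 (by norm_num)))
    rw [lineFunctional_add hu (hvi.const_mul (-1)), lineFunctional_const_mul, ← hD] at hle
    linarith [(abs_le.1 hle).1]
  refine le_of_forall_pos_lt_add fun ε hε => ?_
  have h1 := key (ε / (D + 1)) (by positivity)
  have h2 : ε / (D + 1) * D < ε := by
    rw [div_mul_eq_mul_div, div_lt_iff₀ (by positivity)]; nlinarith
  linarith

end LFunction

end

/-! ### Separating the factors at infinity from `log ‖L‖` -/

noncomputable section
open Set Filter Topology MeasureTheory intervalIntegral

namespace LFunction

variable {d : ℕ}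

/-- The factor `q^{s/2} γ(s)` at infinity. -/
def archFactor (f : LFunction d) (s : ℂ) : ℂ :=
  (f.conductor : ℂ) ^ (s / 2) * gammaFactor f.kappa s

/-- The logarithm of the ratio of the factors at infinity at `s + 2` and at `s = 1/2 + A + iτ`. -/
def stepLog (f : LFunction d) (A τ : ℝ) : ℝ :=
  Real.log f.conductor - d * Real.log Real.pi +
    ∑ j, Real.log (‖1 / 2 + A + τ * Complex.I + f.kappa j‖ / 2)

/-- `log ‖L(1/2 + A + iτ)‖`. -/
def logL (f : LFunction d) (A τ : ℝ) : ℝ := Real.log ‖f.L (1 / 2 + A + τ * Complex.I)‖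

/-- Here `Re ((s + κ_j)/2) > -1/4`, so the only pole of `Γ` that can be met is the one at `0`. -/
theorem archFactor_ne_zero (f : LFunction d) {s : ℂ} (hs : 1 / 2 ≤ s.re)
    (h : ∀ j, s + f.kappa j ≠ 0) : f.archFactor s ≠ 0 := by
  refine mul_ne_zero (f.conductor_cpow_ne_zero _)
    (mul_ne_zero ?_ (Finset.prod_ne_zero_iff.2 fun j _ => Complex.Gamma_ne_zero fun m hm => ?_))
  · rw [Ne, Complex.cpow_eq_zero_iff]
    rintro ⟨h, -⟩
    exact Real.pi_ne_zero (by exact_mod_cast h)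
  · rcases m.eq_zero_or_pos with rfl | hm0
    · apply h j
      have : (s + f.kappa j) / 2 * 2 = 0 := by rw [hm]; simp
      simpa using this
    · have h1 := congrArg Complex.re hm
      have h2 : ((s + f.kappa j) / 2).re = (s.re + (f.kappa j).re) / 2 := by simp
      rw [h2] at h1
      simp only [Complex.neg_re, Complex.natCast_re] at h1
      have h3 := f.kappa_re j
      have h4 : (1 : ℝ) ≤ m := by exact_mod_cast hm0
      linarith

theorem archFactor_add_two (f : LFunction d) {s : ℂ} (h : ∀ j, s + f.kappa j ≠ 0) :
    f.archFactor (s + 2) = f.archFactor s *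
      (f.conductor * (Real.pi : ℂ) ^ (-(d : ℂ)) * ∏ j, (s + f.kappa j) / 2) := by
  have hq : (f.conductor : ℂ) ≠ 0 := by
    have := f.conductor_pos
    exact_mod_cast (by omega : f.conductor ≠ 0)
  have hπ : (Real.pi : ℂ) ≠ 0 := by exact_mod_cast Real.pi_ne_zero
  have e1 : (f.conductor : ℂ) ^ ((s + 2) / 2) = (f.conductor : ℂ) ^ (s / 2) * f.conductor := by
    rw [show (s + 2) / 2 = s / 2 + 1 by ring, Complex.cpow_add _ _ hq, Complex.cpow_one]
  have e2 : (Real.pi : ℂ) ^ (-((d : ℂ) * (s + 2)) / 2) =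
      (Real.pi : ℂ) ^ (-((d : ℂ) * s) / 2) * (Real.pi : ℂ) ^ (-(d : ℂ)) := by
    rw [← Complex.cpow_add _ _ hπ]
    congr 1
    ring
  have e3 : ∏ j, Complex.Gamma ((s + 2 + f.kappa j) / 2) =
      (∏ j, (s + f.kappa j) / 2) * ∏ j, Complex.Gamma ((s + f.kappa j) / 2) := by
    rw [← Finset.prod_mul_distrib]
    refine Finset.prod_congr rfl fun j _ => ?_
    rw [← Complex.Gamma_add_one _ (div_ne_zero (h j) two_ne_zero)]
    congr 1
    ring
  rw [archFactor, archFactor, gammaFactor, gammaFactor, e1, e2, e3]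
  ring

theorem log_norm_archFactor_add_two (f : LFunction d) {A τ : ℝ} (hA : 0 ≤ A)
    (h : ∀ j, 1 / 2 + A + τ * Complex.I + f.kappa j ≠ 0) :
    Real.log ‖f.archFactor (1 / 2 + (A + 2 : ℝ) + τ * Complex.I)‖ =
      Real.log ‖f.archFactor (1 / 2 + A + τ * Complex.I)‖ + f.stepLog A τ := by
  have hre : (1 / 2 + A + τ * Complex.I : ℂ).re = 1 / 2 + A := by simp
  have hX := f.archFactor_ne_zero (s := 1 / 2 + A + τ * Complex.I) (by rw [hre]; linarith) h
  have e : (1 / 2 + (A + 2 : ℝ) + τ * Complex.I : ℂ) = 1 / 2 + A + τ * Complex.I + 2 := by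
    push_cast; ring
  have hq : (0 : ℝ) < f.conductor := by exact_mod_cast f.conductor_pos
  have hprod : ∏ j, ‖(1 / 2 + A + τ * Complex.I + f.kappa j) / 2‖ ≠ 0 :=
    Finset.prod_ne_zero_iff.2 fun j _ => norm_ne_zero_iff.2 (div_ne_zero (h j) two_ne_zero)
  have hπ := Real.pi_pos
  rw [e, f.archFactor_add_two h, norm_mul, Real.log_mul (norm_ne_zero_iff.2 hX), norm_mul, norm_mul,
    Complex.norm_natCast, Complex.norm_cpow_eq_rpow_re_of_pos hπ, norm_prod, Real.log_mul _ hprod,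
    Real.log_mul hq.ne' (by positivity), Real.log_rpow hπ,
    Real.log_prod fun j _ => norm_ne_zero_iff.2 (div_ne_zero (h j) two_ne_zero), stepLog]
  · simp only [Complex.neg_re, Complex.natCast_re, norm_div, Complex.norm_ofNat]
    ring
  · positivity
  · rw [norm_mul, norm_mul, norm_prod, Complex.norm_natCast,
      Complex.norm_cpow_eq_rpow_re_of_pos hπ]
    exact mul_ne_zero (by positivity) hprod

theorem logCompleted_eq (f : LFunction d) {A τ : ℝ}
    (h : f.archFactor (1 / 2 + A + τ * Complex.I) ≠ 0)
    (hΛ : f.completed (1 / 2 + A + τ * Complex.I) ≠ 0) :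
    f.logCompleted A τ =
      Real.log ‖f.archFactor (1 / 2 + A + τ * Complex.I)‖ + f.logL A τ := by
  have hL : f.archFactor (1 / 2 + A + τ * Complex.I) * f.L (1 / 2 + A + τ * Complex.I) =
      f.completed (1 / 2 + A + τ * Complex.I) := by
    rw [L, ← archFactor, mul_comm, mul_assoc, inv_mul_cancel₀ h, mul_one]
  have hL0 : f.L (1 / 2 + A + τ * Complex.I) ≠ 0 := by
    intro h0; rw [h0, mul_zero] at hL; exact hΛ hL.symm
  rw [logCompleted, logL, ← hL, norm_mul,
    Real.log_mul (norm_ne_zero_iff.2 h) (norm_ne_zero_iff.2 hL0)]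

theorem shift_add_kappa_ne_zero (f : LFunction d) {A : ℝ} (hA : 1 / 2 ≤ A) (τ : ℝ) (j : Fin d) :
    1 / 2 + A + τ * Complex.I + f.kappa j ≠ 0 := by
  intro h
  have h1 := congrArg Complex.re h
  simp at h1
  have := f.kappa_re j
  linarith

theorem completed_ne_zero_right (f : LFunction d) {A : ℝ} (hA : 1 ≤ A) (τ : ℝ) :
    f.completed (1 / 2 + A + τ * Complex.I) ≠ 0 := by
  refine f.completed_ne_zero ?_
  have : (1 / 2 + A + τ * Complex.I : ℂ).re = 1 / 2 + A := by simp
  rw [this]; linarith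

theorem logCompleted_add_two (f : LFunction d) {A τ : ℝ} (hA : 0 ≤ A)
    (h : ∀ j, 1 / 2 + A + τ * Complex.I + f.kappa j ≠ 0)
    (hΛ : f.completed (1 / 2 + A + τ * Complex.I) ≠ 0) :
    f.logCompleted (A + 2) τ - f.logCompleted A τ =
      f.stepLog A τ + f.logL (A + 2) τ - f.logL A τ := by
  have hre : (1 / 2 + A + τ * Complex.I : ℂ).re = 1 / 2 + A := by simp
  have hre' : (1 / 2 + (A + 2 : ℝ) + τ * Complex.I : ℂ).re = 1 / 2 + (A + 2) := by simp
  rw [f.logCompleted_eq (f.archFactor_ne_zero (by rw [hre]; linarith) h) hΛ,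
    f.logCompleted_eq (f.archFactor_ne_zero (by rw [hre']; linarith)
      (f.shift_add_kappa_ne_zero (by linarith) τ)) (f.completed_ne_zero_right (by linarith) τ),
    f.log_norm_archFactor_add_two hA h]
  ring

/-- The recurrence `Γ(z + 1) = zΓ(z)` telescopes in steps of `2`, replacing Stirling's formula. Only
the first step, from the critical line, needs the nonvanishing hypotheses. -/
theorem logCompleted_sub_eq_sum (f : LFunction d) {τ : ℝ}
    (h : ∀ j, 1 / 2 + (0 : ℝ) + τ * Complex.I + f.kappa j ≠ 0)
    (hΛ : f.completed (1 / 2 + (0 : ℝ) + τ * Complex.I) ≠ 0) (K : ℕ) :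
    f.logCompleted (2 * K) τ - f.logCompleted 0 τ =
      ∑ i ∈ Finset.range K, f.stepLog (2 * i) τ + f.logL (2 * K) τ - f.logL 0 τ := by
  induction K with
  | zero => simp
  | succ n ih =>
    have hstep : f.logCompleted (2 * n + 2) τ - f.logCompleted (2 * n) τ =
        f.stepLog (2 * n) τ + f.logL (2 * n + 2) τ - f.logL (2 * n) τ := by
      rcases n.eq_zero_or_pos with rfl | hn
      · simp only [Nat.cast_zero, mul_zero]
        exact f.logCompleted_add_two le_rfl h hΛ
      · have hn1 : (1 : ℝ) ≤ n := by exact_mod_cast hn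
        exact f.logCompleted_add_two (by linarith) (f.shift_add_kappa_ne_zero (by linarith) τ)
          (f.completed_ne_zero_right (by linarith) τ)
    rw [Finset.sum_range_succ, Nat.cast_succ, mul_add, mul_one]
    linarith

theorem ae_line_add_kappa_ne_zero (f : LFunction d) (A : ℝ) :
    ∀ᵐ τ : ℝ, ∀ j, 1 / 2 + A + τ * Complex.I + f.kappa j ≠ 0 := by
  rw [ae_all_iff]
  intro j
  have hd : Differentiable ℂ fun z : ℂ => z + f.kappa j := by fun_prop
  exact ae_ne_zero_on_vertical_line hd (z₀ := 1 - f.kappa j) (by simp) (1 / 2 + A)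

theorem analyticAt_L_line (f : LFunction d) {A : ℝ} (hA : A = 0 ∨ 1 ≤ A) (τ : ℝ) :
    AnalyticAt ℝ (fun τ : ℝ => f.L (1 / 2 + A + τ * Complex.I)) τ := by
  -- The reciprocal of `Γ` is entire, so `L` inherits analyticity from `Λ` even at poles of the
  -- gamma factor.
  have hd : Differentiable ℂ fun s => (f.archFactor s)⁻¹ := by
    have hq : (f.conductor : ℂ) ≠ 0 := by
      have := f.conductor_pos
      exact_mod_cast (by omega : f.conductor ≠ 0)
    have hπ : (Real.pi : ℂ) ≠ 0 := by exact_mod_cast Real.pi_ne_zero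
    have e : (fun s => (f.archFactor s)⁻¹) = fun s => (f.conductor : ℂ) ^ (-(s / 2)) *
        ((Real.pi : ℂ) ^ (-(-((d : ℂ) * s) / 2)) *
          ∏ j, (Complex.Gamma ((s + f.kappa j) / 2))⁻¹) := by
      funext s
      rw [archFactor, gammaFactor, mul_inv, mul_inv, Complex.cpow_neg, Complex.cpow_neg,
        Finset.prod_inv_distrib]
    rw [e]
    refine Differentiable.mul ?_ (Differentiable.mul ?_ ?_)
    · exact Differentiable.const_cpow (by fun_prop) (Or.inl hq)
    · exact Differentiable.const_cpow (by fun_prop) (Or.inl hπ)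
    · refine Differentiable.fun_finsetProd fun j _ => ?_
      exact Complex.differentiable_one_div_Gamma.comp (by fun_prop)
  have han : AnalyticAt ℝ (fun τ : ℝ => (f.archFactor (1 / 2 + A + τ * Complex.I))⁻¹) τ :=
    ((hd.analyticAt (1 / 2 + A + τ * Complex.I)).restrictScalars (𝕜 := ℝ)).comp
      (f := fun τ : ℝ => (1 / 2 + A + τ * Complex.I : ℂ))
      (analyticAt_const.add ((Complex.ofRealCLM.analyticAt τ).mul analyticAt_const))
  exact (f.analyticAt_completed_line hA τ).mul han

theorem intervalIntegrable_logL (f : LFunction d) {A : ℝ} (hA : A = 0 ∨ 1 ≤ A)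
    (p q : ℝ) : IntervalIntegrable (f.logL A) volume p q :=
  MeromorphicOn.intervalIntegrable_log_norm fun τ _ => (f.analyticAt_L_line hA τ).meromorphicAt

theorem continuous_L_line (f : LFunction d) {A : ℝ} (hA : A = 0 ∨ 1 ≤ A) :
    Continuous fun τ : ℝ => f.L (1 / 2 + A + τ * Complex.I) :=
  continuous_iff_continuousAt.2 fun τ => (f.analyticAt_L_line hA τ).continuousAt

theorem intervalIntegrable_stepLog (f : LFunction d) (A p q : ℝ) :
    IntervalIntegrable (f.stepLog A) volume p q := by
  have h : ∀ j, IntervalIntegrable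
      (fun τ : ℝ => Real.log (‖1 / 2 + A + τ * Complex.I + f.kappa j‖ / 2)) volume p q := by
    intro j
    have h1 : MeromorphicOn (fun τ : ℝ => (1 / 2 + A + τ * Complex.I + f.kappa j) / 2)
        (uIcc p q) := fun τ _ => (((analyticAt_const.add
          ((Complex.ofRealCLM.analyticAt τ).mul analyticAt_const)).add
          analyticAt_const).div_const).meromorphicAt
    refine h1.intervalIntegrable_log_norm.congr fun τ _ => ?_
    simp only [norm_div, Complex.norm_ofNat]
  have h2 := (IntervalIntegrable.sum Finset.univ fun j _ => h j)
  refine ((intervalIntegrable_const (μ := volume) (a := p) (b := q)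
    (c := Real.log f.conductor - d * Real.log Real.pi)).add h2).congr fun τ _ => ?_
  simp [stepLog]

end LFunction

end

/-! ### Uniform estimates for the pole mass and the factors at infinity -/

noncomputable section
open Set Filter Topology MeasureTheory intervalIntegral

theorem sqrt_add_le_sqrt_add_sqrt {x y : ℝ} (hx : 0 ≤ x) (hy : 0 ≤ y) : √(x + y) ≤ √x + √y := by
  rw [Real.sqrt_le_left (by positivity)]
  nlinarith [Real.sq_sqrt hx, Real.sq_sqrt hy, mul_nonneg (Real.sqrt_nonneg x) (Real.sqrt_nonneg y)]

theorem intervalIntegrable_inv_sqrt_abs (a b : ℝ) :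
    IntervalIntegrable (fun y : ℝ => (√|y|)⁻¹) volume a b := by
  refine intervalIntegrable_of_even (fun x => by rw [abs_neg]) fun x hx => ?_
  refine (intervalIntegrable_rpow' (r := -(1 / 2)) (by norm_num)).congr fun y hy => ?_
  rw [uIoc_of_le hx.le] at hy
  rw [abs_of_pos hy.1, Real.rpow_neg hy.1.le, Real.sqrt_eq_rpow]

theorem integral_inv_sqrt_abs {x : ℝ} (hx : 0 ≤ x) : ∫ y in (0 : ℝ)..x, (√|y|)⁻¹ = 2 * √x := by
  have h : ∫ y in (0 : ℝ)..x, (√|y|)⁻¹ = ∫ y in (0 : ℝ)..x, y ^ (-(1 / 2) : ℝ) := by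
    refine integral_congr fun y hy => ?_
    rw [uIcc_of_le hx] at hy
    rw [abs_of_nonneg hy.1, Real.rpow_neg hy.1, Real.sqrt_eq_rpow]
  rw [h, integral_rpow (Or.inl (by norm_num)), Real.sqrt_eq_rpow,
    Real.zero_rpow (by norm_num)]
  norm_num
  ring

/-- The bound depends only on the length of the interval, which makes later estimates independent of
`Im κ_j`. An interval straddling `0` accounts for `4` in place of `2`. -/
theorem integral_inv_sqrt_abs_le {p q : ℝ} (hpq : p ≤ q) :
    ∫ y in p..q, (√|y|)⁻¹ ≤ 4 * √(q - p) := by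
  have hi := intervalIntegrable_inv_sqrt_abs
  have hneg : ∀ {x : ℝ}, 0 ≤ x → ∫ y in (0 : ℝ)..(-x), (√|y|)⁻¹ = -(2 * √x) := by
    intro x hx
    have := intervalIntegral.integral_comp_neg (a := 0) (b := x) fun y : ℝ => (√|y|)⁻¹
    simp only [abs_neg, neg_zero] at this
    rw [integral_symm, ← this, integral_inv_sqrt_abs hx]
  rw [← integral_interval_sub_left (hi 0 q) (hi 0 p)]
  have hs := Real.sqrt_nonneg (q - p)
  rcases le_total 0 p with hp | hp
  · rw [integral_inv_sqrt_abs hp, integral_inv_sqrt_abs (hp.trans hpq)]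
    have := sqrt_add_le_sqrt_add_sqrt hp (sub_nonneg.2 hpq)
    rw [add_sub_cancel] at this
    linarith
  · have hp' := hneg (neg_nonneg.2 hp)
    rw [neg_neg] at hp'
    rw [hp']
    rcases le_total 0 q with hq | hq
    · rw [integral_inv_sqrt_abs hq]
      have h1 : √q ≤ √(q - p) := Real.sqrt_le_sqrt (by linarith)
      have h2 : √(-p) ≤ √(q - p) := Real.sqrt_le_sqrt (by linarith)
      linarith
    · have hq' := hneg (neg_nonneg.2 hq)
      rw [neg_neg] at hq'
      rw [hq']
      have := sqrt_add_le_sqrt_add_sqrt (neg_nonneg.2 hq) (sub_nonneg.2 hpq)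
      rw [show -q + (q - p) = -p by ring] at this
      linarith

theorem log_one_add_le_two_mul_sqrt {x : ℝ} (hx : 0 ≤ x) : Real.log (1 + x) ≤ 2 * √x := by
  have hs := Real.sqrt_nonneg x
  calc Real.log (1 + x) ≤ Real.log ((1 + √x) ^ 2) :=
        Real.log_le_log (by linarith) (by nlinarith [Real.sq_sqrt hx])
    _ = 2 * Real.log (1 + √x) := by rw [Real.log_pow]; push_cast; ring
    _ ≤ 2 * √x := by
        have := Real.log_le_sub_one_of_pos (show 0 < 1 + √x by linarith)
        linarith

theorem poleMass_le_pi (a b : ℝ) : poleMass a b ≤ Real.pi := by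
  rw [poleMass, integral_one_div_one_add_sq]
  linarith [Real.arctan_lt_pi_div_two b, Real.neg_pi_div_two_lt_arctan a]

/-- An interval far from the poles has small mass. -/
theorem poleMass_mul_log_le {T₀ T : ℝ} (hT : 1 ≤ T) :
    poleMass (T₀ - T) (T₀ + T) * Real.log (10 + |T₀|) ≤ 4 * Real.log (10 + 2 * T) + 44 := by
  have h0 := poleMass_nonneg (show T₀ - T ≤ T₀ + T by linarith)
  -- Either `log (10 + |T₀|)` is comparable with `log (10 + 2T)`, or the interval is far from the
  -- poles and its mass `8T/|T₀|²` beats the logarithm.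
  rcases le_total |T₀| (2 * T) with h | h
  · have h1 : Real.log (10 + |T₀|) ≤ Real.log (10 + 2 * T) :=
      Real.log_le_log (by positivity) (by linarith)
    have h2 : 0 ≤ Real.log (10 + |T₀|) := Real.log_nonneg (by linarith [abs_nonneg T₀])
    have h3 := (poleMass_le_pi (T₀ - T) (T₀ + T)).trans Real.pi_le_four
    calc _ ≤ 4 * Real.log (10 + 2 * T) := by gcongr
      _ ≤ _ := by linarith
  · have hpos : 0 < |T₀| := by linarith
    have hb : poleMass (T₀ - T) (T₀ + T) ≤ 8 * T / |T₀| ^ 2 := by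
      have := intervalIntegral.norm_integral_le_of_norm_le_const (a := T₀ - T) (b := T₀ + T)
        (C := 4 / |T₀| ^ 2) (f := fun τ : ℝ => 1 / (1 + τ ^ 2)) fun τ hτ => by
          rw [uIoc_of_le (by linarith)] at hτ
          rw [Real.norm_of_nonneg (by positivity), div_le_div_iff₀ (by positivity) (by positivity),
            ← sq_abs τ]
          have : |T₀| / 2 ≤ |τ| := by
            have h1 : |T₀| - |τ| ≤ |T₀ - τ| := abs_sub_abs_le_abs_sub _ _
            have h2 : |T₀ - τ| ≤ T := by
              rw [abs_le]; constructor <;> linarith [hτ.1, hτ.2]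
            linarith
          nlinarith
      rw [show T₀ + T - (T₀ - T) = 2 * T by ring, abs_of_nonneg (by linarith : 0 ≤ 2 * T)] at this
      refine (le_abs_self _).trans (this.trans_eq ?_)
      ring
    have hl : Real.log (10 + |T₀|) ≤ 11 / 2 * |T₀| := by
      have := Real.log_le_sub_one_of_pos (show 0 < 10 + |T₀| by linarith)
      linarith
    have hl0 : 0 ≤ Real.log (10 + 2 * T) := Real.log_nonneg (by linarith)
    have hl1 : 0 ≤ Real.log (10 + |T₀|) := Real.log_nonneg (by linarith)
    calc _ ≤ 8 * T / |T₀| ^ 2 * (11 / 2 * |T₀|) := by gcongr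
      _ = 22 * (2 * T / |T₀|) := by field_simp; ring
      _ ≤ 22 * 1 := by gcongr; rwa [div_le_one hpos]
      _ ≤ _ := by linarith

namespace LFunction

variable {d : ℕ}

theorem exists_abs_logL_le (d : ℕ) : ∃ C : ℝ, 0 ≤ C ∧ ∀ (f : LFunction d) (A τ : ℝ), 4 ≤ A →
    |f.logL A τ| ≤ C * 2 ^ (-A) := by
  obtain ⟨C, hC, h⟩ := exists_abs_log_norm_LSeries_le d
  refine ⟨C, hC, fun f A τ hA => ?_⟩
  have hre : (1 / 2 + A + τ * Complex.I : ℂ).re = 1 / 2 + A := by simp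
  rw [logL, f.L_eq_LSeries (by rw [hre]; linarith)]
  refine (h f _ (by rw [hre]; linarith)).trans ?_
  rw [hre]
  gcongr
  · norm_num
  · linarith

theorem conductor_real_pos (f : LFunction d) : (0 : ℝ) < f.conductor := by
  exact_mod_cast f.conductor_pos

theorem one_le_analyticConductor (f : LFunction d) (s : ℂ) : 1 ≤ f.analyticConductor s := by
  have h1 : (1 : ℝ) ≤ f.conductor := by exact_mod_cast f.conductor_pos
  have h2 : (1 : ℝ) ≤ ∏ j, (‖s + f.kappa j‖ + 3) := by
    calc (1 : ℝ) = ∏ j : Fin d, 1 := by simp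
      _ ≤ _ := Finset.prod_le_prod (fun _ _ => zero_le_one)
        fun j _ => by linarith [norm_nonneg (s + f.kappa j)]
  rw [analyticConductor]
  nlinarith

theorem log_analyticConductor (f : LFunction d) (s : ℂ) : Real.log (f.analyticConductor s) =
    Real.log f.conductor + ∑ j, Real.log (‖s + f.kappa j‖ + 3) := by
  have h : ∀ j, ‖s + f.kappa j‖ + 3 ≠ 0 := fun j => by positivity
  rw [analyticConductor, Real.log_mul f.conductor_real_pos.ne'
    (Finset.prod_ne_zero_iff.2 fun j _ => h j), Real.log_prod fun j _ => h j]

/-- Moving the point by at most `B` changes `‖s + κ_j‖ + 3` by at most a factor `B`; this transfers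
the conductor bound at height `t` to other heights and lines. -/
theorem sum_log_norm_shift_le (f : LFunction d) {A B : ℝ} {τ t : ℝ} (hA : 1 / 2 ≤ A)
    (hB : 1 ≤ B) (hAB : A + |τ - t| ≤ B) :
    Real.log f.conductor + ∑ j, Real.log (‖1 / 2 + A + τ * Complex.I + f.kappa j‖ / 2) ≤
      Real.log (f.analyticConductor (1 / 2 + t * Complex.I)) + d * Real.log B := by
  have hj : ∀ j, Real.log (‖1 / 2 + A + τ * Complex.I + f.kappa j‖ / 2) ≤
      Real.log (‖1 / 2 + t * Complex.I + f.kappa j‖ + 3) + Real.log B := by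
    intro j
    have hpos : 0 < ‖1 / 2 + A + τ * Complex.I + f.kappa j‖ :=
      norm_pos_iff.2 (f.shift_add_kappa_ne_zero hA τ j)
    set y := ‖1 / 2 + t * Complex.I + f.kappa j‖ with hy
    have hy0 : 0 ≤ y := norm_nonneg _
    have e : (1 / 2 + A + τ * Complex.I + f.kappa j : ℂ) =
        (1 / 2 + t * Complex.I + f.kappa j) + (A + (τ - t : ℝ) * Complex.I) := by push_cast; ring
    have h1 : ‖(A + (τ - t : ℝ) * Complex.I : ℂ)‖ ≤ B := by
      refine (norm_add_le _ _).trans (le_trans (le_of_eq ?_) hAB)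
      rw [norm_mul, Complex.norm_I, mul_one, Complex.norm_real, Complex.norm_real,
        Real.norm_eq_abs, Real.norm_eq_abs, abs_of_nonneg (by linarith)]
    have h2 : ‖1 / 2 + A + τ * Complex.I + f.kappa j‖ ≤ y + B := by
      rw [e]; exact (norm_add_le _ _).trans (by gcongr)
    rw [← Real.log_mul (by positivity) (by positivity)]
    refine Real.log_le_log (by positivity) ?_
    nlinarith
  have := Finset.sum_le_sum fun j (_ : j ∈ Finset.univ) => hj j
  rw [Finset.sum_add_distrib, Finset.sum_const, Finset.card_univ, Fintype.card_fin,
    nsmul_eq_mul] at this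
  rw [log_analyticConductor]
  linarith

theorem stepLog_le (f : LFunction d) {A B : ℝ} {τ t : ℝ} (hA : 1 / 2 ≤ A) (hB : 1 ≤ B)
    (hAB : A + |τ - t| ≤ B) : f.stepLog A τ ≤
      Real.log (f.analyticConductor (1 / 2 + t * Complex.I)) + d * Real.log B := by
  have h1 := f.sum_log_norm_shift_le hA hB hAB
  have h2 : 0 ≤ d * Real.log Real.pi :=
    mul_nonneg d.cast_nonneg (Real.log_nonneg (by linarith [Real.pi_gt_three]))
  rw [stepLog]
  linarith

/-- From `A ≥ 5/2` and `Re κ_j > -1` one gets `‖s + κ_j‖ / 2 ≥ 1`, so every logarithm in the sum is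
nonnegative. -/
theorem abs_stepLog_le (f : LFunction d) {A B : ℝ} {τ t : ℝ} (hA : 5 / 2 ≤ A) (hB : 1 ≤ B)
    (hAB : A + |τ - t| ≤ B) : |f.stepLog A τ| ≤
      Real.log (f.analyticConductor (1 / 2 + t * Complex.I)) + d * (Real.log B + 3) := by
  have h1 := f.sum_log_norm_shift_le (by linarith : 1 / 2 ≤ A) hB hAB
  have hq : 0 ≤ Real.log f.conductor := Real.log_natCast_nonneg _
  have hπ : 0 ≤ Real.log Real.pi := Real.log_nonneg (by linarith [Real.pi_gt_three])
  have hπ' : Real.log Real.pi ≤ 3 := by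
    have := Real.log_le_sub_one_of_pos Real.pi_pos
    linarith [Real.pi_le_four]
  have hs : 0 ≤ ∑ j, Real.log (‖1 / 2 + A + τ * Complex.I + f.kappa j‖ / 2) := by
    refine Finset.sum_nonneg fun j _ => Real.log_nonneg ?_
    have h2 := (Complex.re_le_norm (1 / 2 + A + τ * Complex.I + f.kappa j))
    have h3 : (1 / 2 + A + τ * Complex.I + f.kappa j : ℂ).re = 1 / 2 + A + (f.kappa j).re := by
      simp
    have := f.kappa_re j
    rw [h3] at h2
    rw [le_div_iff₀ two_pos]
    linarith
  have e1 : (d : ℝ) * Real.log Real.pi ≤ d * 3 := by gcongr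
  have e2 : 0 ≤ d * Real.log Real.pi := by positivity
  have e3 : 0 ≤ d * Real.log B := mul_nonneg d.cast_nonneg (Real.log_nonneg hB)
  have e4 := Real.log_nonneg (f.one_le_analyticConductor (1 / 2 + t * Complex.I))
  rw [stepLog, abs_le]
  constructor <;> linarith

/-- Since `‖s + κ_j‖ ≥ |τ + Im κ_j|`, each term is at most `log (1 + (B - A)/|τ + Im κ_j|)`. The
bound `log (1 + x) ≤ 2√x` turns this into an integrable singularity, uniformly in `κ_j`. -/
theorem stepLog_sub_le (f : LFunction d) {A B τ : ℝ} (hAB : A ≤ B)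
    (hτ : ∀ j, τ + (f.kappa j).im ≠ 0) :
    f.stepLog B τ - f.stepLog A τ ≤
      ∑ j, 2 * √(B - A) * (√|τ + (f.kappa j).im|)⁻¹ := by
  rw [stepLog, stepLog, add_sub_add_left_eq_sub, ← Finset.sum_sub_distrib]
  refine Finset.sum_le_sum fun j _ => ?_
  set y := |τ + (f.kappa j).im| with hy
  have hy0 : 0 < y := abs_pos.2 (hτ j)
  have him : ∀ X : ℝ, y ≤ ‖1 / 2 + X + τ * Complex.I + f.kappa j‖ := fun X => by
    refine le_of_eq_of_le ?_ (Complex.abs_im_le_norm _)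
    rw [hy]; simp
  set z := ‖1 / 2 + A + τ * Complex.I + f.kappa j‖ with hz
  have hz0 : 0 < z := hy0.trans_le (him A)
  have hzB : ‖1 / 2 + B + τ * Complex.I + f.kappa j‖ ≤ z + (B - A) := by
    have e : (1 / 2 + B + τ * Complex.I + f.kappa j : ℂ) =
        (1 / 2 + A + τ * Complex.I + f.kappa j) + ((B - A : ℝ) : ℂ) := by push_cast; ring
    rw [e]
    refine (norm_add_le _ _).trans (le_of_eq ?_)
    rw [Complex.norm_real, Real.norm_of_nonneg (by linarith)]
  have hBpos : 0 < ‖1 / 2 + B + τ * Complex.I + f.kappa j‖ := hy0.trans_le (him B)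
  rw [Real.log_div hBpos.ne' two_ne_zero, Real.log_div hz0.ne' two_ne_zero, sub_sub_sub_cancel_right,
    ← Real.log_div hBpos.ne' hz0.ne']
  have hBA : 0 ≤ B - A := by linarith
  calc Real.log (‖1 / 2 + B + τ * Complex.I + f.kappa j‖ / z) ≤ Real.log (1 + (B - A) / y) := by
        refine Real.log_le_log (by positivity) ?_
        calc _ ≤ (z + (B - A)) / z := by gcongr
          _ = 1 + (B - A) / z := by field_simp
          _ ≤ _ := by gcongr; exact him A
    _ ≤ 2 * √((B - A) / y) := log_one_add_le_two_mul_sqrt (by positivity)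
    _ = _ := by rw [Real.sqrt_div hBA]; ring

theorem integral_stepLog_sub_le (f : LFunction d) {A B p q : ℝ} (hAB : A ≤ B) (hpq : p ≤ q) :
    (∫ τ in p..q, f.stepLog B τ) - (∫ τ in p..q, f.stepLog A τ) ≤
      d * (8 * √(B - A) * √(q - p)) := by
  rw [← intervalIntegral.integral_sub (f.intervalIntegrable_stepLog B p q)
    (f.intervalIntegrable_stepLog A p q)]
  have hj : ∀ j, IntervalIntegrable (fun τ => 2 * √(B - A) * (√|τ + (f.kappa j).im|)⁻¹)
      volume p q := fun j => by
    have := ((intervalIntegrable_inv_sqrt_abs (p + (f.kappa j).im)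
      (q + (f.kappa j).im)).comp_add_right (f.kappa j).im).const_mul (2 * √(B - A))
    simpa using this
  have hae : ∀ᵐ τ : ℝ, ∀ j, τ + (f.kappa j).im ≠ 0 := by
    rw [ae_all_iff]
    intro j
    have : ∀ᵐ τ : ℝ, τ ≠ -(f.kappa j).im := by simp [ae_iff]
    filter_upwards [this] with τ hτ h
    exact hτ (by linarith)
  calc _ ≤ ∫ τ in p..q, ∑ j, 2 * √(B - A) * (√|τ + (f.kappa j).im|)⁻¹ := by
        have hsum : IntervalIntegrable
            (fun τ => ∑ j, 2 * √(B - A) * (√|τ + (f.kappa j).im|)⁻¹) volume p q := by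
          have := IntervalIntegrable.sum Finset.univ fun j _ => hj j
          simpa [Finset.sum_fn] using this
        refine intervalIntegral.integral_mono_ae hpq ((f.intervalIntegrable_stepLog B p q).sub
          (f.intervalIntegrable_stepLog A p q)) hsum ?_
        filter_upwards [hae] with τ hτ
        exact f.stepLog_sub_le hAB hτ
    _ = ∑ j, ∫ τ in p..q, 2 * √(B - A) * (√|τ + (f.kappa j).im|)⁻¹ :=
        intervalIntegral.integral_finsetSum fun j _ => hj j
    _ ≤ ∑ j : Fin d, 8 * √(B - A) * √(q - p) := by
        refine Finset.sum_le_sum fun j _ => ?_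
        rw [intervalIntegral.integral_const_mul,
          intervalIntegral.integral_comp_add_right (fun y => (√|y|)⁻¹) (f.kappa j).im]
        have := integral_inv_sqrt_abs_le (show p + (f.kappa j).im ≤ q + (f.kappa j).im by linarith)
        rw [add_sub_add_right_eq_sub] at this
        calc _ ≤ 2 * √(B - A) * (4 * √(q - p)) := by gcongr
          _ = _ := by ring
    _ = _ := by simp

end LFunction

end

/-! ### Lower bound for the logarithmic mean -/

noncomputable section
open Set Filter Topology MeasureTheory intervalIntegral

namespace LFunction

variable {d : ℕ}

/-- The functional is rewritten through `stepLog` and `logL`. The mean of `logL 0` appears with a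
plus sign, so nonnegativity of the functional bounds it from below. -/
theorem lineFunctional_logCompleted_le (f : LFunction d) {K : ℕ} (hK : 2 ≤ K)
    {W a b a₀ a₁ a₂ V : ℝ}
    (hV : ∀ A τ, (A = 4 ∨ A = 6) → |τ| ≤ 1 →
      |f.stepLog A τ + f.logL (A + 2) τ - f.logL A τ| ≤ V) :
    lineFunctional K W a b a₀ a₁ a₂ f.logCompleted ≤
      K * (1 + ((2 * K + 2) ^ 2 + 1) / W) * ((∫ τ in a..b, f.stepLog (2 * K) τ) +
        ∫ τ in a..b, (f.logL (2 * K + 2) τ - f.logL (2 * K) τ)) -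
      ((∑ i ∈ Finset.range K, ∫ τ in (a + 2 * W)..(b - 2 * W), f.stepLog (2 * i) τ) +
        (∫ τ in (a + 2 * W)..(b - 2 * W), f.logL (2 * K) τ) -
        ∫ τ in (a + 2 * W)..(b - 2 * W), f.logL 0 τ) +
      (|a₀| + 2 * |a₁| + |a₂|) * V := by
  have hK' : (2 : ℝ) ≤ K := by exact_mod_cast hK
  have hstep : ∀ {A : ℝ} (τ : ℝ), 1 ≤ A → f.logCompleted (A + 2) τ - f.logCompleted A τ =
      f.stepLog A τ + f.logL (A + 2) τ - f.logL A τ := fun τ hA =>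
    f.logCompleted_add_two (by linarith) (f.shift_add_kappa_ne_zero (by linarith) τ)
      (f.completed_ne_zero_right hA τ)
  have hL : ∀ {A : ℝ}, 1 ≤ A → ∀ p q, IntervalIntegrable (f.logL A) volume p q :=
    fun hA p q => f.intervalIntegrable_logL (Or.inr hA) p q
  have e1 : ∫ τ in a..b, (f.logCompleted (2 * K + 2) τ - f.logCompleted (2 * K) τ) =
      (∫ τ in a..b, f.stepLog (2 * K) τ) +
        ∫ τ in a..b, (f.logL (2 * K + 2) τ - f.logL (2 * K) τ) := by
    rw [← intervalIntegral.integral_add (f.intervalIntegrable_stepLog _ _ _)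
      ((hL (by linarith) _ _).sub (hL (by linarith) _ _))]
    refine integral_congr fun τ _ => ?_
    rw [hstep τ (by linarith)]
    ring
  have e2 : ∫ τ in (a + 2 * W)..(b - 2 * W), (f.logCompleted (2 * K) τ - f.logCompleted 0 τ) =
      (∑ i ∈ Finset.range K, ∫ τ in (a + 2 * W)..(b - 2 * W), f.stepLog (2 * i) τ) +
        (∫ τ in (a + 2 * W)..(b - 2 * W), f.logL (2 * K) τ) -
        ∫ τ in (a + 2 * W)..(b - 2 * W), f.logL 0 τ := by
    have hs : IntervalIntegrable (fun τ => ∑ i ∈ Finset.range K, f.stepLog (2 * i) τ) volume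
        (a + 2 * W) (b - 2 * W) := by
      have := IntervalIntegrable.sum (Finset.range K) fun i _ =>
        f.intervalIntegrable_stepLog (2 * i) (a + 2 * W) (b - 2 * W)
      simpa [Finset.sum_fn] using this
    rw [← intervalIntegral.integral_finsetSum fun i _ => f.intervalIntegrable_stepLog _ _ _,
      ← intervalIntegral.integral_add hs (hL (by linarith) _ _),
      ← intervalIntegral.integral_sub (hs.add (hL (by linarith) _ _))
        (f.intervalIntegrable_logL (Or.inl rfl) _ _)]
    refine integral_congr_ae ?_
    filter_upwards [f.ae_completed_ne_zero 0, f.ae_line_add_kappa_ne_zero 0] with τ h1 h2 _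
    exact f.logCompleted_sub_eq_sum h2 h1 K
  have c64 : ∀ τ, |τ| ≤ 1 → |f.logCompleted 6 τ - f.logCompleted 4 τ| ≤ V := fun τ hτ => by
    have h1 := hstep (A := 4) τ (by norm_num)
    have h2 := hV 4 τ (Or.inl rfl) hτ
    rw [← h1] at h2
    norm_num at h2
    exact h2
  have c86 : |f.logCompleted 8 0 - f.logCompleted 6 0| ≤ V := by
    have h1 := hstep (A := 6) 0 (by norm_num)
    have h2 := hV 6 0 (Or.inr rfl) (by norm_num)
    rw [← h1] at h2
    norm_num at h2
    exact h2
  have j2 : a₀ * (f.logCompleted 6 0 - f.logCompleted 4 0) ≤ |a₀| * V := by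
    refine (le_abs_self _).trans ?_
    rw [abs_mul]; gcongr; exact c64 0 (by norm_num)
  have j3 : a₁ * ((f.logCompleted 6 1 - f.logCompleted 4 1) -
      (f.logCompleted 6 (-1) - f.logCompleted 4 (-1))) ≤ |a₁| * (V + V) := by
    refine (le_abs_self _).trans ?_
    rw [abs_mul]; gcongr
    exact (abs_sub _ _).trans (add_le_add (c64 1 (by norm_num)) (c64 (-1) (by norm_num)))
  have j4 : a₂ * (f.logCompleted 8 0 - f.logCompleted 6 0) ≤ |a₂| * V := by
    refine (le_abs_self _).trans ?_
    rw [abs_mul]; gcongr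
  rw [lineFunctional, e1, e2]
  linarith

-- With `W = √T`, the terms `K ∫ stepLog (2K)` and `∑ ∫ stepLog (2i)` cancel up to `O(√T log)`. The
-- Dirichlet series lose `2K · 2e + e = (4K + 1)e` per unit length, and the pole correction costs
-- only logarithms.
set_option maxHeartbeats 1000000 in
theorem exists_integral_logL_lower_bound (d : ℕ) {K : ℕ} (hK : 2 ≤ K) {C : ℝ} (hC : 0 ≤ C)
    (hL : ∀ (f : LFunction d) (A τ : ℝ), 4 ≤ A → |f.logL A τ| ≤ C * 2 ^ (-A)) :
    ∃ B : ℝ, 0 ≤ B ∧ ∀ (f : LFunction d) (T₀ T Q : ℝ), 1 ≤ T → 10 * ((K : ℝ) + 1) ≤ √T →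
      (2 * (K : ℝ) + 2) ^ 2 + 1 ≤ √T →
      (∀ t : ℝ, T₀ - T ≤ t → t ≤ T₀ + T →
        f.analyticConductor (1 / 2 + t * Complex.I) ≤ Q) →
      -((4 * K + 1) * (C * 2 ^ (-(2 * K : ℝ))) * (2 * T)) -
          B * (√T * (1 + Real.log Q + Real.log (10 + 2 * T))) ≤
        ∫ τ in (T₀ - T + 2 * √T)..(T₀ + T - 2 * √T), f.logL 0 τ := by
  have hK' : (2 : ℝ) ≤ K := by exact_mod_cast hK
  obtain ⟨P, hP, hfun⟩ := exists_lineFunctional_nonneg (K := K) (by linarith)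
  set δ₀ : ℝ := (2 * (K : ℝ) + 2) ^ 2 + 1 with hδ₀
  have hδ₀0 : 0 ≤ δ₀ := by positivity
  have hlogK : 0 ≤ Real.log (2 * K + 1) := Real.log_nonneg (by linarith)
  refine ⟨32 * d * K ^ 2 + (4 * K + 2 * K * δ₀) * (1 + d * Real.log (2 * K + 1)) +
    4 * P * (4 * (1 + 3 * d + 2 * C) + 48 * d), by positivity,
    fun f T₀ T Q hT hS1 hS2 hQ => ?_⟩
  set S := √T with hS
  have hSsq : S * S = T := Real.mul_self_sqrt (by linarith)
  have hS30 : 30 ≤ S := by linarith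
  set a := T₀ - T with ha
  set b := T₀ + T with hb
  have hab4 : a + 4 * S ≤ b := by rw [ha, hb]; nlinarith only [hSsq, hS30]
  have hba : b - a = 2 * T := by rw [ha, hb]; ring
  have hQ1 : 1 ≤ Q := (f.one_le_analyticConductor _).trans (hQ T₀ (by linarith) (by linarith))
  have hlogQ : 0 ≤ Real.log Q := Real.log_nonneg hQ1
  have hlogcond : ∀ t, a ≤ t → t ≤ b →
      Real.log (f.analyticConductor (1 / 2 + t * Complex.I)) ≤ Real.log Q := fun t h1 h2 =>
    Real.log_le_log (by linarith [f.one_le_analyticConductor (1 / 2 + t * Complex.I)]) (hQ t h1 h2)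
  set M := Real.log Q + d * Real.log (2 * K + 1) with hM
  have hM0 : 0 ≤ M := by positivity
  have hD : ∀ τ ∈ Icc a b, f.stepLog (2 * K) τ ≤ M := fun τ hτ => by
    have := f.stepLog_le (A := 2 * K) (B := 2 * K + 1) (τ := τ) (t := τ) (by linarith)
      (by linarith) (by rw [sub_self, abs_zero]; linarith)
    have := hlogcond τ hτ.1 hτ.2
    linarith
  -- the integrals of the contributions of the factors at infinity
  have hDi := f.intervalIntegrable_stepLog (2 * K)
  have hconst : ∀ {p q : ℝ}, a ≤ p → p ≤ q → q ≤ b →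
      ∫ τ in p..q, f.stepLog (2 * K) τ ≤ (q - p) * M := by
    intro p q h1 h2 h3
    have := integral_mono_on h2 (hDi p q) (intervalIntegrable_const (c := M))
      fun τ hτ => hD τ ⟨h1.trans hτ.1, hτ.2.trans h3⟩
    rwa [intervalIntegral.integral_const, smul_eq_mul] at this
  set X := ∫ τ in a..b, f.stepLog (2 * K) τ with hX
  set Y := ∫ τ in (a + 2 * S)..(b - 2 * S), f.stepLog (2 * K) τ with hY
  have hX1 : X ≤ Y + 4 * S * M := by
    rw [hX, ← integral_add_adjacent_intervals (hDi a (b - 2 * S)) (hDi _ b),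
      ← integral_add_adjacent_intervals (hDi a (a + 2 * S)) (hDi _ (b - 2 * S))]
    have h1 := hconst (p := a) (q := a + 2 * S) le_rfl (by linarith) (by linarith)
    have h2 := hconst (p := b - 2 * S) (q := b) (by linarith) (by linarith) le_rfl
    linarith
  have hX2 : X ≤ 2 * T * M := by
    have := hconst (p := a) (q := b) le_rfl (by linarith) le_rfl
    rwa [hba] at this
  -- The end pieces have total length `4S`, and the excess factor `δ₀/S` acts on an integral of size
  -- `2TM = 2S²M`, so both losses are `O(SM)`.
  have hcX : K * (1 + δ₀ / S) * X ≤ K * Y + (4 * K + 2 * K * δ₀) * (S * M) := by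
    have h1 : K * X ≤ K * (Y + 4 * S * M) := by gcongr
    have h2 : K * (δ₀ / S) * X ≤ K * (δ₀ / S) * (2 * T * M) := by gcongr
    have h3 : K * (δ₀ / S) * (2 * T * M) = 2 * K * δ₀ * (S * M) := by
      rw [← hSsq]; field_simp
    linarith
  -- Only a lower bound for the steps at `2i` is needed. Using `√(2K - 2i) ≤ 2K` and length at most
  -- `(2S)²`, each costs `32dKS`.
  have hZ : K * Y - 32 * d * K ^ 2 * S ≤
      ∑ i ∈ Finset.range K, ∫ τ in (a + 2 * S)..(b - 2 * S), f.stepLog (2 * i) τ := by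
    have hi : ∀ i ∈ Finset.range K, Y - 32 * d * K * S ≤
        ∫ τ in (a + 2 * S)..(b - 2 * S), f.stepLog (2 * i) τ := by
      intro i hi
      have hiK : (i : ℝ) ≤ K := by exact_mod_cast (Finset.mem_range.1 hi).le
      have h1 := f.integral_stepLog_sub_le (A := 2 * i) (B := 2 * K) (by linarith)
        (show a + 2 * S ≤ b - 2 * S by linarith)
      have h2 : √(2 * K - 2 * i : ℝ) ≤ 2 * K := by
        rw [Real.sqrt_le_left (by positivity)]
        have : (0 : ℝ) ≤ i := i.cast_nonneg
        nlinarith only [this, hK']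
      have h3 : √(b - 2 * S - (a + 2 * S)) ≤ 2 * S := by
        rw [Real.sqrt_le_left (by positivity)]
        nlinarith only [hSsq, hba, hS30, hT]
      have h4 : (d : ℝ) * (8 * √(2 * K - 2 * i) * √(b - 2 * S - (a + 2 * S))) ≤
          d * (8 * (2 * K) * (2 * S)) := by gcongr
      linarith
    have := Finset.sum_le_sum hi
    rw [Finset.sum_const, Finset.card_range, nsmul_eq_mul] at this
    linarith
  -- the contributions of the Dirichlet series
  set e := C * 2 ^ (-(2 * K : ℝ)) with he
  have he0 : 0 ≤ e := by positivity
  have hL1 : ∀ τ, |f.logL (2 * K) τ| ≤ e := fun τ => hL f _ τ (by linarith)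
  have hL2 : ∀ τ, |f.logL (2 * K + 2) τ| ≤ e := fun τ => by
    refine (hL f _ τ (by linarith)).trans ?_
    rw [he]; gcongr
    · norm_num
    · linarith
  have hc2 : K * (1 + δ₀ / S) ≤ 2 * K := by
    have : δ₀ / S ≤ 1 := by rw [div_le_one (by linarith)]; exact hS2
    nlinarith only [this, hK']
  have hI1 : |∫ τ in a..b, (f.logL (2 * K + 2) τ - f.logL (2 * K) τ)| ≤ 2 * e * (2 * T) := by
    have := intervalIntegral.norm_integral_le_of_norm_le_const (a := a) (b := b) (C := 2 * e)
      (f := fun τ => f.logL (2 * K + 2) τ - f.logL (2 * K) τ) fun τ _ =>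
        (abs_sub _ _).trans (by linarith [hL1 τ, hL2 τ])
    rwa [hba, abs_of_nonneg (by linarith : 0 ≤ 2 * T)] at this
  have hcI1 : K * (1 + δ₀ / S) * ∫ τ in a..b, (f.logL (2 * K + 2) τ - f.logL (2 * K) τ) ≤
      2 * K * (2 * e * (2 * T)) := by
    refine (le_abs_self _).trans ?_
    rw [abs_mul, abs_of_nonneg (by positivity)]
    gcongr
  have hI2 : |∫ τ in (a + 2 * S)..(b - 2 * S), f.logL (2 * K) τ| ≤ e * (2 * T) := by
    have := intervalIntegral.norm_integral_le_of_norm_le_const (a := a + 2 * S) (b := b - 2 * S)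
      (C := e) (f := fun τ => f.logL (2 * K) τ) fun τ _ => hL1 τ
    refine this.trans ?_
    rw [abs_of_nonneg (by linarith)]
    gcongr
    linarith
  -- the correction at the poles
  obtain ⟨a₀, a₁, a₂, b0, b1, b2, hzero, hnonneg⟩ := hfun a b S hS1 hS2 hab4
  set ω := poleMass a b with hω
  have hω0 : 0 ≤ ω := poleMass_nonneg (by linarith)
  have hωπ : ω ≤ 4 := (poleMass_le_pi a b).trans Real.pi_le_four
  have hωl : ω * Real.log (10 + |T₀|) ≤ 4 * Real.log (10 + 2 * T) + 44 := poleMass_mul_log_le hT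
  set V := Real.log Q + d * (Real.log (10 + |T₀|) + 3) + 2 * C with hV
  have hV0 : 0 ≤ V := by
    have : 0 ≤ Real.log (10 + |T₀|) := Real.log_nonneg (by linarith [abs_nonneg T₀])
    positivity
  have hVle : ∀ A τ, (A = 4 ∨ A = 6) → |τ| ≤ 1 →
      |f.stepLog A τ + f.logL (A + 2) τ - f.logL A τ| ≤ V := by
    intro A τ hA hτ
    have hA4 : 4 ≤ A := by rcases hA with rfl | rfl <;> norm_num
    have hA6 : A ≤ 6 := by rcases hA with rfl | rfl <;> norm_num
    -- The correction lives near height `0`, where the conductor need not be bounded by `Q`;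
    -- comparison with height `T₀` costs `log (10 + |T₀|)` for each factor.
    have h1 := f.abs_stepLog_le (A := A) (B := 10 + |T₀|) (τ := τ) (t := T₀) (by linarith)
      (by linarith [abs_nonneg T₀]) (by linarith [abs_sub τ T₀])
    have h2 := hlogcond T₀ (by linarith) (by linarith)
    have h3 : ∀ A', 4 ≤ A' → |f.logL A' τ| ≤ C := fun A' hA' => by
      refine (hL f A' τ hA').trans (mul_le_of_le_one_right hC ?_)
      exact Real.rpow_le_one_of_one_le_of_nonpos one_le_two (by linarith)
    have h4 := h3 A hA4
    have h5 := h3 (A + 2) (by linarith)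
    rw [abs_le] at h1 h4 h5 ⊢
    constructor <;> linarith [h1.1, h1.2, h4.1, h4.2, h5.1, h5.2]
  -- The product `ω * log (10 + |T₀|)` is bounded through `hωl`, which removes the dependence on
  -- `T₀`.
  have hcorr : (|a₀| + 2 * |a₁| + |a₂|) * V ≤
      4 * P * (4 * (Real.log Q + 3 * d + 2 * C) + d * (4 * Real.log (10 + 2 * T) + 44)) := by
    calc (|a₀| + 2 * |a₁| + |a₂|) * V ≤ (4 * (P * ω)) * V := by gcongr; linarith
      _ = 4 * P * (ω * (Real.log Q + 3 * d + 2 * C) + d * (ω * Real.log (10 + |T₀|))) := by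
          rw [hV]; ring
      _ ≤ _ := by gcongr
  have hJ := f.lineFunctional_logCompleted_nonneg (by linarith) (by linarith : 0 < S) hab4 hzero
    hnonneg
  have hJ' := f.lineFunctional_logCompleted_le hK (a₀ := a₀) (a₁ := a₁) (a₂ := a₂)
    (W := S) (a := a) (b := b) hVle
  rw [← hδ₀, mul_add] at hJ'
  have hmain : -((4 * K + 1) * e * (2 * T)) - (32 * d * K ^ 2 * S +
      (4 * K + 2 * K * δ₀) * (S * M) + 4 * P * (4 * (Real.log Q + 3 * d + 2 * C) +
        d * (4 * Real.log (10 + 2 * T) + 44))) ≤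
      ∫ τ in (a + 2 * S)..(b - 2 * S), f.logL 0 τ := by
    have hI2' := (abs_le.1 hI2).1
    linarith only [hI2', hJ, hJ', hcorr, hcI1, hcX, hZ]
  refine le_trans ?_ hmain
  set l := Real.log (10 + 2 * T) with hl
  have hl0 : 0 ≤ l := Real.log_nonneg (by linarith)
  set U := 1 + Real.log Q + l with hU
  have hU1 : 1 ≤ U := by linarith
  have hSU : U ≤ S * U := by nlinarith only [hS30, hU1]
  have k1 : 32 * d * K ^ 2 * S ≤ 32 * d * K ^ 2 * (S * U) := by
    gcongr; nlinarith only [hS30, hU1]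
  have k2 : M ≤ (1 + d * Real.log (2 * K + 1)) * U := by
    have : d * Real.log (2 * K + 1) * 1 ≤ d * Real.log (2 * K + 1) * U := by gcongr
    rw [hM]; linarith only [this, hl0, hlogQ, hU]
  have k3 : (4 * K + 2 * K * δ₀) * (S * M) ≤
      (4 * K + 2 * K * δ₀) * (1 + d * Real.log (2 * K + 1)) * (S * U) := by
    calc _ ≤ (4 * K + 2 * K * δ₀) * (S * ((1 + d * Real.log (2 * K + 1)) * U)) := by gcongr
      _ = _ := by ring
  have k4 : 4 * (Real.log Q + 3 * d + 2 * C) + d * (4 * l + 44) ≤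
      (4 * (1 + 3 * d + 2 * C) + 48 * d) * U := by
    have q1 : (d : ℝ) * 1 ≤ d * U := by gcongr
    have q2 : C * 1 ≤ C * U := by gcongr
    have q3 : (d : ℝ) * l ≤ d * U := by gcongr; linarith
    linarith only [q1, q2, q3, hU, hlogQ, hl0]
  have k5 : 4 * P * (4 * (Real.log Q + 3 * d + 2 * C) + d * (4 * l + 44)) ≤
      4 * P * (4 * (1 + 3 * d + 2 * C) + 48 * d) * (S * U) := by
    calc _ ≤ 4 * P * ((4 * (1 + 3 * d + 2 * C) + 48 * d) * U) := by gcongr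
      _ ≤ 4 * P * ((4 * (1 + 3 * d + 2 * C) + 48 * d) * (S * U)) := by gcongr
      _ = _ := by ring
  linarith only [k1, k3, k5]

end LFunction

end

/-! ### Choice of `K` and passage to the second moment -/

noncomputable section
open Set Filter Topology MeasureTheory intervalIntegral

/-- This fixes `K` in terms of `d` alone (through `C`): the decay `4^{-K}` beats the linear loss in
`K`. -/
theorem exists_mul_rpow_le (C : ℝ) : ∃ K : ℕ, 2 ≤ K ∧
    (4 * K + 1) * (C * 2 ^ (-(2 * K : ℝ))) ≤ 1 / 16 := by
  have h1 := tendsto_self_mul_const_pow_of_lt_one (r := (1 / 4 : ℝ)) (by norm_num) (by norm_num)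
  have h2 := tendsto_pow_atTop_nhds_zero_of_lt_one (r := (1 / 4 : ℝ)) (by norm_num) (by norm_num)
  have h3 := (((h1.const_mul 4).add h2).const_mul C)
  rw [mul_zero, add_zero, mul_zero] at h3
  have h4 := h3.eventually_le_const (show (0 : ℝ) < 1 / 16 by norm_num)
  obtain ⟨K, hK, hK2⟩ := (h4.and (eventually_ge_atTop 2)).exists
  refine ⟨K, hK2, le_of_eq_of_le ?_ hK⟩
  have e : (2 : ℝ) ^ (-(2 * K : ℝ)) = (1 / 4) ^ K := by
    rw [Real.rpow_neg zero_le_two, Real.rpow_mul zero_le_two, Real.rpow_natCast, one_div, inv_pow]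
    norm_num
  rw [e]
  ring

theorem eventually_sqrt_mul_log_le {B ε : ℝ} (hB : 0 ≤ B) (hε : 0 < ε) : ∀ᶠ T : ℝ in atTop,
    B * (√T * (1 + Real.log T / ε + Real.log (10 + 2 * T))) ≤ T / 8 := by
  have hsqrt := Real.tendsto_sqrt_atTop
  have hlog := (isLittleO_log_rpow_atTop (r := 1 / 2) (by norm_num)).bound
    (show 0 < 1 / (16 * (B * (1 / ε + 1) + 1)) by positivity)
  filter_upwards [hlog, hsqrt.eventually_ge_atTop (16 * (12 * B)), eventually_ge_atTop 1]
    with T h1 h2 hT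
  have hT0 : 0 ≤ T := by linarith
  have hl0 : 0 ≤ Real.log T := Real.log_nonneg hT
  rw [Real.norm_of_nonneg hl0, Real.norm_of_nonneg (by positivity), ← Real.sqrt_eq_rpow] at h1
  have h3 : Real.log (10 + 2 * T) ≤ 11 + Real.log T := by
    calc Real.log (10 + 2 * T) ≤ Real.log (12 * T) := Real.log_le_log (by linarith) (by linarith)
      _ = Real.log 12 + Real.log T := Real.log_mul (by norm_num) (by linarith)
      _ ≤ _ := by
        have := Real.log_le_sub_one_of_pos (show (0 : ℝ) < 12 by norm_num)
        linarith
  have hs := Real.sqrt_nonneg T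
  have h4 : B * (1 / ε + 1) * Real.log T ≤ √T / 16 := by
    calc _ ≤ B * (1 / ε + 1) * (1 / (16 * (B * (1 / ε + 1) + 1)) * √T) := by gcongr
      _ = (B * (1 / ε + 1)) / (B * (1 / ε + 1) + 1) * (√T / 16) := by field_simp
      _ ≤ 1 * (√T / 16) := by
        gcongr
        rw [div_le_one (by positivity)]
        linarith
      _ = _ := one_mul _
  have h5 : B * (1 + Real.log T / ε + Real.log (10 + 2 * T)) ≤ √T / 8 := by
    have : B * (1 + Real.log T / ε + Real.log (10 + 2 * T)) ≤
        B * (1 + Real.log T / ε + (11 + Real.log T)) := by gcongr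
    have e : B * (1 + Real.log T / ε + (11 + Real.log T)) =
        12 * B + B * (1 / ε + 1) * Real.log T := by ring
    linarith
  calc _ = √T * (B * (1 + Real.log T / ε + Real.log (10 + 2 * T))) := by ring
    _ ≤ √T * (√T / 8) := by gcongr
    _ = T / 8 := by rw [← mul_div_assoc, Real.mul_self_sqrt hT0]

namespace LFunction

variable {d : ℕ}

/-- A lower bound for the second moment from one for the logarithmic mean. -/
theorem le_integral_norm_L_sq (f : LFunction d) {a b p q : ℝ} (hap : a ≤ p) (hpq : p ≤ q)
    (hqb : q ≤ b) : (q - p) + 2 * ∫ τ in p..q, f.logL 0 τ ≤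
      ∫ τ in a..b, ‖f.L (1 / 2 + τ * Complex.I)‖ ^ 2 := by
  have e : ∀ τ : ℝ, (1 / 2 + (0 : ℝ) + τ * Complex.I : ℂ) = 1 / 2 + τ * Complex.I := fun τ => by
    rw [Complex.ofReal_zero, add_zero]
  have hcont : Continuous fun τ : ℝ => ‖f.L (1 / 2 + τ * Complex.I)‖ ^ 2 := by
    have := f.continuous_L_line (Or.inl rfl)
    simp only [e] at this
    exact this.norm.pow 2
  have hi := (f.intervalIntegrable_logL (Or.inl rfl) p q).const_mul 2
  have hne : ∀ᵐ τ : ℝ, f.L (1 / 2 + τ * Complex.I) ≠ 0 := by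
    filter_upwards [f.ae_completed_ne_zero 0, f.ae_line_add_kappa_ne_zero 0] with τ h1 h2
    rw [e] at h1
    simp only [e] at h2
    have h3 := f.archFactor_ne_zero (s := 1 / 2 + τ * Complex.I) (by simp) h2
    rw [L]
    exact mul_ne_zero h1 (inv_ne_zero h3)
  calc (q - p) + 2 * ∫ τ in p..q, f.logL 0 τ = ∫ τ in p..q, (1 + 2 * f.logL 0 τ) := by
        rw [intervalIntegral.integral_add intervalIntegrable_const hi,
          intervalIntegral.integral_const, intervalIntegral.integral_const_mul, smul_eq_mul, mul_one]
    _ ≤ ∫ τ in p..q, ‖f.L (1 / 2 + τ * Complex.I)‖ ^ 2 := by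
        refine intervalIntegral.integral_mono_ae hpq (intervalIntegrable_const.add hi)
          (hcont.intervalIntegrable p q) ?_
        filter_upwards [hne] with τ hτ
        have hpos := norm_pos_iff.2 hτ
        -- The inequality `log x ≤ x - 1` at `x = ‖L‖²` replaces the concavity form of Jensen's
        -- inequality.
        have := Real.log_le_sub_one_of_pos (show 0 < ‖f.L (1 / 2 + τ * Complex.I)‖ ^ 2 by positivity)
        rw [Real.log_pow] at this
        rw [logL, e]
        push_cast at this
        linarith
    _ ≤ _ := integral_mono_interval hap hpq hqb (Eventually.of_forall fun τ => by positivity)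
        (hcont.intervalIntegrable a b)

end LFunction

end

theorem proposition7p5 (d : ℕ) (hd : 1 ≤ d) (ε : ℝ) (hε : 0 < ε) :
    ∃ C : ℝ, 0 < C ∧ ∀ (f : LFunction d) (T₀ T Q : ℝ), 0 < T →
      (∀ t : ℝ, T₀ - T ≤ t → t ≤ T₀ + T →
        f.analyticConductor (1 / 2 + t * Complex.I) ≤ Q) →
      Q ^ ε ≤ T →
      T - C * Q ^ (-99 : ℤ) ≤
        ∫ t in (T₀ - T)..(T₀ + T), ‖f.L (1 / 2 + t * Complex.I)‖ ^ 2 := by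
  obtain ⟨C, hC, hL⟩ := LFunction.exists_abs_logL_le d
  obtain ⟨K, hK, hKC⟩ := exists_mul_rpow_le C
  obtain ⟨B, hB, hlow⟩ := LFunction.exists_integral_logL_lower_bound d hK hC hL
  have hsqrt := Real.tendsto_sqrt_atTop
  obtain ⟨N, hN⟩ := Filter.eventually_atTop.1 ((((eventually_sqrt_mul_log_le hB hε).and
    (hsqrt.eventually_ge_atTop (10 * ((K : ℝ) + 1)))).and
    (hsqrt.eventually_ge_atTop ((2 * (K : ℝ) + 2) ^ 2 + 1))).and
    (Filter.eventually_ge_atTop (64 : ℝ)))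
  set N' := max N 1 with hN'
  have hN'0 : 0 < N' := lt_of_lt_of_le one_pos (le_max_right _ _)
  -- For `T < N'` the hypothesis `Q^ε ≤ T` gives `Q ≤ N'^{1/ε}`. This constant then makes `C Q^{-99}
  -- ≥ N' > T`, and the claim is trivial.
  refine ⟨N' * (N' ^ (1 / ε)) ^ 99, by positivity, fun f T₀ T Q hT hQ hQT => ?_⟩
  have hQ1 : 1 ≤ Q := (f.one_le_analyticConductor _).trans (hQ T₀ (by linarith) (by linarith))
  have hQ0 : 0 < Q := by linarith
  rcases lt_or_ge T N' with hlt | hge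
  · have hQN : Q ≤ N' ^ (1 / ε) := by
      calc Q = (Q ^ ε) ^ (1 / ε) := by
            rw [← Real.rpow_mul hQ0.le, mul_one_div_cancel hε.ne', Real.rpow_one]
        _ ≤ N' ^ (1 / ε) := Real.rpow_le_rpow (by positivity) (hQT.trans hlt.le) (by positivity)
    have h1 : 1 ≤ (N' ^ (1 / ε)) ^ 99 * Q ^ (-99 : ℤ) := by
      rw [zpow_neg, ← div_eq_mul_inv, one_le_div (by positivity)]
      exact pow_le_pow_left₀ hQ0.le hQN 99
    have h2 : T ≤ N' * (N' ^ (1 / ε)) ^ 99 * Q ^ (-99 : ℤ) := by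
      calc T ≤ N' * 1 := by linarith
        _ ≤ N' * ((N' ^ (1 / ε)) ^ 99 * Q ^ (-99 : ℤ)) := by gcongr
        _ = _ := by ring
    have h3 : 0 ≤ ∫ t in (T₀ - T)..(T₀ + T), ‖f.L (1 / 2 + t * Complex.I)‖ ^ 2 :=
      intervalIntegral.integral_nonneg (by linarith) fun t _ => by positivity
    linarith
  -- For large `T` the count is `2T - 4√T ≥ 3T/2`, and twice the logarithmic mean loses at most
  -- `2(T/8 + T/8) = T/2`.
  · obtain ⟨⟨⟨h1, h2⟩, h3⟩, h4⟩ := hN T ((le_max_left _ _).trans hge)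
    have hS : √T * √T = T := Real.mul_self_sqrt hT.le
    have hS8 : 8 ≤ √T := by
      rw [Real.le_sqrt (by norm_num) hT.le]; linarith
    have hlogQ : Real.log Q ≤ Real.log T / ε := by
      rw [le_div_iff₀ hε, mul_comm, ← Real.log_rpow hQ0]
      exact Real.log_le_log (by positivity) hQT
    have h5 := hlow f T₀ T Q (by linarith) h2 h3 hQ
    have h6 : B * (√T * (1 + Real.log Q + Real.log (10 + 2 * T))) ≤ T / 8 :=
      le_trans (by gcongr) h1
    have h7 : (4 * K + 1) * (C * 2 ^ (-(2 * K : ℝ))) * (2 * T) ≤ 1 / 16 * (2 * T) := by gcongr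
    have h8 : 4 * √T ≤ T / 2 := by nlinarith
    have h9 := f.le_integral_norm_L_sq (a := T₀ - T) (b := T₀ + T) (p := T₀ - T + 2 * √T)
      (q := T₀ + T - 2 * √T) (by linarith) (by linarith) (by linarith)
    have h10 : 0 ≤ N' * (N' ^ (1 / ε)) ^ 99 * Q ^ (-99 : ℤ) := by positivity
    linarith
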